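/- \textbf{Setting.} Fix integers $L,n_0,n_{L+1}\ge 1$, constants $C_b\ge 0$, $C_W>0$, a finite set $A$, inputs $x_\alpha=(x_{\alpha,1},\dots,x_{\alpha,n_0})\in\mathbb R^{n_0}$ ($\alpha\in A$), and a bounded continuous function $\sigma:\mathbb R\to\mathbb R$. For $n\ge 1$ let $n_1(n),\dots,n_L(n)$ be positive integers that all tend to $\infty$ as $n\to\infty$. Assume that there are $\widehat\ell\in\{1,\dots,L\}$ and $\gamma_1,\dots,\gamma_L\in[1,\infty]$ such that, with $v_n^*:=n_{\widehat\ell}(n)$, $$\lim_{n\to\infty} n_\ell(n)/v_n^*=\gamma_\ell\qquad(\ell=1,\dots,L).$$ For each $n$ consider the fully connected network with hidden widths $n_\ell=n_\ell(n)$, $$Z_i^{(1)}(x)=b_i^{(1)}+\sum_{r=1}^{n_0}W_{ir}^{(1)}x_r,\qquad Z_i^{(\ell+1)}(x)=b_i^{(\ell+1)}+\sum_{j=1}^{n_\ell}W_{ij}^{(\ell+1)}\sigma(Z_j^{(\ell)}(x))\quad(1\le\ell\le L),$$ where all the $b_i^{(\ell+1)}\sim N(0,C_b)$ and $W_{ij}^{(\ell+1)}\sim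 N(0,C_W/n_\ell)$ ($0\le\ell\le L$) are independent. \textbf{Notation.} $q^{\#}$ is the unique symmetric positive semidefinite square root of a symmetric positive semidefinite matrix $q\in\mathbb R^{A\times A}$; $\mathbf 1\in\mathbb R^{A\times A}$ is the matrix with all entries $1$; $\mathcal S$ is the set of symmetric positive semidefinite $q\in\mathbb R^{A\times A}$ such that $q-C_b\mathbf 1$ is positive semidefinite. Let $(N_\gamma)_{\gamma\in A}$ be independent standard normal variables, $\sigma_\alpha(q):=\sigma\big(\sum_{\gamma\in A}q^{\#}_{\alpha\gamma}N_\gamma\big)$, and for $\eta,y\in\mathbb R^{A\times A}$ put $$\kappa(\eta;q)=\log\mathbb E\Big[\exp\sum_{\alpha,\beta}\eta_{\alpha\beta}\,\sigma_\alpha(q)\sigma_\beta(q)\Big],\qquad \kappa^*(y;q)=\sup_{\eta}\Big\{\sum_{\alpha,\beta}\eta_{\alpha\beta}y_{\alpha\beta}-\kappa(\eta;q)\Big\},\qquad y_{\alpha\beta}(q)=\mathbb E[\sigma_\alpha(q)\sigma_\beta(q)].$$ Let $\Delta(r;r')=0$ if $r=r'$ and $\Delta(r;r')=\infty$ otherwise.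 For $g,q\in\mathcal S$ and $\ell=1,\dots,L$ put $$J_\ell(g|q)=\begin{cases}\gamma_\ell\,\kappa^*\big((g-C_b\mathbf 1)/C_W;\,q\big)&\text{if }\gamma_\ell<\infty,\\ \Delta\big(g;\,C_b\mathbf 1+C_Wy(q)\big)&\text{if }\gamma_\ell=\infty.\end{cases}$$ Let $g^{(0)}_{\alpha\beta}=C_b+\frac{C_W}{n_0}\sum_{r=1}^{n_0}x_{\alpha,r}x_{\beta,r}$ and, for $g^{(L)}\in\mathcal S$, $$I_{G^{(L)}}(g^{(L)})=\inf\Big\{\sum_{\ell=1}^{L}J_\ell(g^{(\ell)}|g^{(\ell-1)}):\ g^{(1)},\dots,g^{(L-1)}\in\mathcal S\Big\}.$$ \textbf{Theorem (large deviations).} The random elements $\big(Z_h^{(L+1)}(x_\alpha)/\sqrt{v_n^*}\big)_{\alpha\in A,\,1\le h\le n_{L+1}}$ satisfy, as $n\to\infty$, the large deviation principle on $\mathbb R^{A\times n_{L+1}}$ with speed $v_n^*$ and rate function $$I(z)=\inf\Big\{I_{G^{(L)}}(g)+\tfrac12\|r\|^2:\ g\in\mathcal S,\ r\in\mathbb R^{A\times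 n_{L+1}},\ g^{\#}r=z\Big\},$$ where $\|\cdot\|$ is the Euclidean norm; and $I$ is a good rate function. That is, $I:\mathbb R^{A\times n_{L+1}}\to[0,\infty]$ is lower semicontinuous with compact level sets $\{I\le a\}$, $a\ge0$, and the laws $\pi_n$ of these random elements satisfy $$\limsup_{n\to\infty}\frac1{v_n^*}\log\pi_n(C)\le-\inf_C I\ \ (C\text{ closed}),\qquad \liminf_{n\to\infty}\frac1{v_n^*}\log\pi_n(O)\ge-\inf_O I\ \ (O\text{ open}).$$ -/

import Mathlib

open MeasureTheory ProbabilityTheory Filter Topology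
open scoped ENNReal NNReal MatrixOrder

noncomputable section

namespace DeepLDP

/-! ### Large deviation principles -/

/-- The sequence `μ` of probability measures on `X` satisfies the large deviation principle with
speed `v` and good rate function `I` (a `[0, ∞]`-valued function). -/
structure IsGoodLDP {X : Type*} [TopologicalSpace X] [MeasurableSpace X] [BorelSpace X]
    (v : ℕ → ℝ) (μ : ℕ → Measure X) (I : X → ℝ≥0∞) : Prop where
  speed_pos : ∀ n, 0 < v n
  speed_tendsto : Tendsto v atTop atTop
  isProbabilityMeasure : ∀ n, IsProbabilityMeasure (μ n)
  lowerSemicontinuous : LowerSemicontinuous I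
  isCompact_level : ∀ a : ℝ≥0, IsCompact {x | I x ≤ a}
  upper : ∀ C : Set X, IsClosed C →
    limsup (fun n => ENNReal.log (μ n C) / (v n : EReal)) atTop ≤ -((⨅ x ∈ C, I x : ℝ≥0∞) : EReal)
  lower : ∀ O : Set X, IsOpen O →
    -((⨅ x ∈ O, I x : ℝ≥0∞) : EReal) ≤ liminf (fun n => ENNReal.log (μ n O) / (v n : EReal)) atTop

/-! ### The fully connected network -/

/-- Pre-activations of the fully connected network whose layer `ℓ` has width `N ℓ` (`N 0` is the
input dimension). The biases and weights entering layer `ℓ + 1` are `b ℓ` and `W ℓ`, and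
`preActivation N σ b W x ℓ` is the vector `Z^{(ℓ+1)}(x)`. -/
def preActivation (N : ℕ → ℕ) (σ : ℝ → ℝ) (b : (ℓ : ℕ) → Fin (N (ℓ + 1)) → ℝ)
    (W : (ℓ : ℕ) → Fin (N (ℓ + 1)) → Fin (N ℓ) → ℝ) (x : Fin (N 0) → ℝ) :
    (ℓ : ℕ) → Fin (N (ℓ + 1)) → ℝ
  | 0 => fun i => b 0 i + ∑ r, W 0 i r * x r
  | ℓ + 1 => fun i => b (ℓ + 1) i + ∑ j, W (ℓ + 1) i j * σ (preActivation N σ b W x ℓ j)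

/-- Index set of all the biases (left) and weights (right) of a network with `L` hidden layers. -/
abbrev ParamIndex (L : ℕ) (N : ℕ → ℕ) : Type :=
  (Σ ℓ : Fin (L + 1), Fin (N (ℓ + 1))) ⊕ (Σ ℓ : Fin (L + 1), Fin (N (ℓ + 1)) × Fin (N ℓ))

/-- Gaussian parameters: all biases are `N(0, Cb)`, the weights leaving layer `ℓ` are
`N(0, CW / N ℓ)`, and all of these random variables are independent. -/
structure IsGaussianInit {Ω : Type*} [MeasurableSpace Ω] (P : Measure Ω) (L : ℕ) (N : ℕ → ℕ)
    (Cb CW : ℝ≥0) (b : (ℓ : ℕ) → Fin (N (ℓ + 1)) → Ω → ℝ)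
    (W : (ℓ : ℕ) → Fin (N (ℓ + 1)) → Fin (N ℓ) → Ω → ℝ) : Prop where
  law_bias : ∀ ℓ ≤ L, ∀ i, HasLaw (b ℓ i) (gaussianReal 0 Cb) P
  law_weight : ∀ ℓ ≤ L, ∀ i j, HasLaw (W ℓ i j) (gaussianReal 0 (CW / (N ℓ : ℝ≥0))) P
  indep : iIndepFun
    (Sum.elim (fun p => b p.1 p.2) (fun p => W p.1 p.2.1 p.2.2) : ParamIndex L N → Ω → ℝ) P

/-! ### The rate function -/

section Rate

variable {A : Type*} [Fintype A] [DecidableEq A]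

/-- The square root `q^#` of a positive semidefinite matrix. -/
def psdSqrt (q : Matrix A A ℝ) : Matrix A A ℝ := CFC.sqrt q

/-- `q^#` is the unique positive semidefinite matrix whose square is `q`. -/
theorem psdSqrt_spec {q : Matrix A A ℝ} (hq : q.PosSemidef) (p : Matrix A A ℝ) :
    psdSqrt q = p ↔ p.PosSemidef ∧ p * p = q := by
  constructor
  · rintro rfl
    exact ⟨Matrix.nonneg_iff_posSemidef.mp (CFC.sqrt_nonneg q), CFC.sqrt_mul_sqrt_self q hq.nonneg⟩
  · rintro ⟨hp, h⟩
    exact CFC.sqrt_unique h hp.nonneg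

/-- The set `S_{|A|, Cb}` of positive semidefinite `q` with `q - Cb 𝟏` positive semidefinite, where
`𝟏` is the matrix with all entries equal to one. -/
def covSet (A : Type*) [Fintype A] (Cb : ℝ) : Set (Matrix A A ℝ) :=
  {q | q.PosSemidef ∧ (q - Matrix.of fun _ _ => Cb).PosSemidef}

/-- The law of a family of independent standard normal random variables indexed by `A`. -/
def stdNormal (A : Type*) [Fintype A] : Measure (A → ℝ) := Measure.pi fun _ => gaussianReal 0 1

/-- `σ(⟨q^#_{α·}, N_·⟩)` at the realization `N = u`. -/
def feature (σ : ℝ → ℝ) (q : Matrix A A ℝ) (u : A → ℝ) (α : A) : ℝ :=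
  σ (∑ γ, psdSqrt q α γ * u γ)

/-- The logarithmic moment generating function `κ(η; q)`. -/
def kappa (σ : ℝ → ℝ) (η q : Matrix A A ℝ) : ℝ :=
  Real.log (∫ u, Real.exp (∑ α, ∑ β, η α β * (feature σ q u α * feature σ q u β)) ∂stdNormal A)

/-- The Fenchel-Legendre transform `κ^*(y; q)`. -/
def kappaStar (σ : ℝ → ℝ) (y q : Matrix A A ℝ) : EReal :=
  ⨆ η : Matrix A A ℝ, (((∑ α, ∑ β, η α β * y α β) - kappa σ η q : ℝ) : EReal)

/-- The transform is nonnegative (take `η = 0`), so it loses nothing when read in `[0, ∞]`. -/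
theorem kappaStar_nonneg (σ : ℝ → ℝ) (y q : Matrix A A ℝ) : 0 ≤ kappaStar σ y q := by
  refine le_iSup_of_le 0 ?_
  simp [kappa, stdNormal]

/-- The second moment matrix `y(q)`. -/
def secondMoment (σ : ℝ → ℝ) (q : Matrix A A ℝ) : Matrix A A ℝ :=
  Matrix.of fun α β => ∫ u, feature σ q u α * feature σ q u β ∂stdNormal A

open scoped Classical in
/-- `Δ(r; r')`, equal to `0` if `r = r'` and to `∞` otherwise. -/
def diracCost {X : Type*} (r r' : X) : ℝ≥0∞ := if r = r' then 0 else ∞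

/-- The cost `J(g | q)` of one layer with width ratio `γ`. -/
def layerCost (σ : ℝ → ℝ) (Cb CW : ℝ) (γ : ℝ≥0∞) (g q : Matrix A A ℝ) : ℝ≥0∞ :=
  if γ = ∞ then diracCost g ((Matrix.of fun _ _ => Cb) + CW • secondMoment σ q)
  else γ * (kappaStar σ (CW⁻¹ • (g - Matrix.of fun _ _ => Cb)) q).toENNReal

/-- The covariance `g^{(0)}` of the first layer at the inputs `x`. -/
def inputCov {n₀ : ℕ} (Cb CW : ℝ) (x : A → Fin n₀ → ℝ) : Matrix A A ℝ :=
  Matrix.of fun α β => Cb + CW / n₀ * ∑ r, x α r * x β r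

/-- The rate function `I_{G^{(L)}}`: the infimum of the total layer cost over the chains
`G 0, …, G L` in `S_{|A|, Cb}` that start at `g₀` and end at `g`. -/
def covRate (σ : ℝ → ℝ) (Cb CW : ℝ) (γ : ℕ → ℝ≥0∞) (L : ℕ) (g₀ g : Matrix A A ℝ) : ℝ≥0∞ :=
  ⨅ (G : ℕ → Matrix A A ℝ) (_ : G 0 = g₀) (_ : G L = g)
    (_ : ∀ ℓ, 1 ≤ ℓ → ℓ < L → G ℓ ∈ covSet A Cb),
    ∑ ℓ ∈ Finset.Icc 1 L, layerCost σ Cb CW (γ ℓ) (G ℓ) (G (ℓ - 1))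

/-- The rate function of the output, `‖r‖` being the Euclidean norm. -/
def outputRate (σ : ℝ → ℝ) (Cb CW : ℝ) (γ : ℕ → ℝ≥0∞) (L : ℕ) (g₀ : Matrix A A ℝ) {m : ℕ}
    (z : A → Fin m → ℝ) : ℝ≥0∞ :=
  ⨅ (g : Matrix A A ℝ) (_ : g ∈ covSet A Cb) (r : Matrix A (Fin m) ℝ)
    (_ : psdSqrt g * r = Matrix.of z),
    covRate σ Cb CW γ L g₀ g + ENNReal.ofReal ((∑ α, ∑ h, r α h ^ 2) / 2)

end Rate

end DeepLDP

end

/-!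
The proof works with Laplace functionals. For a probability measure `ρ`, a speed `v` and a bounded
nonnegative test function `f`, the *free energy* `freeEnergy v ρ f` is
`-(1/v) log ∫ exp (-v f) dρ`. A large deviation principle with good rate function `I` follows once
the free energies of bounded continuous `f` converge to `inf (I + f)` (`isGoodLDP_of_laplace`), and
free energies compose well: integrating out the last layer of the network replaces the test function
by the free energy of that layer, viewed as a function of the preceding covariance.

Given the covariance `q` of the pre-activations of a layer, its rows are independent and
distributed as `q^# N` with `N` standard normal (`map_affine_rows`, by characteristic functions, and
`IsGaussianInit.lintegral_netArray_succ`). Hence the next covariance is an affine image of the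
empirical mean of `n_ℓ` independent copies of the bounded vector `(σ_α(q) σ_β(q))`, and the hidden
covariances form a Markov chain. The free energy of one such step depends on `n` and on the starting
point `q`, and the test function itself already depends on `n`. The right notion is therefore
*continuous convergence* (`ContConv`): convergence of `f n q'` to `F q` as `n → ∞` and `q' → q`
jointly.

The analytic core is a Gärtner–Ellis theorem for continuously converging test functions
(`HasLimitLogMGF.tendsto_freeEnergy`).

* Upper bound on the integrals: around each point one exponential tilt suffices, coordinatewise
  exponential tilts give exponential tightness, and compactness reduces to finitely many tilts.
* Lower bound: the maximizer `η` of `⟨η, y⟩ - κ η - δ |η|² / 2` has gradient `∇κ(η)` close to `y`,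
  which costs no more than `y` (`exists_gradient_near`); the measure tilted by `η` concentrates near
  `∇κ(η)`. Continuity of `κ` and existence of its partial derivatives are all that this needs, so
  possibly degenerate features cause no difficulty.

With `∞ * 0 = 0` the cost of a layer is `γ κ^*` also for `γ = ∞`, because `κ^*` vanishes only at the
mean (`layerCost_eq`). So both regimes of the width ratio are treated at once, and one layer maps
continuously converging test functions to continuously converging ones (`contConv_layerEnergy`).
Taking the filter `n → ∞`, `q' → q` as index in the Gärtner–Ellis theorem gives uniformity in the
conditioning covariance for free; the input is joint continuity of `κ(η; q)`, which comes from
continuity of the square root on the positive semidefinite cone.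

The same theorem applies to the output layer: given `q` it is `q^# r` with `r` a Gaussian array of
variance `1 / v` (`contConv_outputEnergy`). Induction on the depth (`tendsto_freeEnergy_netCov`) and
the dynamic programming recursion for the rate functions (`covRate_succ`) then give the Laplace
principle. Goodness of the rate function is proved separately: compactness of sublevel sets is
propagated along the layers (`isCompact_level_iInf_add`).
-/

noncomputable section

namespace DeepLDP

/-! ### Free energies, Legendre transforms and exponential tilting -/

section GartnerEllis

/-- The normalized free energy `-(1/v) log ∫ exp (-v f) dρ` of the test function `f`. -/
def freeEnergy {X : Type*} [MeasurableSpace X] (v : ℝ) (ρ : Measure X) (f : X → ℝ) : ℝ :=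
  -(Real.log (∫⁻ x, ENNReal.ofReal (Real.exp (-(v * f x))) ∂ρ).toReal / v)

variable {ι : Type*} [Fintype ι]

/-- The Fenchel–Legendre transform of `κ`, with values in `[0, ∞]`: negative values of
`⟨η, y⟩ - κ η` are truncated, which is harmless when `κ 0 = 0`. -/
def legendre (κ : (ι → ℝ) → ℝ) (y : ι → ℝ) : ℝ≥0∞ :=
  ⨆ η : ι → ℝ, ENNReal.ofReal (η ⬝ᵥ y - κ η)

lemma continuous_dotProduct_right (η : ι → ℝ) : Continuous fun y : ι → ℝ => η ⬝ᵥ y := by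
  unfold dotProduct; fun_prop

lemma continuous_dotProduct_left (y : ι → ℝ) : Continuous fun η : ι → ℝ => η ⬝ᵥ y := by
  unfold dotProduct; fun_prop

lemma sq_norm_le_dotProduct_self (η : ι → ℝ) : ‖η‖ ^ 2 ≤ η ⬝ᵥ η := by
  have h : ∀ k, |η k| ^ 2 ≤ η ⬝ᵥ η := fun k => by
    rw [sq_abs, sq]
    exact Finset.single_le_sum (f := fun k => η k * η k) (fun j _ => mul_self_nonneg _)
      (Finset.mem_univ k)
  have h0 : 0 ≤ η ⬝ᵥ η := Finset.sum_nonneg fun j _ => mul_self_nonneg _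
  have : ‖η‖ ≤ √(η ⬝ᵥ η) := by
    refine (pi_norm_le_iff_of_nonneg (Real.sqrt_nonneg _)).2 fun k => ?_
    exact Real.le_sqrt_of_sq_le (by simpa using h k)
  calc ‖η‖ ^ 2 ≤ √(η ⬝ᵥ η) ^ 2 := by gcongr
    _ = _ := Real.sq_sqrt h0

lemma measurable_exp_mul_dotProduct (c : ℝ) (η : ι → ℝ) :
    Measurable fun y : ι → ℝ => ENNReal.ofReal (Real.exp (c * (η ⬝ᵥ y))) := by
  have := continuous_dotProduct_right η
  exact (ENNReal.continuous_ofReal.comp (Real.continuous_exp.comp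
    (continuous_const.mul this))).measurable

variable [DecidableEq ι]

/-- The laws `ρ i` have logarithmic moment generating functions `κi i` at scale `N i`, which
converge along `l` to a continuous `κ` having partial derivatives; the scale `N i` is
asymptotically `γ` times the speed `v i`. -/
structure HasLimitLogMGF {I : Type*} (l : Filter I) (v N : I → ℝ) (γ : ℝ≥0∞)
    (ρ : I → Measure (ι → ℝ)) (κi : I → (ι → ℝ) → ℝ) (κ : (ι → ℝ) → ℝ) : Prop where
  prob : ∀ i, IsProbabilityMeasure (ρ i)
  speed_pos : ∀ i, 0 < v i
  scale_pos : ∀ i, 0 < N i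
  speed_tendsto : Tendsto v l atTop
  one_le : 1 ≤ γ
  ratio : Tendsto (fun i => ENNReal.ofReal (N i / v i)) l (𝓝 γ)
  mgf : ∀ i η, ∫⁻ y, ENNReal.ofReal (Real.exp (N i * (η ⬝ᵥ y))) ∂ρ i
    = ENNReal.ofReal (Real.exp (N i * κi i η))
  tendsto : ∀ η, Tendsto (fun i => κi i η) l (𝓝 (κ η))
  cont : Continuous κ
  diff : ∀ η k, DifferentiableAt ℝ (fun t : ℝ => κ (η + t • Pi.single k 1)) 0

/-- Points with finite Legendre transform are approximated by gradients of `κ`, at no extra cost: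
the maximizer `η` of the penalized functional `⟨η, y⟩ - κ η - δ |η|² / 2` has `∇κ(η) = y - δ η`. -/
lemma exists_gradient_near {κ : (ι → ℝ) → ℝ} (hc : Continuous κ) (h0 : κ 0 = 0)
    (hd : ∀ η k, DifferentiableAt ℝ (fun t : ℝ => κ (η + t • Pi.single k 1)) 0)
    {y : ι → ℝ} (hy : legendre κ y ≠ ∞) {ε : ℝ} (hε : 0 < ε) :
    ∃ η m : ι → ℝ, ‖m - y‖ < ε ∧
      (∀ k, HasDerivAt (fun t : ℝ => κ (η + t • Pi.single k 1)) (m k) 0) ∧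
      ENNReal.ofReal (η ⬝ᵥ m - κ η) ≤ legendre κ y := by
  set M := (legendre κ y).toReal with hM
  have hM0 : 0 ≤ M := ENNReal.toReal_nonneg
  have hle : ∀ η, η ⬝ᵥ y - κ η ≤ M := fun η => by
    rw [hM, ← ENNReal.ofReal_le_iff_le_toReal hy]
    exact le_iSup (fun η : ι → ℝ => ENNReal.ofReal (η ⬝ᵥ y - κ η)) η
  -- a maximizer `η` of `φ` below has `δ |η|² ≤ 2 M`, hence `|δ η|² ≤ 2 δ M < ε²`
  obtain ⟨δ, hδ, hδε⟩ : ∃ δ : ℝ, 0 < δ ∧ 2 * δ * M < ε ^ 2 := by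
    refine ⟨ε ^ 2 / (2 * (M + 1)), by positivity, ?_⟩
    rw [show 2 * (ε ^ 2 / (2 * (M + 1))) * M = ε ^ 2 * (M / (M + 1)) by field_simp]
    have : M / (M + 1) < 1 := by rw [div_lt_one (by linarith)]; linarith
    have : 0 < ε ^ 2 := by positivity
    nlinarith
  set φ : (ι → ℝ) → ℝ := fun η => η ⬝ᵥ y - κ η - δ / 2 * (η ⬝ᵥ η) with hφ
  have hφc : Continuous φ := by
    have := continuous_dotProduct_left y
    have h2 : Continuous fun η : ι → ℝ => η ⬝ᵥ η := by unfold dotProduct; fun_prop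
    fun_prop
  have hφ0 : φ 0 = 0 := by simp [hφ, h0]
  obtain ⟨η, hη⟩ : ∃ η, ∀ η', φ η' ≤ φ η := by
    refine hφc.exists_forall_ge' 0 ?_
    have : Tendsto (fun η : ι → ℝ => ‖η‖) (cocompact _) atTop := tendsto_norm_cocompact_atTop
    have h2 : Tendsto (fun η : ι → ℝ => δ / 2 * ‖η‖ ^ 2) (cocompact _) atTop :=
      ((tendsto_pow_atTop two_ne_zero).comp this).const_mul_atTop (by positivity)
    filter_upwards [h2.eventually_ge_atTop M] with η' h'
    rw [hφ0]
    have := mul_le_mul_of_nonneg_left (sq_norm_le_dotProduct_self η') (by positivity : 0 ≤ δ / 2)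
    have := hle η'
    simp only [hφ]; linarith
  have hquad : δ / 2 * (η ⬝ᵥ η) ≤ M := by
    have h1 := hη 0
    rw [hφ0] at h1
    have := hle η
    simp only [hφ] at h1; linarith
  have hηη : 0 ≤ η ⬝ᵥ η := (sq_nonneg _).trans (sq_norm_le_dotProduct_self η)
  refine ⟨η, y - δ • η, ?_, fun k => ?_, ?_⟩
  · have h1 : ‖y - δ • η - y‖ = δ * ‖η‖ := by
      rw [show y - δ • η - y = (-δ) • η by rw [neg_smul]; abel, norm_smul, norm_neg,
        Real.norm_of_nonneg hδ.le]
    rw [h1]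
    refine lt_of_pow_lt_pow_left₀ 2 hε.le ?_
    calc (δ * ‖η‖) ^ 2 = δ ^ 2 * ‖η‖ ^ 2 := by ring
      _ ≤ δ ^ 2 * (η ⬝ᵥ η) := by gcongr; exact sq_norm_le_dotProduct_self η
      _ = 2 * δ * (δ / 2 * (η ⬝ᵥ η)) := by ring
      _ ≤ 2 * δ * M := by gcongr
      _ < ε ^ 2 := hδε
  · have hd1 := (hd η k).hasDerivAt
    set d := deriv (fun t : ℝ => κ (η + t • (Pi.single k 1 : ι → ℝ))) 0
    have hlin : ∀ t : ℝ, φ (η + t • (Pi.single k 1 : ι → ℝ))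
        = η ⬝ᵥ y + t * y k - κ (η + t • (Pi.single k 1 : ι → ℝ))
          - δ / 2 * (η ⬝ᵥ η + 2 * t * η k + t ^ 2) := fun t => by
      simp only [hφ, add_dotProduct, dotProduct_add, smul_dotProduct, dotProduct_smul,
        single_one_dotProduct, dotProduct_single_one, smul_eq_mul, Pi.add_apply, Pi.smul_apply,
        Pi.single_eq_same]
      ring
    have hderiv : HasDerivAt (fun t : ℝ => φ (η + t • (Pi.single k 1 : ι → ℝ)))
        (y k - d - δ * η k) 0 := by
      simp only [hlin]
      have e1 : HasDerivAt (fun t : ℝ => η ⬝ᵥ y + t * y k) (y k) 0 := by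
        simpa using ((hasDerivAt_id (0 : ℝ)).mul_const (y k)).const_add (η ⬝ᵥ y)
      have e2 : HasDerivAt (fun t : ℝ => δ / 2 * (η ⬝ᵥ η + 2 * t * η k + t ^ 2)) (δ * η k) 0 := by
        have e3 : HasDerivAt (fun t : ℝ => η ⬝ᵥ η + 2 * t * η k + t ^ 2)
            (2 * 1 * η k + (2 : ℕ) * (0 : ℝ) ^ (2 - 1) * 1) 0 :=
          ((((hasDerivAt_id (0 : ℝ)).const_mul 2).mul_const (η k)).const_add _).add
            ((hasDerivAt_id (0 : ℝ)).pow 2)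
        have e4 := e3.const_mul (δ / 2)
        rwa [show δ / 2 * (2 * 1 * η k + (2 : ℕ) * (0 : ℝ) ^ (2 - 1) * 1) = δ * η k by
          norm_num; ring] at e4
      exact (e1.sub hd1).sub e2
    have hmax : IsLocalMax (fun t : ℝ => φ (η + t • (Pi.single k 1 : ι → ℝ))) 0 :=
      Filter.Eventually.of_forall fun t => by simpa using hη _
    have : y k - d - δ * η k = 0 := hmax.hasDerivAt_eq_zero hderiv
    have hdk : (y - δ • η) k = d := by simp; linarith
    rw [hdk]; exact hd1
  · refine le_trans (ENNReal.ofReal_le_ofReal ?_)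
      (le_iSup (fun η : ι → ℝ => ENNReal.ofReal (η ⬝ᵥ y - κ η)) η)
    rw [dotProduct_sub, dotProduct_smul, smul_eq_mul]
    nlinarith

/-- If the transform vanishes at `y`, then `0` is a maximizer of `⟨η, y⟩ - κ η`, so `y` is the
gradient of `κ` at `0`. -/
lemma hasDerivAt_zero_of_legendre_eq_zero {κ : (ι → ℝ) → ℝ} (h0 : κ 0 = 0)
    (hd : ∀ η k, DifferentiableAt ℝ (fun t : ℝ => κ (η + t • Pi.single k 1)) 0)
    {y : ι → ℝ} (hy : legendre κ y = 0) (k : ι) :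
    HasDerivAt (fun t : ℝ => κ (0 + t • Pi.single k 1)) (y k) 0 := by
  have hle : ∀ η, η ⬝ᵥ y - κ η ≤ 0 := fun η => by
    have := le_iSup (fun η : ι → ℝ => ENNReal.ofReal (η ⬝ᵥ y - κ η)) η
    rw [← legendre, hy] at this
    simpa using this
  have hd1 := (hd 0 k).hasDerivAt
  set d := deriv (fun t : ℝ => κ (0 + t • (Pi.single k 1 : ι → ℝ))) 0
  have hderiv : HasDerivAt (fun t : ℝ => t * y k - κ (0 + t • (Pi.single k 1 : ι → ℝ)))
      (1 * y k - d) 0 := ((hasDerivAt_id (0 : ℝ)).mul_const (y k)).sub hd1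
  have hmax : IsLocalMax (fun t : ℝ => t * y k - κ (0 + t • (Pi.single k 1 : ι → ℝ))) 0 :=
    Filter.Eventually.of_forall fun t => by
      have := hle (0 + t • (Pi.single k 1 : ι → ℝ))
      simpa [h0] using this
  have := hmax.hasDerivAt_eq_zero hderiv
  rw [show y k = d by linarith]
  exact hd1

namespace HasLimitLogMGF

variable {I : Type*} {l : Filter I} {v N : I → ℝ} {γ : ℝ≥0∞}
    {ρ : I → Measure (ι → ℝ)} {κi : I → (ι → ℝ) → ℝ} {κ : (ι → ℝ) → ℝ}

lemma logMGF_zero (h : HasLimitLogMGF l v N γ ρ κi κ) (i : I) : κi i 0 = 0 := by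
  have := h.prob i
  have h1 := h.mgf i 0
  simp only [zero_dotProduct, mul_zero, Real.exp_zero, ENNReal.ofReal_one, lintegral_const,
    measure_univ, mul_one] at h1
  have h2 : Real.exp (N i * κi i 0) = 1 := by
    have h3 := congrArg ENNReal.toReal h1
    rw [ENNReal.toReal_ofReal (Real.exp_pos _).le] at h3
    simpa using h3.symm
  have h3 := (Real.exp_eq_one_iff _).1 h2
  exact (mul_eq_zero.1 h3).resolve_left (h.scale_pos i).ne'

lemma limit_zero [l.NeBot] (h : HasLimitLogMGF l v N γ ρ κi κ) : κ 0 = 0 :=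
  tendsto_nhds_unique (h.tendsto 0) (by simp [h.logMGF_zero])

lemma eventually_half_le (h : HasLimitLogMGF l v N γ ρ κi κ) : ∀ᶠ i in l, v i / 2 ≤ N i := by
  have h1 : ENNReal.ofReal (1 / 2) < γ :=
    lt_of_lt_of_le (by rw [← ENNReal.ofReal_one]; exact
      (ENNReal.ofReal_lt_ofReal_iff one_pos).2 (by norm_num)) h.one_le
  filter_upwards [h.ratio.eventually (lt_mem_nhds h1)] with i hi
  have := (ENNReal.ofReal_lt_ofReal_iff'.1 hi).1
  rw [lt_div_iff₀ (h.speed_pos i)] at this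
  linarith

lemma scale_tendsto (h : HasLimitLogMGF l v N γ ρ κi κ) : Tendsto N l atTop := by
  refine tendsto_atTop_mono' l h.eventually_half_le ?_
  exact h.speed_tendsto.atTop_div_const two_pos

/-- Under the exponentially tilted measure a coordinate is unlikely to deviate from the partial
derivative of `κ`. The sign of `t` selects the upper or the lower tail. -/
lemma tilted_tail (h : HasLimitLogMGF l v N γ ρ κi κ) {η m : ι → ℝ} {k : ι}
    {ε t : ℝ}
    (ht : κ (η + t • Pi.single k 1) - κ η - t * m k < |t| * ε) {c : ℝ} (hc : 0 < c) :
    ∀ᶠ i in l, ∫⁻ y in {y | |t| * ε ≤ t * (y k - m k)},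
      ENNReal.ofReal (Real.exp (N i * (η ⬝ᵥ y))) ∂ρ i
        ≤ ENNReal.ofReal (c * Real.exp (N i * κi i η)) := by
  obtain ⟨r, hr1, hr2⟩ := exists_between ht
  have h1 : ∀ᶠ i in l, κi i (η + t • Pi.single k 1) - κi i η - t * m k < r :=
    (((h.tendsto _).sub (h.tendsto η)).sub_const _).eventually (gt_mem_nhds hr1)
  have h2 : Tendsto (fun i => Real.exp (N i * (r - |t| * ε))) l (𝓝 0) :=
    Real.tendsto_exp_atBot.comp (h.scale_tendsto.atTop_mul_const_of_neg (by linarith))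
  filter_upwards [h1, h2.eventually (ge_mem_nhds hc)] with i hi1 hi2
  have hmeas : MeasurableSet {y : ι → ℝ | |t| * ε ≤ t * (y k - m k)} :=
    measurableSet_le (by fun_prop) (by fun_prop)
  have hN := h.scale_pos i
  calc ∫⁻ y in {y | |t| * ε ≤ t * (y k - m k)}, ENNReal.ofReal (Real.exp (N i * (η ⬝ᵥ y))) ∂ρ i
      ≤ ∫⁻ y in {y | |t| * ε ≤ t * (y k - m k)},
        ENNReal.ofReal (Real.exp (-(N i * (|t| * ε + t * m k)))) *
          ENNReal.ofReal (Real.exp (N i * ((η + t • Pi.single k 1) ⬝ᵥ y))) ∂ρ i := by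
        refine setLIntegral_mono' hmeas fun y hy => ?_
        rw [← ENNReal.ofReal_mul (Real.exp_pos _).le, ← Real.exp_add]
        refine ENNReal.ofReal_le_ofReal (Real.exp_le_exp.2 ?_)
        simp only [add_dotProduct, smul_dotProduct, single_one_dotProduct, smul_eq_mul]
        have hy' : |t| * ε ≤ t * (y k - m k) := hy
        nlinarith
    _ ≤ ENNReal.ofReal (Real.exp (-(N i * (|t| * ε + t * m k)))) *
          ∫⁻ y, ENNReal.ofReal (Real.exp (N i * ((η + t • Pi.single k 1) ⬝ᵥ y))) ∂ρ i := by
        rw [← lintegral_const_mul _ (measurable_exp_mul_dotProduct _ _)]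
        exact setLIntegral_le_lintegral _ _
    _ = ENNReal.ofReal (Real.exp (N i * (κi i (η + t • Pi.single k 1) - t * m k - |t| * ε))) := by
        rw [h.mgf, ← ENNReal.ofReal_mul (Real.exp_pos _).le, ← Real.exp_add]
        congr 2; ring
    _ ≤ ENNReal.ofReal (c * Real.exp (N i * κi i η)) := by
        refine ENNReal.ofReal_le_ofReal ?_
        calc _ ≤ Real.exp (N i * (r - |t| * ε) + N i * κi i η) := by
              refine Real.exp_le_exp.2 ?_
              nlinarith
          _ ≤ _ := by rw [Real.exp_add]; gcongr

/-- The tilted measures concentrate near the gradient of `κ`. -/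
lemma tilted_ball (h : HasLimitLogMGF l v N γ ρ κi κ) {η m : ι → ℝ}
    (hm : ∀ k, HasDerivAt (fun t : ℝ => κ (η + t • Pi.single k 1)) (m k) 0)
    {ε : ℝ} (hε : 0 < ε) :
    ∀ᶠ i in l, ENNReal.ofReal (Real.exp (N i * κi i η) / 2)
      ≤ ∫⁻ y in Metric.ball m ε, ENNReal.ofReal (Real.exp (N i * (η ⬝ᵥ y))) ∂ρ i := by
  -- the `2 |ι|` tails, of relative mass at most `c` each, leave half of the mass to the ball
  set c : ℝ := 1 / (4 * (Fintype.card ι + 1)) with hc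
  have hc0 : 0 < c := by positivity
  -- a small step of either sign along each coordinate has the wrong slope by less than `ε`
  have key : ∀ k, ∃ t > 0, κ (η + t • Pi.single k 1) - κ η - t * m k < |t| * ε ∧
      κ (η + (-t) • Pi.single k 1) - κ η - (-t) * m k < |-t| * ε := fun k => by
    have h1 := (hasDerivAt_iff_isLittleO_nhds_zero.1 (hm k)).def (half_pos hε)
    simp only [zero_add, zero_smul, add_zero, smul_eq_mul] at h1
    obtain ⟨r, hr, hb⟩ := Metric.eventually_nhds_iff.1 h1
    have e : ∀ t : ℝ, t ≠ 0 → |t| < r →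
        κ (η + t • Pi.single k 1) - κ η - t * m k < |t| * ε := fun t ht htr => by
      have h2 := hb (y := t) (by simpa using htr)
      have h3 := (le_abs_self _).trans h2
      have : 0 < |t| * ε := mul_pos (abs_pos.2 ht) hε
      rw [Real.norm_eq_abs] at h3
      linarith
    refine ⟨r / 2, by positivity, e _ (by positivity) ?_, e _ (by simp; positivity) ?_⟩
    · rw [abs_of_pos (by positivity)]; linarith
    · rw [abs_neg, abs_of_pos (by positivity)]; linarith
  choose t ht0 ht1 ht2 using key
  have hev : ∀ᶠ i in l, ∀ k, _ := Filter.eventually_all.2 fun k =>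
    (h.tilted_tail (ht1 k) hc0).and (h.tilted_tail (ht2 k) hc0)
  filter_upwards [hev] with i hi
  set μ : Measure (ι → ℝ) := (ρ i).withDensity
    fun y => ENNReal.ofReal (Real.exp (N i * (η ⬝ᵥ y))) with hμ
  have hμs : ∀ s, MeasurableSet s →
      μ s = ∫⁻ y in s, ENNReal.ofReal (Real.exp (N i * (η ⬝ᵥ y))) ∂ρ i :=
    fun s hs => withDensity_apply _ hs
  set T := Real.exp (N i * κi i η) with hT
  have hT0 : 0 < T := Real.exp_pos _
  have htot : μ Set.univ = ENNReal.ofReal T := by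
    rw [hμs _ MeasurableSet.univ, Measure.restrict_univ, h.mgf]
  have hsub : (Set.univ : Set (ι → ℝ)) ⊆ Metric.ball m ε ∪ ⋃ k,
      ({y | |t k| * ε ≤ t k * (y k - m k)} ∪ {y | |-t k| * ε ≤ -t k * (y k - m k)}) := by
    intro y _
    by_cases hy : y ∈ Metric.ball m ε
    · exact Or.inl hy
    · refine Or.inr ?_
      rw [Metric.mem_ball, dist_pi_lt_iff hε] at hy
      push Not at hy
      obtain ⟨k, hk⟩ := hy
      refine Set.mem_iUnion.2 ⟨k, ?_⟩
      rw [Real.dist_eq] at hk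
      have := ht0 k
      rcases le_abs'.1 hk with h1 | h1
      · right
        simp only [Set.mem_ofPred_eq, abs_neg, abs_of_pos this]
        nlinarith
      · left
        simp only [Set.mem_ofPred_eq, abs_of_pos this]
        nlinarith
  have hbound : ENNReal.ofReal T ≤ μ (Metric.ball m ε) + ENNReal.ofReal (T / 2) := by
    rw [← htot]
    refine (measure_mono hsub).trans ((measure_union_le _ _).trans ?_)
    gcongr
    refine (measure_iUnion_fintype_le _ _).trans ?_
    have hmeas : ∀ (s : ℝ) k, MeasurableSet {y : ι → ℝ | |s| * ε ≤ s * (y k - m k)} := fun s k =>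
      measurableSet_le (by fun_prop) (by fun_prop)
    calc ∑ k, μ ({y | |t k| * ε ≤ t k * (y k - m k)} ∪ {y | |-t k| * ε ≤ -t k * (y k - m k)})
        ≤ ∑ k : ι, ENNReal.ofReal (2 * (c * T)) := by
          refine Finset.sum_le_sum fun k _ => (measure_union_le _ _).trans ?_
          rw [two_mul, ENNReal.ofReal_add (by positivity) (by positivity), hμs _ (hmeas _ k),
            hμs _ (hmeas _ k)]
          exact add_le_add (hi k).1 (hi k).2
      _ = ENNReal.ofReal (Fintype.card ι * (2 * (c * T))) := by
          rw [Finset.sum_const, nsmul_eq_mul, Finset.card_univ,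
            ENNReal.ofReal_mul (p := (Fintype.card ι : ℝ)) (by positivity), ENNReal.ofReal_natCast]
      _ ≤ ENNReal.ofReal (T / 2) := by
          refine ENNReal.ofReal_le_ofReal ?_
          rw [hc, show (Fintype.card ι : ℝ) * (2 * (1 / (4 * (Fintype.card ι + 1)) * T))
            = (Fintype.card ι : ℝ) / (Fintype.card ι + 1) * (T / 2) by field_simp; norm_num]
          refine mul_le_of_le_one_left (by positivity) ?_
          rw [div_le_one (by positivity)]; linarith
  rw [← hμs _ Metric.isOpen_ball.measurableSet]
  have hsplit : ENNReal.ofReal T = ENNReal.ofReal (T / 2) + ENNReal.ofReal (T / 2) := by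
    rw [← ENNReal.ofReal_add (by positivity) (by positivity)]; congr 1; ring
  rw [hsplit] at hbound
  exact (ENNReal.add_le_add_iff_right ENNReal.ofReal_ne_top).1 hbound

end HasLimitLogMGF

/-! ### A Gärtner–Ellis theorem for converging test functions -/

/-- Continuous convergence on `S`: `f i y' → F y` as `i` runs along `l` and `y' → y` within `S`. -/
def ContConv {I X : Type*} [TopologicalSpace X] (l : Filter I) (S : Set X) (f : I → X → ℝ)
    (F : X → ℝ≥0∞) : Prop :=
  ∀ y ∈ S, Tendsto (fun p : I × X => ENNReal.ofReal (f p.1 p.2)) (l ×ˢ 𝓝[S] y) (𝓝 (F y))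

lemma lintegral_exp_le_one {X : Type*} [MeasurableSpace X] {ρ : Measure X}
    [IsProbabilityMeasure ρ] {v : ℝ} (hv : 0 < v) {f : X → ℝ} (hf0 : ∀ x, 0 ≤ f x) :
    ∫⁻ x, ENNReal.ofReal (Real.exp (-(v * f x))) ∂ρ ≤ 1 := by
  calc _ ≤ ∫⁻ _, 1 ∂ρ := lintegral_mono fun x => by
        rw [← ENNReal.ofReal_one]
        refine ENNReal.ofReal_le_ofReal (Real.exp_le_one_iff.2 ?_)
        have := mul_nonneg hv.le (hf0 x)
        linarith
    _ = 1 := by simp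

lemma le_lintegral_exp {X : Type*} [MeasurableSpace X] {ρ : Measure X}
    [IsProbabilityMeasure ρ] {v B : ℝ} (hv : 0 < v) {f : X → ℝ} (hfB : ∀ x, f x ≤ B) :
    ENNReal.ofReal (Real.exp (-(v * B))) ≤ ∫⁻ x, ENNReal.ofReal (Real.exp (-(v * f x))) ∂ρ := by
  calc _ = ∫⁻ _, ENNReal.ofReal (Real.exp (-(v * B))) ∂ρ := by simp
    _ ≤ _ := lintegral_mono fun x => ENNReal.ofReal_le_ofReal (Real.exp_le_exp.2 (by
      have := mul_le_mul_of_nonneg_left (hfB x) hv.le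
      linarith))

/-- The bound on `f` keeps the integral positive, so that its logarithm is not a junk value. -/
lemma le_freeEnergy {X : Type*} [MeasurableSpace X] {ρ : Measure X}
    [IsProbabilityMeasure ρ] {v B : ℝ} (hv : 0 < v) {f : X → ℝ} (hfB : ∀ x, f x ≤ B) {T : ℝ}
    (h : ∫⁻ x, ENNReal.ofReal (Real.exp (-(v * f x))) ∂ρ ≤ ENNReal.ofReal (Real.exp T)) :
    -(T / v) ≤ freeEnergy v ρ f := by
  unfold freeEnergy
  have h1 := (ENNReal.toReal_le_toReal (ne_top_of_le_ne_top ENNReal.ofReal_ne_top h)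
    ENNReal.ofReal_ne_top).2 h
  rw [ENNReal.toReal_ofReal (Real.exp_pos _).le] at h1
  have h2 := (ENNReal.toReal_le_toReal ENNReal.ofReal_ne_top
    (ne_top_of_le_ne_top ENNReal.ofReal_ne_top h)).2 (le_lintegral_exp (ρ := ρ) hv hfB)
  rw [ENNReal.toReal_ofReal (Real.exp_pos _).le] at h2
  have h3 := Real.log_le_log ((Real.exp_pos _).trans_le h2) h1
  rw [Real.log_exp] at h3
  rw [neg_le_neg_iff]
  gcongr

lemma freeEnergy_le {X : Type*} [MeasurableSpace X] {ρ : Measure X}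
    [IsProbabilityMeasure ρ] {v : ℝ} (hv : 0 < v) {f : X → ℝ} (hf0 : ∀ x, 0 ≤ f x) {T : ℝ}
    (h : ENNReal.ofReal (Real.exp T) ≤ ∫⁻ x, ENNReal.ofReal (Real.exp (-(v * f x))) ∂ρ) :
    freeEnergy v ρ f ≤ -(T / v) := by
  unfold freeEnergy
  have h1 := (ENNReal.toReal_le_toReal ENNReal.ofReal_ne_top
    (ne_top_of_le_ne_top ENNReal.one_ne_top (lintegral_exp_le_one (ρ := ρ) hv hf0))).2 h
  rw [ENNReal.toReal_ofReal (Real.exp_pos _).le] at h1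
  have h3 := Real.log_le_log (Real.exp_pos _) h1
  rw [Real.log_exp] at h3
  rw [neg_le_neg_iff]
  gcongr

lemma freeEnergy_nonneg {X : Type*} [MeasurableSpace X] {ρ : Measure X}
    [IsProbabilityMeasure ρ] {v B : ℝ} (hv : 0 < v) {f : X → ℝ} (hf0 : ∀ x, 0 ≤ f x)
    (hfB : ∀ x, f x ≤ B) : 0 ≤ freeEnergy v ρ f := by
  simpa using le_freeEnergy (T := 0) (ρ := ρ) hv hfB (by simpa using lintegral_exp_le_one hv hf0)

lemma freeEnergy_le_of_le {X : Type*} [MeasurableSpace X] {ρ : Measure X}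
    [IsProbabilityMeasure ρ] {v B : ℝ} (hv : 0 < v) {f : X → ℝ} (hf0 : ∀ x, 0 ≤ f x)
    (hfB : ∀ x, f x ≤ B) : freeEnergy v ρ f ≤ B := by
  have := freeEnergy_le (T := -(v * B)) (ρ := ρ) hv hf0 (le_lintegral_exp hv hfB)
  rwa [neg_div, neg_neg, mul_div_cancel_left₀ _ hv.ne'] at this

namespace HasLimitLogMGF

variable {I : Type*} {l : Filter I} {v N : I → ℝ} {γ : ℝ≥0∞}
    {ρ : I → Measure (ι → ℝ)} {κi : I → (ι → ℝ) → ℝ} {κ : (ι → ℝ) → ℝ}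
    {S : Set (ι → ℝ)} {f : I → (ι → ℝ) → ℝ} {F : (ι → ℝ) → ℝ≥0∞}

/-- Chebyshev's exponential inequality with a test function. -/
lemma chernoff (h : HasLimitLogMGF l v N γ ρ κi κ) (i : I) {s : Set (ι → ℝ)}
    (hs : MeasurableSet s) {η : ι → ℝ} {a : ℝ} {g : (ι → ℝ) → ℝ}
    (hle : ∀ y ∈ s, v i * a ≤ v i * g y + N i * (η ⬝ᵥ y - κi i η)) :
    ∫⁻ y in s, ENNReal.ofReal (Real.exp (-(v i * g y))) ∂ρ i
      ≤ ENNReal.ofReal (Real.exp (-(v i * a))) := by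
  calc ∫⁻ y in s, ENNReal.ofReal (Real.exp (-(v i * g y))) ∂ρ i
      ≤ ∫⁻ y in s, ENNReal.ofReal (Real.exp (-(v i * a) - N i * κi i η)) *
          ENNReal.ofReal (Real.exp (N i * (η ⬝ᵥ y))) ∂ρ i := by
        refine setLIntegral_mono' hs fun y hy => ?_
        rw [← ENNReal.ofReal_mul (Real.exp_pos _).le, ← Real.exp_add]
        refine ENNReal.ofReal_le_ofReal (Real.exp_le_exp.2 ?_)
        have := hle y hy
        linarith
    _ ≤ ENNReal.ofReal (Real.exp (-(v i * a) - N i * κi i η)) *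
          ∫⁻ y, ENNReal.ofReal (Real.exp (N i * (η ⬝ᵥ y))) ∂ρ i := by
        rw [← lintegral_const_mul _ (measurable_exp_mul_dotProduct _ _)]
        exact setLIntegral_le_lintegral _ _
    _ = ENNReal.ofReal (Real.exp (-(v i * a))) := by
        rw [h.mgf, ← ENNReal.ofReal_mul (Real.exp_pos _).le, ← Real.exp_add]
        congr 2; ring

/-- Near a point whose cost exceeds `a`, a single exponential tilt certifies the bound `a`. -/
lemma exists_local_tilt (h : HasLimitLogMGF l v N γ ρ κi κ) (hf0 : ∀ i y, 0 ≤ f i y)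
    (hfF : ContConv l S f F) {y : ι → ℝ} (hy : y ∈ S) {a : ℝ}
    (hlt : ENNReal.ofReal a < γ * legendre κ y + F y) :
    ∃ η, ∀ᶠ p in l ×ˢ 𝓝[S] y, v p.1 * a ≤ v p.1 * f p.1 p.2 + N p.1 * (η ⬝ᵥ p.2 - κi p.1 η) := by
  rw [legendre, ENNReal.mul_iSup, ENNReal.iSup_add, lt_iSup_iff] at hlt
  obtain ⟨η, hη⟩ := hlt
  -- a tilt without gain is dropped, as its (truncated) contribution is `0`
  by_cases hc : η ⬝ᵥ y - κ η ≤ 0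
  · rw [ENNReal.ofReal_of_nonpos hc, mul_zero, zero_add] at hη
    refine ⟨0, ?_⟩
    filter_upwards [(hfF y hy).eventually (lt_mem_nhds hη)] with p hp
    have := (ENNReal.ofReal_lt_ofReal_iff'.1 hp).1
    rw [h.logMGF_zero, zero_dotProduct, sub_zero, mul_zero, add_zero]
    exact mul_le_mul_of_nonneg_left this.le (h.speed_pos _).le
  · push Not at hc
    refine ⟨η, ?_⟩
    have h1 : Tendsto (fun p : I × (ι → ℝ) => η ⬝ᵥ p.2 - κi p.1 η) (l ×ˢ 𝓝[S] y)
        (𝓝 (η ⬝ᵥ y - κ η)) := by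
      refine Tendsto.sub ?_ ((h.tendsto η).comp tendsto_fst)
      exact ((continuous_dotProduct_right η).tendsto y).comp
        (tendsto_snd.mono_right nhdsWithin_le_nhds)
    have h2 : Tendsto (fun p : I × (ι → ℝ) => ENNReal.ofReal (N p.1 / v p.1) *
        ENNReal.ofReal (η ⬝ᵥ p.2 - κi p.1 η) + ENNReal.ofReal (f p.1 p.2)) (l ×ˢ 𝓝[S] y)
        (𝓝 (γ * ENNReal.ofReal (η ⬝ᵥ y - κ η) + F y)) :=
      (ENNReal.Tendsto.mul (h.ratio.comp tendsto_fst) (Or.inr ENNReal.ofReal_ne_top)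
        (ENNReal.tendsto_ofReal h1) (Or.inl (by simpa using hc))).add (hfF y hy)
    filter_upwards [h2.eventually (lt_mem_nhds hη), h1.eventually (lt_mem_nhds hc)] with p hp hp1
    have hv := h.speed_pos p.1
    have hNv : 0 < N p.1 / v p.1 := div_pos (h.scale_pos p.1) hv
    rw [← ENNReal.ofReal_mul hNv.le, ← ENNReal.ofReal_add (by positivity) (hf0 _ _)] at hp
    have h3 := mul_le_mul_of_nonneg_left (ENNReal.ofReal_lt_ofReal_iff'.1 hp).1.le hv.le
    calc v p.1 * a ≤ _ := h3
      _ = _ := by field_simp; ring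

/-- The upper bound: exponential tightness confines the integral to a compact set, which is
covered by finitely many neighbourhoods each handled by one exponential tilt. -/
lemma exists_upper_bound (h : HasLimitLogMGF l v N γ ρ κi κ) (hS : IsClosed S)
    (hρS : ∀ i, ρ i Sᶜ = 0) (hf0 : ∀ i y, 0 ≤ f i y)
    (hfF : ContConv l S f F) {a : ℝ} (ha : 0 ≤ a)
    (hlt : ∀ y ∈ S, ENNReal.ofReal a < γ * legendre κ y + F y) :
    ∃ C : ℝ, 0 ≤ C ∧ ∀ᶠ i in l, ∫⁻ y, ENNReal.ofReal (Real.exp (-(v i * f i y))) ∂ρ i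
      ≤ ENNReal.ofReal (C * Real.exp (-(v i * a))) := by
  -- the sets satisfying the bound form an ideal, as needed for induction over compact sets
  let p : Set (ι → ℝ) → Prop := fun s => ∃ C : ℝ, 0 ≤ C ∧ ∀ᶠ i in l,
    ∫⁻ y in s ∩ S, ENNReal.ofReal (Real.exp (-(v i * f i y))) ∂ρ i
      ≤ ENNReal.ofReal (C * Real.exp (-(v i * a)))
  have p0 : p ∅ := ⟨0, le_rfl, by simp⟩
  have pmono : ∀ ⦃s t : Set (ι → ℝ)⦄, s ⊆ t → p t → p s := by
    rintro s t hst ⟨C, hC, hev⟩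
    refine ⟨C, hC, hev.mono fun i hi => le_trans ?_ hi⟩
    exact lintegral_mono_set (Set.inter_subset_inter_left _ hst)
  have punion : ∀ ⦃s t : Set (ι → ℝ)⦄, p s → p t → p (s ∪ t) := by
    rintro s t ⟨C, hC, hev⟩ ⟨D, hD, hev'⟩
    refine ⟨C + D, add_nonneg hC hD, (hev.and hev').mono fun i hi => ?_⟩
    rw [Set.union_inter_distrib_right, add_mul, ENNReal.ofReal_add (by positivity) (by positivity)]
    exact (lintegral_union_le _ _ _).trans (add_le_add hi.1 hi.2)
  have plocal : ∀ y ∈ S, ∃ t ∈ 𝓝 y, p t := by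
    intro y hy
    obtain ⟨η, hη⟩ := h.exists_local_tilt hf0 hfF hy (hlt y hy)
    obtain ⟨pa, hpa, pb, hpb, hab⟩ := eventually_prod_iff.1 hη
    obtain ⟨u, hu, hyu, hus⟩ := mem_nhdsWithin.1 hpb
    refine ⟨u, hu.mem_nhds hyu, 1, zero_le_one, hpa.mono fun i hi => ?_⟩
    rw [one_mul]
    exact h.chernoff i (hu.measurableSet.inter hS.measurableSet) fun y' hy' => hab hi (hus hy')
  -- since `N i` may be as small as `v i / 2`, the half-space is shifted by `2 a` rather than `a`
  have ptail : ∀ (η : ι → ℝ) (R : ℝ), κ η + 1 + 2 * a ≤ R → p {y | R ≤ η ⬝ᵥ y} := by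
    intro η R hR
    refine ⟨1, zero_le_one, ?_⟩
    filter_upwards [(h.tendsto η).eventually (gt_mem_nhds (lt_add_one (κ η))),
      h.eventually_half_le] with i hi hN
    rw [one_mul]
    have hm : MeasurableSet {y : ι → ℝ | R ≤ η ⬝ᵥ y} :=
      measurableSet_le measurable_const (continuous_dotProduct_right η).measurable
    refine h.chernoff (η := η) i (hm.inter hS.measurableSet) fun y hy => ?_
    have h1 : R ≤ η ⬝ᵥ y := hy.1
    have hv := h.speed_pos i
    have h2 : v i / 2 * (2 * a) ≤ N i * (η ⬝ᵥ y - κi i η) :=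
      mul_le_mul hN (by linarith) (by linarith) (h.scale_pos i).le
    have := mul_nonneg hv.le (hf0 i y)
    linarith
  obtain ⟨R, hR⟩ : ∃ R : ℝ, ∀ k : ι, κ (Pi.single k 1) + 1 + 2 * a ≤ R ∧
      κ (-Pi.single k 1) + 1 + 2 * a ≤ R := by
    have : ∀ᶠ R : ℝ in atTop, ∀ k : ι, κ (Pi.single k 1) + 1 + 2 * a ≤ R ∧
      κ (-Pi.single k 1) + 1 + 2 * a ≤ R :=
      eventually_all.2 fun k => (eventually_ge_atTop _).and (eventually_ge_atTop _)
    exact this.exists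
  have pfin : ∀ t : Finset ι, p (⋃ k ∈ t,
      ({y | R ≤ Pi.single k 1 ⬝ᵥ y} ∪ {y | R ≤ -Pi.single k 1 ⬝ᵥ y})) := by
    intro t
    induction t using Finset.induction_on with
    | empty => simpa using p0
    | insert k t _ ih =>
      rw [Finset.set_biUnion_insert]
      exact punion (punion (ptail _ _ (hR k).1) (ptail _ _ (hR k).2)) ih
  have pK : p (Metric.closedBall 0 |R| ∩ S) := by
    refine ((isCompact_closedBall 0 |R|).inter_right hS).induction_on p0 pmono punion ?_
    intro y hy
    obtain ⟨t, ht, hpt⟩ := plocal y hy.2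
    exact ⟨t, mem_nhdsWithin_of_mem_nhds ht, hpt⟩
  obtain ⟨C, hC, hev⟩ := pmono (s := S) (by
    intro y hy
    by_cases hyR : y ∈ Metric.closedBall 0 |R|
    · exact Or.inl ⟨hyR, hy⟩
    · right
      rw [mem_closedBall_zero_iff, pi_norm_le_iff_of_nonneg (abs_nonneg R)] at hyR
      push Not at hyR
      obtain ⟨k, hk⟩ := hyR
      refine Set.mem_biUnion (Finset.mem_univ k) ?_
      rw [Real.norm_eq_abs] at hk
      have h1 := (le_abs_self R).trans hk.le
      rcases le_abs.1 h1 with h2 | h2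
      · left; simpa using h2
      · right; simpa using h2) (punion pK (pfin Finset.univ))
  refine ⟨C, hC, hev.mono fun i hi => ?_⟩
  rw [Set.inter_self, setLIntegral_congr (t := Set.univ)] at hi
  · simpa using hi
  · exact eventuallyEq_univ.2 (by rw [mem_ae_iff]; exact hρS i)

/-- A tilt whose mean lies in a prescribed neighbourhood of `y` and whose entropic cost is at most
that of `y`. For `γ = ∞` the trivial tilt is the only affordable one, and it suffices. -/
lemma exists_tilt [l.NeBot] (h : HasLimitLogMGF l v N γ ρ κi κ) {y : ι → ℝ}
    (hy : γ * legendre κ y ≠ ∞) {U : Set (ι → ℝ)} (hU : U ∈ 𝓝 y) {ε : ℝ} (hε : 0 < ε) :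
    ∃ (η m : ι → ℝ) (r : ℝ), 0 < r ∧ Metric.ball m r ⊆ U ∧
      (∀ k, HasDerivAt (fun t : ℝ => κ (η + t • Pi.single k 1)) (m k) 0) ∧
      ∀ᶠ i in l, ∀ y' ∈ Metric.ball m r,
        N i * (η ⬝ᵥ y' - κi i η) ≤ v i * ((γ * legendre κ y).toReal + ε) := by
  have hκ0 := h.limit_zero
  obtain ⟨δ, hδ, hδU⟩ := Metric.mem_nhds_iff.1 hU
  by_cases hz : legendre κ y = 0
  · refine ⟨0, y, δ, hδ, hδU, hasDerivAt_zero_of_legendre_eq_zero hκ0 h.diff hz, ?_⟩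
    refine Eventually.of_forall fun i y' _ => ?_
    rw [h.logMGF_zero, zero_dotProduct, sub_zero, mul_zero]
    exact mul_nonneg (h.speed_pos i).le (add_nonneg ENNReal.toReal_nonneg hε.le)
  have hγ0 : γ ≠ 0 := (zero_lt_one.trans_le h.one_le).ne'
  have hγ : γ ≠ ∞ := fun h' => hy (by rw [h', ENNReal.top_mul hz])
  have hl : legendre κ y ≠ ∞ := fun h' => hy (by rw [h', ENNReal.mul_top hγ0])
  obtain ⟨η, m, hm, hd, hc⟩ := exists_gradient_near h.cont hκ0 h.diff hl hδ
  have hr : Tendsto (fun i => N i / v i) l (𝓝 γ.toReal) := by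
    refine ((ENNReal.tendsto_toReal hγ).comp h.ratio).congr fun i => ?_
    exact ENNReal.toReal_ofReal (div_pos (h.scale_pos i) (h.speed_pos i)).le
  have h1 : Tendsto (fun p : I × (ι → ℝ) => N p.1 / v p.1 * (η ⬝ᵥ p.2 - κi p.1 η)) (l ×ˢ 𝓝 m)
      (𝓝 (γ.toReal * (η ⬝ᵥ m - κ η))) :=
    (hr.comp tendsto_fst).mul ((((continuous_dotProduct_right η).tendsto m).comp tendsto_snd).sub
      ((h.tendsto η).comp tendsto_fst))
  have h2 : γ.toReal * (η ⬝ᵥ m - κ η) < (γ * legendre κ y).toReal + ε := by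
    rw [ENNReal.toReal_mul]
    have : η ⬝ᵥ m - κ η ≤ (legendre κ y).toReal := (ENNReal.ofReal_le_iff_le_toReal hl).1 hc
    have := mul_le_mul_of_nonneg_left this (ENNReal.toReal_nonneg (a := γ))
    linarith
  obtain ⟨pa, hpa, pb, hpb, hab⟩ := eventually_prod_iff.1 (h1.eventually (gt_mem_nhds h2))
  obtain ⟨r, hr0, hr⟩ := Metric.mem_nhds_iff.1
    (Filter.inter_mem hpb (Metric.isOpen_ball.mem_nhds (show m ∈ Metric.ball y δ by
      rwa [Metric.mem_ball, dist_eq_norm])))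
  refine ⟨η, m, r, hr0, fun z hz => hδU (hr hz).2, hd, hpa.mono fun i hi y' hy' => ?_⟩
  have h3 := mul_le_mul_of_nonneg_left (hab hi (hr hy').1).le (h.speed_pos i).le
  have hv := (h.speed_pos i).ne'
  calc N i * (η ⬝ᵥ y' - κi i η) = v i * (N i / v i * (η ⬝ᵥ y' - κi i η)) := by field_simp
    _ ≤ _ := h3

/-- The lower bound, by a change of measure concentrating near the given point. -/
lemma eventually_freeEnergy_lt [l.NeBot] (h : HasLimitLogMGF l v N γ ρ κi κ) (hS : IsClosed S)
    (hρS : ∀ i, ρ i Sᶜ = 0) (hf0 : ∀ i y, 0 ≤ f i y)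
    (hfF : ContConv l S f F) {y : ι → ℝ} (hy : y ∈ S) {b : ℝ}
    (hlt : γ * legendre κ y + F y < ENNReal.ofReal b) :
    ∀ᶠ i in l, freeEnergy (v i) (ρ i) (f i) < b := by
  have hJ : γ * legendre κ y ≠ ∞ := ne_top_of_lt (lt_of_le_of_lt le_self_add hlt)
  have hF : F y ≠ ∞ := ne_top_of_lt (lt_of_le_of_lt le_add_self hlt)
  set j := (γ * legendre κ y).toReal with hj
  set φ := (F y).toReal with hφ
  have hφ0 : 0 ≤ φ := ENNReal.toReal_nonneg
  have hj0 : 0 ≤ j := ENNReal.toReal_nonneg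
  have hjφ : j + φ < b := by
    rw [hj, hφ, ← ENNReal.toReal_add hJ hF]
    exact (ENNReal.lt_ofReal_iff_toReal_lt (ENNReal.add_ne_top.2 ⟨hJ, hF⟩)).1 hlt
  set ε := (b - j - φ) / 4 with hε
  have hε0 : 0 < ε := by rw [hε]; linarith
  have h1 : ∀ᶠ p in l ×ˢ 𝓝[S] y, ENNReal.ofReal (f p.1 p.2) < ENNReal.ofReal (φ + ε) :=
    (hfF y hy).eventually (gt_mem_nhds (by
      rw [← ENNReal.ofReal_toReal hF]
      exact (ENNReal.ofReal_lt_ofReal_iff (by linarith)).2 (by linarith)))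
  obtain ⟨pa, hpa, pb, hpb, hab⟩ := eventually_prod_iff.1 h1
  obtain ⟨U, hU, hUS⟩ := mem_nhdsWithin_iff_exists_mem_nhds_inter.1 hpb
  obtain ⟨η, m, r, hr, hrU, hd, hev⟩ := h.exists_tilt hJ hU hε0
  filter_upwards [hpa, hev, h.tilted_ball hd hr,
    h.speed_tendsto.eventually_gt_atTop (Real.log 2 / ε)] with i hi1 hi2 hi3 hi4
  have := h.prob i
  have hv := h.speed_pos i
  have hlow : ENNReal.ofReal (Real.exp (-(v i * (φ + j + 2 * ε)) - Real.log 2))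
      ≤ ∫⁻ y, ENNReal.ofReal (Real.exp (-(v i * f i y))) ∂ρ i := by
    have hball := (Metric.isOpen_ball (x := m) (ε := r)).measurableSet
    calc ENNReal.ofReal (Real.exp (-(v i * (φ + j + 2 * ε)) - Real.log 2))
        = ENNReal.ofReal (Real.exp (-(v i * (φ + j + 2 * ε)) - N i * κi i η)) *
            ENNReal.ofReal (Real.exp (N i * κi i η) / 2) := by
          rw [← ENNReal.ofReal_mul (Real.exp_pos _).le, Real.exp_sub, Real.exp_sub,
            Real.exp_log two_pos]
          congr 1; field_simp
      _ ≤ ENNReal.ofReal (Real.exp (-(v i * (φ + j + 2 * ε)) - N i * κi i η)) *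
            ∫⁻ y in Metric.ball m r, ENNReal.ofReal (Real.exp (N i * (η ⬝ᵥ y))) ∂ρ i := by
          gcongr
      _ = ∫⁻ y in Metric.ball m r ∩ S,
            ENNReal.ofReal (Real.exp (-(v i * (φ + j + 2 * ε)) - N i * κi i η)) *
            ENNReal.ofReal (Real.exp (N i * (η ⬝ᵥ y))) ∂ρ i := by
          rw [lintegral_const_mul _ (measurable_exp_mul_dotProduct _ _)]
          congr 1
          refine setLIntegral_congr ?_
          have : (S : Set (ι → ℝ)) =ᵐ[ρ i] Set.univ :=
            eventuallyEq_univ.2 (by rw [mem_ae_iff]; exact hρS i)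
          simpa using (Filter.EventuallyEq.rfl.inter this.symm :
            ((Metric.ball m r ∩ Set.univ : Set (ι → ℝ)) =ᵐ[ρ i] _))
      _ ≤ ∫⁻ y in Metric.ball m r ∩ S, ENNReal.ofReal (Real.exp (-(v i * f i y))) ∂ρ i := by
          refine setLIntegral_mono' (hball.inter hS.measurableSet) fun z hz => ?_
          rw [← ENNReal.ofReal_mul (Real.exp_pos _).le, ← Real.exp_add]
          refine ENNReal.ofReal_le_ofReal (Real.exp_le_exp.2 ?_)
          have e1 := hi2 z hz.1
          have e2 : f i z < φ + ε :=
            (ENNReal.ofReal_lt_ofReal_iff'.1 (hab hi1 (hUS ⟨hrU hz.1, hz.2⟩))).1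
          have e3 := mul_le_mul_of_nonneg_left e2.le hv.le
          nlinarith
      _ ≤ _ := setLIntegral_le_lintegral _ _
  refine (freeEnergy_le hv (hf0 i) hlow).trans_lt ?_
  rw [div_lt_iff₀ hε0] at hi4
  have e5 : -((-(v i * (φ + j + 2 * ε)) - Real.log 2) / v i)
      = φ + j + 2 * ε + Real.log 2 / v i := by field_simp; ring
  have e6 : Real.log 2 / v i < ε := by rw [div_lt_iff₀ hv]; linarith
  rw [e5]
  have : b = j + φ + 4 * ε := by rw [hε]; ring
  linarith

/-- **Gärtner–Ellis theorem** in Laplace form, for continuously converging test functions. -/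
theorem tendsto_freeEnergy [l.NeBot] (h : HasLimitLogMGF l v N γ ρ κi κ) (hS : IsClosed S)
    (hρS : ∀ i, ρ i Sᶜ = 0) (hf0 : ∀ i y, 0 ≤ f i y) {B : ℝ} (hfB : ∀ i y, f i y ≤ B)
    (hfF : ContConv l S f F) :
    Tendsto (fun i => ENNReal.ofReal (freeEnergy (v i) (ρ i) (f i))) l
      (𝓝 (⨅ y ∈ S, (γ * legendre κ y + F y))) := by
  refine tendsto_order.2 ⟨fun a ha => ?_, fun b hb => ?_⟩
  · obtain ⟨a₁, ha1, ha⟩ := ENNReal.lt_iff_exists_nnreal_btwn.1 ha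
    obtain ⟨a₂, ha2, ha⟩ := ENNReal.lt_iff_exists_nnreal_btwn.1 ha
    obtain ⟨C, hC, hev⟩ := h.exists_upper_bound (a := a₂) hS hρS hf0 hfF a₂.2 fun y hy => by
      rw [ENNReal.ofReal_coe_nnreal]
      exact ha.trans_le (iInf₂_le y hy)
    have h12 : (0 : ℝ) < a₂ - a₁ := sub_pos.2 (by exact_mod_cast ha2)
    filter_upwards [hev, h.speed_tendsto.eventually_gt_atTop (Real.log (C + 1) / (a₂ - a₁))]
      with i hi hi2
    have := h.prob i
    have hv := h.speed_pos i
    refine ha1.trans_le ?_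
    rw [← ENNReal.ofReal_coe_nnreal]
    refine ENNReal.ofReal_le_ofReal ?_
    refine le_trans ?_ (le_freeEnergy (T := Real.log (C + 1) - v i * a₂) hv (hfB i)
      (hi.trans (ENNReal.ofReal_le_ofReal ?_)))
    · rw [div_lt_iff₀ h12] at hi2
      rw [← neg_div, le_div_iff₀ hv]
      nlinarith
    · rw [Real.exp_sub, Real.exp_log (by linarith), Real.exp_neg, ← div_eq_mul_inv]
      gcongr
      linarith
  · obtain ⟨b₁, hb1, hb2⟩ := ENNReal.lt_iff_exists_nnreal_btwn.1 hb
    obtain ⟨y, hy⟩ := iInf_lt_iff.1 hb1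
    obtain ⟨hyS, hy⟩ := iInf_lt_iff.1 hy
    rw [← ENNReal.ofReal_coe_nnreal] at hy
    filter_upwards [h.eventually_freeEnergy_lt hS hρS hf0 hfF hyS hy] with i hi
    refine lt_of_le_of_lt ?_ hb2
    rw [← ENNReal.ofReal_coe_nnreal]
    exact ENNReal.ofReal_le_ofReal hi.le

end HasLimitLogMGF

end GartnerEllis

/-! ### Functions with compact sublevel sets -/

section Good

lemma lowerSemicontinuous_of_isCompact_level {X : Type*} [TopologicalSpace X] [T2Space X]
    {f : X → ℝ≥0∞} (hf : ∀ a : ℝ≥0, IsCompact {x | f x ≤ a}) : LowerSemicontinuous f := by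
  refine lowerSemicontinuous_iff_isClosed_preimage.2 fun a => ?_
  induction a with
  | top => simp
  | coe a => exact (hf a).isClosed

/-- The contraction principle for sublevel sets: infima over the fibres of a map which is continuous
where `Φ` is finite are attained, so the sublevel sets are images of compact sets. -/
lemma isCompact_level_iInf_fiber {Z Y : Type*} [TopologicalSpace Z] [T2Space Z]
    [TopologicalSpace Y] [T2Space Y] {Φ : Z → ℝ≥0∞} (hΦ : ∀ a : ℝ≥0, IsCompact {z | Φ z ≤ a})
    {p : Z → Y} (hp : ContinuousOn p {z | Φ z ≠ ∞}) (a : ℝ≥0) :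
    IsCompact {y | ⨅ (z : Z) (_ : p z = y), Φ z ≤ a} := by
  have hsub : ∀ b : ℝ≥0, {z | Φ z ≤ b} ⊆ {z | Φ z ≠ ∞} := fun b z hz =>
    ne_top_of_le_ne_top ENNReal.coe_ne_top hz
  have : {y | ⨅ (z : Z) (_ : p z = y), Φ z ≤ a} = p '' {z | Φ z ≤ a} := by
    ext y
    constructor
    · intro hy
      let s : ℕ → Set Z := fun k => {z | Φ z ≤ ((a + 1 / (k + 1) : ℝ≥0) : ℝ≥0∞)} ∩ p ⁻¹' {y}
      have hcl : ∀ k, IsClosed (s k) := fun k =>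
        (hp.mono (hsub _)).preimage_isClosed_of_isClosed (hΦ _).isClosed isClosed_singleton
      have hne : (⋂ k, s k).Nonempty := by
        refine IsCompact.nonempty_iInter_of_sequence_nonempty_isCompact_isClosed s ?_ ?_ ?_ hcl
        · intro k z hz
          have hz1 : Φ z ≤ ((a + 1 / ((k + 1 : ℕ) + 1) : ℝ≥0) : ℝ≥0∞) := hz.1
          refine ⟨show Φ z ≤ _ from hz1.trans ?_, hz.2⟩
          have : (1 : ℝ≥0) / ((k + 1 : ℕ) + 1) ≤ 1 / (k + 1) := by
            gcongr; simp
          exact_mod_cast add_le_add_right this a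
        · intro k
          have h1 : ⨅ (z : Z) (_ : p z = y), Φ z < ((a + 1 / (k + 1) : ℝ≥0) : ℝ≥0∞) := by
            refine lt_of_le_of_lt hy ?_
            exact_mod_cast lt_add_of_pos_right a (by positivity)
          obtain ⟨z, hz⟩ := iInf_lt_iff.1 h1
          obtain ⟨hz1, hz⟩ := iInf_lt_iff.1 hz
          exact ⟨z, hz.le, hz1⟩
        · exact (hΦ _).of_isClosed_subset (hcl 0) Set.inter_subset_left
      obtain ⟨z, hz⟩ := hne
      rw [Set.mem_iInter] at hz
      refine ⟨z, ?_, (hz 0).2⟩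
      have hlim : Tendsto (fun k : ℕ => ((a + 1 / (k + 1) : ℝ≥0) : ℝ≥0∞)) atTop (𝓝 a) := by
        rw [ENNReal.tendsto_coe]
        simpa using (tendsto_one_div_add_atTop_nhds_zero_nat (𝕜 := ℝ≥0)).const_add a
      exact ge_of_tendsto' hlim fun k => (hz k).1
    · rintro ⟨z, hz, rfl⟩
      exact (iInf₂_le (f := fun (w : Z) (_ : p w = p z) => Φ w) z rfl).trans hz
  rw [this]
  exact (hΦ a).image_of_continuousOn (hp.mono (hsub a))

/-- Goodness is inherited along one step of a chain. The sublevel sets of the cost `J` of the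
step need only be compact over compact subsets of a set `D` containing the domain of `R`. -/
lemma isCompact_level_iInf_add {X Y : Type*} [TopologicalSpace X] [T2Space X]
    [TopologicalSpace Y] [T2Space Y] {R : X → ℝ≥0∞} (hR : ∀ a : ℝ≥0, IsCompact {x | R x ≤ a})
    {D : Set X} (hRD : ∀ x, R x ≠ ∞ → x ∈ D) {J : X → Y → ℝ≥0∞}
    (hJ : ∀ K ⊆ D, IsCompact K → ∀ a : ℝ≥0, IsCompact {p : X × Y | p.1 ∈ K ∧ J p.1 p.2 ≤ a})
    (a : ℝ≥0) : IsCompact {y | ⨅ x, (R x + J x y) ≤ a} := by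
  classical
  have hlev : ∀ b : ℝ≥0, IsCompact {p : X × Y | R p.1 + J p.1 p.2 ≤ b} := by
    intro b
    set K := {x | R x ≤ b} with hK
    have hKD : K ⊆ D := fun x hx => hRD x (ne_top_of_le_ne_top ENNReal.coe_ne_top hx)
    let J' : X × Y → ℝ≥0∞ := fun p => if p.1 ∈ K then J p.1 p.2 else ∞
    have hJ' : ∀ c : ℝ≥0, IsCompact {p | J' p ≤ c} := fun c => by
      convert hJ K hKD (hR b) c using 1
      ext p
      by_cases hp : p.1 ∈ K <;> simp [J', hp]
    have hlsc : LowerSemicontinuous fun p : X × Y => R p.1 + J' p :=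
      ((lowerSemicontinuous_of_isCompact_level hR).comp continuous_fst).add
        (lowerSemicontinuous_of_isCompact_level hJ')
    have heq : {p : X × Y | R p.1 + J p.1 p.2 ≤ b} = {p | R p.1 + J' p ≤ b} := by
      ext p
      by_cases hp : p.1 ∈ K
      · simp [J', hp]
      · have h1 : ¬ R p.1 ≤ b := hp
        simp only [Set.mem_ofPred_eq, J', hp, if_false]
        constructor
        · intro h; exact absurd (le_self_add.trans h) h1
        · intro h; exact absurd (le_self_add.trans h) h1
    rw [heq]
    refine (hJ' b).of_isClosed_subset (hlsc.isClosed_preimage _) fun p hp => ?_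
    exact (le_add_self : J' p ≤ R p.1 + J' p).trans hp
  convert isCompact_level_iInf_fiber hlev continuous_snd.continuousOn a using 4 with y
  refine le_antisymm (le_iInf₂ fun z hz => ?_) (le_iInf fun x => ?_)
  · subst hz; exact iInf_le _ z.1
  · exact iInf₂_le (f := fun (z : X × Y) (_ : z.2 = y) => R z.1 + J z.1 z.2) (x, y) rfl

end Good

/-! ### From the Laplace principle to the large deviation principle -/

section Laplace

lemma coe_freeEnergy {X : Type*} [MeasurableSpace X] {μ : Measure X} [IsProbabilityMeasure μ]
    {v B : ℝ} (hv : 0 < v) {F : X → ℝ} (hF0 : ∀ x, 0 ≤ F x) (hFB : ∀ x, F x ≤ B) :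
    ENNReal.log (∫⁻ x, ENNReal.ofReal (Real.exp (-(v * F x))) ∂μ) / (v : EReal)
      = -((ENNReal.ofReal (freeEnergy v μ F) : ℝ≥0∞) : EReal) := by
  have h0 : ∫⁻ x, ENNReal.ofReal (Real.exp (-(v * F x))) ∂μ ≠ 0 :=
    ((ENNReal.ofReal_pos.2 (Real.exp_pos _)).trans_le (le_lintegral_exp hv hFB)).ne'
  have ht : ∫⁻ x, ENNReal.ofReal (Real.exp (-(v * F x))) ∂μ ≠ ∞ :=
    ne_top_of_le_ne_top ENNReal.one_ne_top (lintegral_exp_le_one hv hF0)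
  rw [EReal.coe_ennreal_ofReal, max_eq_left (freeEnergy_nonneg hv hF0 hFB), ENNReal.log,
    if_neg h0, if_neg ht, ← EReal.coe_div, ← EReal.coe_neg, freeEnergy, neg_neg]

variable {X : Type*} [MetricSpace X] [MeasurableSpace X] [BorelSpace X]

/-- A Laplace principle for bounded continuous test functions, with a rate function having compact
sublevel sets, implies the large deviation principle. -/
theorem isGoodLDP_of_laplace {v : ℕ → ℝ} {μ : ℕ → Measure X} {I : X → ℝ≥0∞}
    (hv : ∀ n, 0 < v n) (hvt : Tendsto v atTop atTop) (hμ : ∀ n, IsProbabilityMeasure (μ n))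
    (hI : ∀ a : ℝ≥0, IsCompact {x | I x ≤ a})
    (hL : ∀ F : X → ℝ, Continuous F → (∀ x, 0 ≤ F x) → (∃ B, ∀ x, F x ≤ B) →
      Tendsto (fun n => ENNReal.ofReal (freeEnergy (v n) (μ n) F)) atTop
        (𝓝 (⨅ x, (I x + ENNReal.ofReal (F x))))) :
    IsGoodLDP v μ I where
  speed_pos := hv
  speed_tendsto := hvt
  isProbabilityMeasure := hμ
  lowerSemicontinuous := lowerSemicontinuous_of_isCompact_level hI
  isCompact_level := hI
  upper := by
    intro C hC
    have hvE : ∀ n, (0 : EReal) ≤ (v n : EReal) := fun n => EReal.coe_nonneg.2 (hv n).le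
    refine le_of_forall_gt_imp_ge_of_dense fun c hc => ?_
    rcases le_or_gt 0 c with hc0 | hc0
    · refine (limsup_le_of_le (h := Eventually.of_forall fun n => ?_)).trans hc0
      have := hμ n
      refine EReal.div_nonpos_of_nonpos_of_nonneg ?_ (hvE n)
      rw [← ENNReal.log_one]
      exact ENNReal.log_le_log prob_le_one
    set a : ℝ≥0∞ := (-c).toENNReal with ha
    have hac : (a : EReal) = -c := EReal.coe_toENNReal (by
      have := EReal.neg_lt_neg_iff.2 hc0
      simpa using this.le)
    have ham : a < ⨅ x ∈ C, I x := by
      have : (a : EReal) < ((⨅ x ∈ C, I x : ℝ≥0∞) : EReal) := by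
        rw [hac]; exact EReal.neg_lt_comm.1 hc
      exact_mod_cast this
    lift a to ℝ≥0 using ne_top_of_lt ham with a' ha'
    rcases C.eq_empty_or_nonempty with rfl | hCne
    · refine limsup_le_of_le (h := Eventually.of_forall fun n => ?_)
      simp [EReal.bot_div_of_pos_ne_top (EReal.coe_pos.2 (hv n)) (EReal.coe_ne_top _)]
    -- a continuous function vanishing on `C` and equal to `a'` where the rate is at most `a'`
    obtain ⟨δ, hδ, hδK⟩ : ∃ δ > 0, ∀ x, I x ≤ a' → δ ≤ Metric.infDist x C := by
      rcases {x | I x ≤ a'}.eq_empty_or_nonempty with he | hne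
      · exact ⟨1, one_pos, fun x hx => by
          have : x ∈ {x | I x ≤ a'} := hx
          rw [he] at this; exact this.elim⟩
      · obtain ⟨x₀, hx₀, hmin⟩ := (hI a').exists_isMinOn hne
          (Metric.continuous_infDist_pt C).continuousOn
        refine ⟨Metric.infDist x₀ C, ?_, fun x hx => hmin hx⟩
        refine (hC.notMem_iff_infDist_pos hCne).1 ?_
        intro hx₀C
        exact absurd (hx₀ : I x₀ ≤ a') (not_le.2 (ham.trans_le (iInf₂_le x₀ hx₀C)))
    let F : X → ℝ := fun x => a' * min (Metric.infDist x C / δ) 1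
    have hFc : Continuous F := by
      have := Metric.continuous_infDist_pt C
      fun_prop
    have hF0 : ∀ x, 0 ≤ F x := fun x =>
      mul_nonneg a'.2 (le_min (div_nonneg Metric.infDist_nonneg hδ.le) zero_le_one)
    have hFB : ∀ x, F x ≤ a' := fun x => mul_le_of_le_one_right a'.2 (min_le_right _ _)
    have hlim := hL F hFc hF0 ⟨_, hFB⟩
    have hge : (a' : ℝ≥0∞) ≤ ⨅ x, (I x + ENNReal.ofReal (F x)) := by
      refine le_iInf fun x => ?_
      by_cases hx : I x ≤ a'
      · have : F x = a' := by
          simp only [F]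
          rw [min_eq_right ((one_le_div hδ).2 (hδK x hx)), mul_one]
        rw [this, ENNReal.ofReal_coe_nnreal]
        exact le_add_self
      · exact (not_le.1 hx).le.trans le_self_add
    have hle : ∀ n, ENNReal.log (μ n C) / (v n : EReal)
        ≤ -((ENNReal.ofReal (freeEnergy (v n) (μ n) F) : ℝ≥0∞) : EReal) := by
      intro n
      have := hμ n
      rw [← coe_freeEnergy (hv n) hF0 hFB]
      refine EReal.div_le_div_right_of_nonneg (hvE n) (ENNReal.log_le_log ?_)
      calc μ n C = ∫⁻ _ in C, 1 ∂μ n := by simp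
        _ ≤ ∫⁻ x in C, ENNReal.ofReal (Real.exp (-(v n * F x))) ∂μ n := by
            refine setLIntegral_mono' hC.measurableSet fun x hx => ?_
            simp [F, Metric.infDist_zero_of_mem hx]
        _ ≤ _ := setLIntegral_le_lintegral _ _
    have hlim2 : Tendsto (fun n => -((ENNReal.ofReal (freeEnergy (v n) (μ n) F) : ℝ≥0∞) : EReal))
        atTop (𝓝 (-((⨅ x, (I x + ENNReal.ofReal (F x)) : ℝ≥0∞) : EReal))) :=
      (continuous_neg.tendsto _).comp ((continuous_coe_ennreal_ereal.tendsto _).comp hlim)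
    calc limsup (fun n => ENNReal.log (μ n C) / (v n : EReal)) atTop
        ≤ limsup (fun n => -((ENNReal.ofReal (freeEnergy (v n) (μ n) F) : ℝ≥0∞) : EReal)) atTop :=
          limsup_le_limsup (Eventually.of_forall hle)
      _ = -((⨅ x, (I x + ENNReal.ofReal (F x)) : ℝ≥0∞) : EReal) := hlim2.limsup_eq
      _ ≤ -((a' : ℝ≥0∞) : EReal) := EReal.neg_le_neg_iff.2 (by exact_mod_cast hge)
      _ = c := by rw [hac, neg_neg]
  lower := by
    intro O hO
    have hvE : ∀ n, (0 : EReal) ≤ (v n : EReal) := fun n => EReal.coe_nonneg.2 (hv n).le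
    refine le_of_forall_lt_imp_le_of_dense fun c hc => ?_
    induction c with
    | bot => exact bot_le
    | top => exact absurd hc (by simp)
    | coe c =>
    have h1 : ((⨅ x ∈ O, I x : ℝ≥0∞) : EReal) < ((-c : ℝ) : EReal) := by
      rw [EReal.coe_neg]; exact EReal.lt_neg_comm.1 hc
    have hcpos : 0 < -c := by
      have : (0 : EReal) < ((-c : ℝ) : EReal) := lt_of_le_of_lt (EReal.coe_ennreal_nonneg _) h1
      exact_mod_cast this
    have h2 : ⨅ x ∈ O, I x < ENNReal.ofReal (-c) := by
      have : ((-c : ℝ) : EReal) = ((ENNReal.ofReal (-c) : ℝ≥0∞) : EReal) := by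
        rw [EReal.coe_ennreal_ofReal, max_eq_left hcpos.le]
      rw [this] at h1
      exact_mod_cast h1
    obtain ⟨x, hx⟩ := iInf_lt_iff.1 h2
    obtain ⟨hxO, hx⟩ := iInf_lt_iff.1 hx
    obtain ⟨t, ht1, ht2⟩ := ENNReal.lt_iff_exists_nnreal_btwn.1 hx
    have htc : (t : ℝ) < -c := by
      rw [← ENNReal.ofReal_coe_nnreal] at ht2
      exact (ENNReal.ofReal_lt_ofReal_iff hcpos).1 ht2
    obtain ⟨δ, hδ, hδO⟩ := Metric.isOpen_iff.1 hO x hxO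
    -- outside `O` this test function exceeds `t` by one, so the complement contributes negligibly
    let F : X → ℝ := fun y => (t + 1) * min (dist y x / δ) 1
    have hFc : Continuous F := by fun_prop
    have ht0 : (0 : ℝ) ≤ t := t.2
    have hF0 : ∀ x, 0 ≤ F x := fun x =>
      mul_nonneg (by positivity) (le_min (div_nonneg dist_nonneg hδ.le) zero_le_one)
    have hFB : ∀ x, F x ≤ t + 1 := fun x =>
      mul_le_of_le_one_right (by positivity) (min_le_right _ _)
    have hlt : ⨅ y, (I y + ENNReal.ofReal (F y)) < t :=
      lt_of_le_of_lt (iInf_le _ x) (by simpa [F] using ht1)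
    have hgap : 0 < -c - t := by linarith
    refine le_liminf_of_le (h := ?_)
    filter_upwards [(hL F hFc hF0 ⟨_, hFB⟩).eventually (gt_mem_nhds hlt),
      hvt.eventually_gt_atTop (Real.log 2), hvt.eventually_gt_atTop (Real.log 2 / (-c - t))]
      with n hn hn2 hn3
    have := hμ n
    have hvn := hv n
    set T := ∫⁻ x, ENNReal.ofReal (Real.exp (-(v n * F x))) ∂μ n with hT
    have hTtop : T ≠ ∞ :=
      ne_top_of_le_ne_top ENNReal.one_ne_top (lintegral_exp_le_one hvn hF0)
    have hTpos : 0 < T.toReal := by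
      refine ENNReal.toReal_pos ?_ hTtop
      exact ((ENNReal.ofReal_pos.2 (Real.exp_pos _)).trans_le (le_lintegral_exp hvn hFB)).ne'
    have hTlow : Real.exp (-(v n * t)) < T.toReal := by
      rw [← ENNReal.ofReal_coe_nnreal] at hn
      have h3 := (ENNReal.ofReal_lt_ofReal_iff'.1 hn).1
      rw [freeEnergy, ← neg_div, div_lt_iff₀ hvn] at h3
      rw [← Real.lt_log_iff_exp_lt hTpos]
      linarith
    have hTup : T ≤ μ n O + ENNReal.ofReal (Real.exp (-(v n * (t + 1)))) := by
      rw [hT, ← lintegral_add_compl _ hO.measurableSet]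
      refine add_le_add ?_ ?_
      · calc _ ≤ ∫⁻ _ in O, 1 ∂μ n := lintegral_mono fun y => by
              rw [← ENNReal.ofReal_one]
              refine ENNReal.ofReal_le_ofReal (Real.exp_le_one_iff.2 ?_)
              have := mul_nonneg hvn.le (hF0 y)
              linarith
          _ = μ n O := by simp
      · calc _ ≤ ∫⁻ _ in Oᶜ, ENNReal.ofReal (Real.exp (-(v n * (t + 1)))) ∂μ n := by
              refine setLIntegral_mono' hO.measurableSet.compl fun y hy => ?_
              have : F y = t + 1 := by
                have hd : δ ≤ dist y x := by
                  by_contra hlt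
                  exact hy (hδO (not_le.1 hlt))
                simp only [F]
                rw [min_eq_right ((one_le_div hδ).2 hd), mul_one]
              rw [this]
          _ ≤ _ := by
              rw [setLIntegral_const]
              exact mul_le_of_le_one_right zero_le prob_le_one
    have hOlow : Real.exp (-(v n * t) - Real.log 2) ≤ (μ n O).toReal := by
      have h3 := (ENNReal.toReal_le_toReal hTtop (by finiteness)).2 hTup
      rw [ENNReal.toReal_add (by finiteness) (by finiteness),
        ENNReal.toReal_ofReal (Real.exp_pos _).le] at h3
      have h4 : Real.exp (-(v n * (t + 1))) ≤ Real.exp (-(v n * t) - Real.log 2) :=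
        Real.exp_le_exp.2 (by linarith)
      have h5 : Real.exp (-(v n * t)) = 2 * Real.exp (-(v n * t) - Real.log 2) := by
        rw [Real.exp_sub, Real.exp_log two_pos]; ring
      linarith
    have hOne : μ n O ≠ 0 := fun h0 => by
      rw [h0] at hOlow
      exact absurd hOlow (not_le.2 (by simpa using Real.exp_pos _))
    rw [ENNReal.log, if_neg hOne, if_neg (measure_ne_top _ _), ← EReal.coe_div,
      EReal.coe_le_coe_iff, le_div_iff₀ hvn]
    have h6 := Real.log_le_log (Real.exp_pos _) hOlow
    rw [Real.log_exp] at h6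
    rw [div_lt_iff₀ hgap] at hn3
    nlinarith

end Laplace

/-! ### Continuity of the matrix square root -/

section Sqrt

variable {A : Type*} [Fintype A]

instance : FirstCountableTopology (Matrix A A ℝ) :=
  inferInstanceAs (FirstCountableTopology (A → A → ℝ))

instance : MeasurableSpace (Matrix A A ℝ) := inferInstanceAs (MeasurableSpace (A → A → ℝ))

instance : BorelSpace (Matrix A A ℝ) := inferInstanceAs (BorelSpace (A → A → ℝ))

lemma continuous_matrix_apply {A : Type*} (α β : A) : Continuous fun q : Matrix A A ℝ => q α β :=
  (continuous_apply β).comp (continuous_apply α)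

lemma isClosed_posSemidef : IsClosed {q : Matrix A A ℝ | q.PosSemidef} := by
  simp only [Matrix.posSemidef_iff_dotProduct_mulVec, Matrix.IsHermitian]
  refine IsClosed.and (isClosed_eq ?_ continuous_id) ?_
  · exact continuous_id.matrix_conjTranspose
  · rw [Set.ofPred_forall]
    exact isClosed_iInter fun x => isClosed_le continuous_const
      (continuous_const.dotProduct (continuous_id.matrix_mulVec continuous_const))

lemma isClosed_covSet (Cb : ℝ) : IsClosed (covSet A Cb) :=
  isClosed_posSemidef.and (isClosed_posSemidef.preimage (continuous_id.sub continuous_const))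

variable [DecidableEq A]

lemma psdSqrt_posSemidef (q : Matrix A A ℝ) : (psdSqrt q).PosSemidef :=
  Matrix.nonneg_iff_posSemidef.mp (CFC.sqrt_nonneg q)

lemma psdSqrt_mul_self {q : Matrix A A ℝ} (hq : q.PosSemidef) : psdSqrt q * psdSqrt q = q :=
  CFC.sqrt_mul_sqrt_self q hq.nonneg

lemma psdSqrt_comm (q : Matrix A A ℝ) (α β : A) : psdSqrt q α β = psdSqrt q β α := by
  have := (psdSqrt_posSemidef q).1.apply β α
  simpa using this

lemma sum_psdSqrt_mul {q : Matrix A A ℝ} (hq : q.PosSemidef) (α β : A) :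
    ∑ γ, psdSqrt q α γ * psdSqrt q β γ = q α β := by
  conv_rhs => rw [← psdSqrt_mul_self hq, Matrix.mul_apply]
  exact Finset.sum_congr rfl fun γ _ => by rw [psdSqrt_comm q β γ]

/-- The square root is continuous on the positive semidefinite cone: it is locally bounded there,
and each of its cluster values is a positive semidefinite root of the limit. -/
lemma continuousOn_psdSqrt : ContinuousOn (psdSqrt (A := A)) {q | q.PosSemidef} := by
  intro q₀ hq₀
  let s : Set (Matrix A A ℝ) := {p | p.PosSemidef} ∩
    Set.pi Set.univ fun α => Set.pi Set.univ fun _ => Set.Icc (-√(q₀ α α + 1)) (√(q₀ α α + 1))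
  have hs : IsCompact s := by
    refine IsCompact.inter_left ?_ isClosed_posSemidef
    exact isCompact_univ_pi fun α => isCompact_univ_pi fun _ => isCompact_Icc
  refine hs.tendsto_nhds_of_unique_mapClusterPt ?_ ?_
  · have h1 : ∀ᶠ q in 𝓝[{q : Matrix A A ℝ | q.PosSemidef}] q₀, ∀ α, q α α < q₀ α α + 1 :=
      eventually_all.2 fun α => nhdsWithin_le_nhds
        (((continuous_matrix_apply α α).tendsto q₀).eventually (gt_mem_nhds (lt_add_one _)))
    filter_upwards [h1, self_mem_nhdsWithin] with q hq hqS
    refine ⟨psdSqrt_posSemidef q, fun α _ β _ => abs_le.1 (Real.abs_le_sqrt ?_)⟩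
    refine le_trans ?_ (hq α).le
    rw [← sum_psdSqrt_mul hqS, sq]
    exact Finset.single_le_sum (f := fun γ => psdSqrt q α γ * psdSqrt q α γ)
      (fun γ _ => mul_self_nonneg _) (Finset.mem_univ β)
  · intro p hp hcl
    symm
    rw [psdSqrt_spec hq₀]
    refine ⟨hp.1, ?_⟩
    have hmul : Continuous fun p : Matrix A A ℝ => p * p := continuous_id.matrix_mul continuous_id
    have h2 := hcl.continuousAt_comp (f := fun p : Matrix A A ℝ => p * p) hmul.continuousAt
    have h3 : Tendsto ((fun p : Matrix A A ℝ => p * p) ∘ psdSqrt)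
        (𝓝[{q : Matrix A A ℝ | q.PosSemidef}] q₀) (𝓝 q₀) := by
      refine (tendsto_id.mono_right nhdsWithin_le_nhds).congr' ?_
      filter_upwards [self_mem_nhdsWithin] with q hq
      exact (psdSqrt_mul_self hq).symm
    have h4 : ClusterPt (p * p) (𝓝 q₀) := ClusterPt.mono h2 h3
    exact eq_of_nhds_neBot h4

lemma measurable_psdSqrt : Measurable (psdSqrt (A := A)) := by
  classical
  have h : psdSqrt (A := A) = Set.piecewise {q | q.PosSemidef} psdSqrt 0 := by
    ext1 q
    by_cases hq : q.PosSemidef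
    · rw [Set.piecewise_eq_of_mem _ _ _ (show q ∈ {q | q.PosSemidef} from hq)]
    · -- off the cone the continuous functional calculus takes the junk value `0`
      rw [Set.piecewise_eq_of_notMem _ _ _ (show q ∉ {q | q.PosSemidef} from hq)]
      exact cfcₙ_apply_of_not_predicate _ fun h => hq (Matrix.nonneg_iff_posSemidef.mp h)
  rw [h]
  exact continuousOn_psdSqrt.measurable_piecewise continuousOn_const
    isClosed_posSemidef.measurableSet

end Sqrt

/-! ### Logarithmic moment generating functions of bounded random vectors -/

section LogMGF

variable {ι : Type*} [Fintype ι] {Ω : Type*} [MeasurableSpace Ω]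

/-- The logarithmic moment generating function of the random vector `ξ`. -/
def logMGF (P : Measure Ω) (ξ : Ω → ι → ℝ) (η : ι → ℝ) : ℝ :=
  Real.log (∫ ω, Real.exp (η ⬝ᵥ ξ ω) ∂P)

lemma abs_dotProduct_le {D : ℝ} {x : ι → ℝ} (hx : ∀ k, |x k| ≤ D) (η : ι → ℝ) :
    |η ⬝ᵥ x| ≤ (∑ k, |η k|) * D := by
  rw [Finset.sum_mul]
  refine (Finset.abs_sum_le_sum_abs _ _).trans (Finset.sum_le_sum fun k _ => ?_)
  rw [abs_mul]
  exact mul_le_mul_of_nonneg_left (hx k) (abs_nonneg _)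

variable {P : Measure Ω} [IsProbabilityMeasure P] {ξ : Ω → ι → ℝ} {D : ℝ}

lemma measurable_dotProduct_left {ξ : Ω → ι → ℝ} (hξ : Measurable ξ) (η : ι → ℝ) :
    Measurable fun ω => η ⬝ᵥ ξ ω :=
  (continuous_dotProduct_right η).measurable.comp hξ

lemma integrable_exp_dotProduct (hξ : Measurable ξ) (hD : ∀ ω k, |ξ ω k| ≤ D) (η : ι → ℝ) :
    Integrable (fun ω => Real.exp (η ⬝ᵥ ξ ω)) P := by
  refine Integrable.of_bound (C := Real.exp ((∑ k, |η k|) * D))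
    (measurable_dotProduct_left hξ η).exp.aestronglyMeasurable (Eventually.of_forall fun ω => ?_)
  rw [Real.norm_of_nonneg (Real.exp_pos _).le]
  exact Real.exp_le_exp.2 ((le_abs_self _).trans (abs_dotProduct_le (hD ω) η))

lemma integral_exp_dotProduct_pos (hξ : Measurable ξ) (hD : ∀ ω k, |ξ ω k| ≤ D) (η : ι → ℝ) :
    0 < ∫ ω, Real.exp (η ⬝ᵥ ξ ω) ∂P :=
  integral_exp_pos (integrable_exp_dotProduct hξ hD η)

lemma exp_logMGF (hξ : Measurable ξ) (hD : ∀ ω k, |ξ ω k| ≤ D) (η : ι → ℝ) :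
    Real.exp (logMGF P ξ η) = ∫ ω, Real.exp (η ⬝ᵥ ξ ω) ∂P :=
  Real.exp_log (integral_exp_dotProduct_pos hξ hD η)

lemma logMGF_zero (P : Measure Ω) [IsProbabilityMeasure P] (ξ : Ω → ι → ℝ) : logMGF P ξ 0 = 0 := by
  simp [logMGF]

lemma logMGF_le (hξ : Measurable ξ) (hD : ∀ ω k, |ξ ω k| ≤ D) (η : ι → ℝ) :
    logMGF P ξ η ≤ (∑ k, |η k|) * D := by
  rw [← Real.exp_le_exp, exp_logMGF hξ hD]
  calc ∫ ω, Real.exp (η ⬝ᵥ ξ ω) ∂P ≤ ∫ _, Real.exp ((∑ k, |η k|) * D) ∂P :=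
        integral_mono (integrable_exp_dotProduct hξ hD η) (integrable_const _) fun ω =>
          Real.exp_le_exp.2 ((le_abs_self _).trans (abs_dotProduct_le (hD ω) η))
    _ = _ := by simp

/-- Joint continuity of the logarithmic moment generating function in its argument and in a
parameter on which the random vector depends continuously. -/
lemma continuousWithinAt_logMGF {X : Type*} [TopologicalSpace X] [FirstCountableTopology X]
    {ξ : X → Ω → ι → ℝ} (hξ : ∀ x, Measurable (ξ x)) (hD : ∀ x ω k, |ξ x ω k| ≤ D) {s : Set X}
    {x₀ : X} (hc : ∀ ω, ContinuousWithinAt (fun x => ξ x ω) s x₀) (η₀ : ι → ℝ) :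
    ContinuousWithinAt (fun p : (ι → ℝ) × X => logMGF P (ξ p.2) p.1) (Set.univ ×ˢ s) (η₀, x₀) := by
  have hdot : ∀ ω, ContinuousWithinAt (fun p : (ι → ℝ) × X => p.1 ⬝ᵥ ξ p.2 ω) (Set.univ ×ˢ s)
      (η₀, x₀) := fun ω => by
    have h1 : ContinuousWithinAt (fun p : (ι → ℝ) × X => ξ p.2 ω) (Set.univ ×ˢ s) (η₀, x₀) :=
      (hc ω).comp (f := Prod.snd) (x := (η₀, x₀)) continuous_snd.continuousWithinAt
        fun p hp => hp.2
    unfold dotProduct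
    refine tendsto_finsetSum _ fun k _ => ?_
    exact (((continuous_apply k).comp continuous_fst).continuousWithinAt).mul
      ((continuous_apply k).continuousAt.comp_continuousWithinAt h1)
  unfold logMGF
  refine ContinuousWithinAt.log ?_
    (integral_exp_dotProduct_pos (P := P) (hξ x₀) (hD x₀) η₀).ne'
  have hev : ∀ᶠ p : (ι → ℝ) × X in 𝓝[Set.univ ×ˢ s] (η₀, x₀),
      ∑ k, |p.1 k| < ∑ k, |η₀ k| + 1 := by
    have h2 : Continuous fun p : (ι → ℝ) × X => ∑ k, |p.1 k| := by fun_prop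
    exact nhdsWithin_le_nhds ((h2.tendsto (η₀, x₀)).eventually (gt_mem_nhds (lt_add_one _)))
  refine continuousWithinAt_of_dominated
    (bound := fun _ => Real.exp ((∑ k, |η₀ k| + 1) * |D|)) ?_ ?_ (integrable_const _) ?_
  · exact Eventually.of_forall fun p =>
      (measurable_dotProduct_left (hξ p.2) p.1).exp.aestronglyMeasurable
  · filter_upwards [hev] with p hp
    refine Eventually.of_forall fun ω => ?_
    rw [Real.norm_of_nonneg (Real.exp_pos _).le]
    refine Real.exp_le_exp.2 ((le_abs_self _).trans ((abs_dotProduct_le (hD p.2 ω) p.1).trans ?_))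
    calc (∑ k, |p.1 k|) * D ≤ (∑ k, |p.1 k|) * |D| := by gcongr; exact le_abs_self D
      _ ≤ _ := by gcongr
  · exact Eventually.of_forall fun ω => (hdot ω).rexp

lemma continuous_logMGF (hξ : Measurable ξ) (hD : ∀ ω k, |ξ ω k| ≤ D) :
    Continuous (logMGF P ξ) := by
  refine continuous_iff_continuousAt.2 fun η => ?_
  have h := continuousWithinAt_logMGF (P := P) (X := Unit) (ξ := fun _ => ξ) (s := Set.univ)
    (x₀ := ()) (fun _ => hξ) (fun _ => hD) (fun _ => continuousWithinAt_const) η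
  rw [Set.univ_prod_univ, continuousWithinAt_univ] at h
  exact h.comp (f := fun η : ι → ℝ => (η, ())) (x := η) (by fun_prop)

/-- Jensen's inequality for the exponential function. -/
lemma dotProduct_mean_le_logMGF (hξ : Measurable ξ) (hD : ∀ ω k, |ξ ω k| ≤ D) (η : ι → ℝ) :
    η ⬝ᵥ (fun k => ∫ ω, ξ ω k ∂P) ≤ logMGF P ξ η := by
  have hint : ∀ k, Integrable (fun ω => ξ ω k) P := fun k =>
    Integrable.of_bound (C := D) ((measurable_pi_apply k).comp hξ).aestronglyMeasurable
      (Eventually.of_forall fun ω => hD ω k)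
  have hint2 : Integrable (fun ω => η ⬝ᵥ ξ ω) P :=
    integrable_finsetSum _ fun k _ => (hint k).const_mul _
  have hm : η ⬝ᵥ (fun k => ∫ ω, ξ ω k ∂P) = ∫ ω, η ⬝ᵥ ξ ω ∂P := by
    simp only [dotProduct]
    rw [integral_finsetSum _ fun k _ => (hint k).const_mul _]
    simp only [integral_const_mul]
  set m := η ⬝ᵥ (fun k => ∫ ω, ξ ω k ∂P)
  rw [logMGF, Real.le_log_iff_exp_le (integral_exp_dotProduct_pos hξ hD η)]
  calc Real.exp m = ∫ ω, Real.exp m * (η ⬝ᵥ ξ ω - m + 1) ∂P := by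
        have e1 : ∫ ω, (η ⬝ᵥ ξ ω - m + 1) ∂P = ∫ ω, (η ⬝ᵥ ξ ω - m) ∂P + ∫ _, 1 ∂P :=
          integral_add (hint2.sub (integrable_const _)) (integrable_const _)
        rw [integral_const_mul, e1, integral_sub hint2 (integrable_const _), ← hm]
        simp
    _ ≤ ∫ ω, Real.exp (η ⬝ᵥ ξ ω) ∂P := by
        refine integral_mono (((hint2.sub (integrable_const _)).add
          (integrable_const _)).const_mul _) (integrable_exp_dotProduct hξ hD η) fun ω => ?_
        have := Real.add_one_le_exp (η ⬝ᵥ ξ ω - m)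
        calc Real.exp m * (η ⬝ᵥ ξ ω - m + 1) ≤ Real.exp m * Real.exp (η ⬝ᵥ ξ ω - m) := by gcongr
          _ = _ := by rw [← Real.exp_add]; congr 1; ring

/-- The law of the empirical mean of `n` independent copies of `ξ`. -/
def empiricalLaw (P : Measure Ω) (ξ : Ω → ι → ℝ) (n : ℕ) : Measure (ι → ℝ) :=
  (Measure.pi fun _ : Fin n => P).map fun u => (n : ℝ)⁻¹ • ∑ j, ξ (u j)

lemma measurable_empirical {ι : Type*} {ξ : Ω → ι → ℝ} (hξ : Measurable ξ) (n : ℕ) :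
    Measurable fun u : Fin n → Ω => (n : ℝ)⁻¹ • ∑ j, ξ (u j) := by
  have h : Measurable fun u : Fin n → Ω => ∑ j, ξ (u j) :=
    Finset.measurable_fun_sum _ fun j _ => hξ.comp (measurable_pi_apply j)
  exact h.const_smul (n : ℝ)⁻¹

/-- The moment generating function of an empirical mean. The hypothesis forces integrability, since
the right-hand side is not `0`. -/
lemma lintegral_exp_empiricalLaw {ξ : Ω → ι → ℝ} (hξ : Measurable ξ) {κ : ℝ} {η : ι → ℝ}
    (hκ : ∫ ω, Real.exp (η ⬝ᵥ ξ ω) ∂P = Real.exp κ)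
    {n : ℕ} (hn : 0 < n) :
    ∫⁻ y, ENNReal.ofReal (Real.exp (n * (η ⬝ᵥ y))) ∂empiricalLaw P ξ n
      = ENNReal.ofReal (Real.exp (n * κ)) := by
  have hn' : (n : ℝ) ≠ 0 := by positivity
  have hint : Integrable (fun ω => Real.exp (η ⬝ᵥ ξ ω)) P := by
    by_contra h
    rw [integral_undef h] at hκ
    exact (Real.exp_pos κ).ne hκ
  rw [empiricalLaw, lintegral_map (measurable_exp_mul_dotProduct _ _) (measurable_empirical hξ n)]
  have h1 : ∀ u : Fin n → Ω, Real.exp (n * (η ⬝ᵥ ((n : ℝ)⁻¹ • ∑ j, ξ (u j))))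
      = ∏ j, Real.exp (η ⬝ᵥ ξ (u j)) := fun u => by
    rw [← Real.exp_sum, dotProduct_smul, smul_eq_mul, mul_inv_cancel_left₀ hn', dotProduct_sum]
  simp only [h1]
  rw [← ofReal_integral_eq_lintegral_ofReal
      (Integrable.fintype_prod (f := fun _ ω => Real.exp (η ⬝ᵥ ξ ω)) fun _ => hint)
      (Eventually.of_forall fun u => Finset.prod_nonneg fun j _ => (Real.exp_pos _).le),
    integral_fintype_prod_eq_prod (fun _ ω => Real.exp (η ⬝ᵥ ξ ω))]
  simp [hκ, ← Real.exp_nat_mul]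

variable [DecidableEq ι]

lemma differentiableAt_logMGF (hξ : Measurable ξ) (hD : ∀ ω k, |ξ ω k| ≤ D) (η : ι → ℝ) (k : ι) :
    DifferentiableAt ℝ (fun t : ℝ => logMGF P ξ (η + t • Pi.single k 1)) 0 := by
  have hint := integrable_exp_dotProduct (P := P) hξ hD η
  have : IsProbabilityMeasure (P.tilted fun ω => η ⬝ᵥ ξ ω) := isProbabilityMeasure_tilted hint
  have hmgf : ∀ t : ℝ, ∫ ω, Real.exp ((η + t • Pi.single k 1) ⬝ᵥ ξ ω) ∂P
      = (∫ ω, Real.exp (η ⬝ᵥ ξ ω) ∂P) *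
        mgf (fun ω => ξ ω k) (P.tilted fun ω => η ⬝ᵥ ξ ω) t := fun t => by
    rw [mgf, integral_exp_tilted,
      mul_div_cancel₀ _ (integral_exp_dotProduct_pos (P := P) hξ hD η).ne']
    simp [add_dotProduct]
  have hset : integrableExpSet (fun ω => ξ ω k) (P.tilted fun ω => η ⬝ᵥ ξ ω) = Set.univ := by
    refine Set.eq_univ_of_forall fun t => ?_
    have := integrable_exp_dotProduct (P := P.tilted fun ω => η ⬝ᵥ ξ ω) hξ hD (t • Pi.single k 1)
    simpa [integrableExpSet] using this
  have hd : DifferentiableAt ℝ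
      (fun t : ℝ => ∫ ω, Real.exp ((η + t • Pi.single k 1) ⬝ᵥ ξ ω) ∂P) 0 := by
    simp only [hmgf]
    refine (differentiableAt_mgf ?_).const_mul _
    rw [hset, interior_univ]; trivial
  exact hd.log (integral_exp_dotProduct_pos (P := P) hξ hD _).ne'

lemma hasDerivAt_logMGF_zero (hξ : Measurable ξ) (hD : ∀ ω k, |ξ ω k| ≤ D) (k : ι) :
    HasDerivAt (fun t : ℝ => logMGF P ξ (0 + t • Pi.single k 1)) (∫ ω, ξ ω k ∂P) 0 := by
  have hset : integrableExpSet (fun ω => ξ ω k) P = Set.univ := by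
    refine Set.eq_univ_of_forall fun t => ?_
    have := integrable_exp_dotProduct (P := P) hξ hD (t • Pi.single k 1)
    simpa [integrableExpSet] using this
  have h1 := hasDerivAt_mgf (X := fun ω => ξ ω k) (μ := P) (t := 0) (by
    rw [hset, interior_univ]; trivial)
  have h2 := h1.log (by simp)
  simp only [mgf_zero, div_one, zero_mul, Real.exp_zero, mul_one] at h2
  have h3 : (fun t : ℝ => logMGF P ξ (0 + t • Pi.single k 1))
      = fun t => Real.log (mgf (fun ω => ξ ω k) P t) := by
    ext t; simp [logMGF, mgf]
  rw [h3]
  simpa using h2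

/-- The transform of a logarithmic moment generating function vanishes exactly at the mean. -/
lemma legendre_logMGF_eq_zero_iff (hξ : Measurable ξ) (hD : ∀ ω k, |ξ ω k| ≤ D) (y : ι → ℝ) :
    legendre (logMGF P ξ) y = 0 ↔ y = fun k => ∫ ω, ξ ω k ∂P := by
  constructor
  · intro h
    ext k
    exact (hasDerivAt_zero_of_legendre_eq_zero (logMGF_zero P ξ)
      (differentiableAt_logMGF hξ hD) h k).unique (hasDerivAt_logMGF_zero hξ hD k)
  · rintro rfl
    simp only [legendre, ENNReal.iSup_eq_zero, ENNReal.ofReal_eq_zero, sub_nonpos]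
    exact dotProduct_mean_le_logMGF hξ hD

end LogMGF

/-! ### The feature vectors of a layer -/

section Feature

variable {A : Type*} [Fintype A] [DecidableEq A]

instance {A : Type*} [Fintype A] : IsProbabilityMeasure (stdNormal A) := by
  unfold stdNormal; infer_instance

/-- The products `σ_α(q) σ_β(q)`, as a vector indexed by the pairs `(α, β)`. -/
def featurePair (σ : ℝ → ℝ) (q : Matrix A A ℝ) (u : A → ℝ) : A × A → ℝ :=
  fun p => feature σ q u p.1 * feature σ q u p.2

variable {σ : ℝ → ℝ} {M : ℝ}

lemma abs_featurePair_le (hM : ∀ t, |σ t| ≤ M) (q : Matrix A A ℝ) (u : A → ℝ) (p : A × A) :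
    |featurePair σ q u p| ≤ M * M := by
  rw [featurePair, abs_mul]
  exact mul_le_mul (hM _) (hM _) (abs_nonneg _) ((abs_nonneg _).trans (hM 0))

lemma measurable_featurePair_prod (hσ : Continuous σ) :
    Measurable fun x : Matrix A A ℝ × (A → ℝ) => featurePair σ x.1 x.2 := by
  have h1 : ∀ α, Measurable fun x : Matrix A A ℝ × (A → ℝ) => feature σ x.1 x.2 α := fun α => by
    refine hσ.measurable.comp (Finset.measurable_fun_sum _ fun γ _ => Measurable.mul ?_ ?_)
    · exact (continuous_matrix_apply α γ).measurable.comp (measurable_psdSqrt.comp measurable_fst)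
    · exact (measurable_pi_apply γ).comp measurable_snd
  exact measurable_pi_lambda _ fun p => (h1 p.1).mul (h1 p.2)

lemma measurable_featurePair (hσ : Continuous σ) (q : Matrix A A ℝ) :
    Measurable (featurePair σ q) :=
  (measurable_featurePair_prod hσ).comp (measurable_const.prodMk measurable_id)

lemma continuousOn_featurePair (hσ : Continuous σ) (u : A → ℝ) :
    ContinuousOn (fun q : Matrix A A ℝ => featurePair σ q u) {q | q.PosSemidef} := by
  have h1 : ∀ α, ContinuousOn (fun q : Matrix A A ℝ => feature σ q u α) {q | q.PosSemidef} :=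
    fun α => hσ.comp_continuousOn (continuousOn_finsetSum _ fun γ _ =>
      ((continuous_matrix_apply α γ).comp_continuousOn continuousOn_psdSqrt).mul continuousOn_const)
  exact continuousOn_pi.2 fun p => (h1 p.1).mul (h1 p.2)

/-- The logarithmic moment generating function `κ(·; q)`, with the matrix argument read as a
vector. -/
abbrev featureLogMGF (σ : ℝ → ℝ) (q : Matrix A A ℝ) : (A × A → ℝ) → ℝ :=
  logMGF (stdNormal A) (featurePair σ q)

lemma kappa_eq (σ : ℝ → ℝ) (η q : Matrix A A ℝ) :
    kappa σ η q = featureLogMGF σ q fun p => η p.1 p.2 := by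
  simp [kappa, featureLogMGF, logMGF, featurePair, dotProduct, Fintype.sum_prod_type]

lemma continuousOn_featureLogMGF (hσ : Continuous σ) (hM : ∀ t, |σ t| ≤ M) (η : A × A → ℝ) :
    ContinuousOn (fun q : Matrix A A ℝ => featureLogMGF σ q η) {q | q.PosSemidef} := by
  intro q hq
  have h := continuousWithinAt_logMGF (P := stdNormal A) (ξ := featurePair σ)
    (measurable_featurePair hσ) (abs_featurePair_le hM)
    (fun u => continuousOn_featurePair hσ u q hq) η
  exact h.comp (f := fun q => (η, q)) (x := q) (by fun_prop) fun q' hq' => ⟨trivial, hq'⟩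

/-- `κ^*` takes values in `[0, ∞]`, so the truncation in `legendre` does not affect it. -/
lemma toENNReal_kappaStar (σ : ℝ → ℝ) (y q : Matrix A A ℝ) :
    (kappaStar σ y q).toENNReal = legendre (featureLogMGF σ q) fun p => y p.1 p.2 := by
  have hdot : ∀ η : Matrix A A ℝ, ∑ α, ∑ β, η α β * y α β
      = (fun p : A × A => η p.1 p.2) ⬝ᵥ fun p => y p.1 p.2 := fun η => by
    simp [dotProduct, Fintype.sum_prod_type]
  refine le_antisymm ?_ (iSup_le fun η => ?_)
  · rw [← EReal.coe_ennreal_le_coe_ennreal_iff, EReal.coe_toENNReal (kappaStar_nonneg σ y q)]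
    refine iSup_le fun η => ?_
    calc _ ≤ ((ENNReal.ofReal ((∑ α, ∑ β, η α β * y α β) - kappa σ η q) : ℝ≥0∞) : EReal) := by
          rw [EReal.coe_ennreal_ofReal]
          exact EReal.coe_le_coe_iff.2 (le_max_left _ _)
      _ ≤ _ := by
          refine EReal.coe_ennreal_le_coe_ennreal_iff.2 ?_
          rw [kappa_eq, hdot]
          exact le_iSup (fun η : A × A → ℝ => ENNReal.ofReal
            (η ⬝ᵥ (fun p => y p.1 p.2) - featureLogMGF σ q η)) (fun p => η p.1 p.2)
  · rw [← EReal.toENNReal_coe (x := ENNReal.ofReal _)]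
    refine EReal.toENNReal_le_toENNReal ?_
    rw [EReal.coe_ennreal_ofReal]
    rcases le_total 0 (η ⬝ᵥ (fun p => y p.1 p.2) - featureLogMGF σ q η) with h | h
    · rw [max_eq_left h]
      refine le_iSup_of_le (Matrix.of fun α β => η (α, β)) ?_
      rw [kappa_eq, hdot]
      rfl
    · rw [max_eq_right h]
      exact kappaStar_nonneg σ y q

/-- The covariance matrix `Cb 𝟏 + CW y` of a layer with empirical second moments `y`. -/
def affineCov {A : Type*} (Cb CW : ℝ) (y : A × A → ℝ) : Matrix A A ℝ :=
  Matrix.of fun α β => Cb + CW * y (α, β)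

lemma continuous_affineCov {A : Type*} (Cb CW : ℝ) :
    Continuous (affineCov (A := A) Cb CW) :=
  continuous_pi fun α => continuous_pi fun β =>
    continuous_const.add (continuous_const.mul (continuous_apply (α, β)))

/-- The empirical second moments `(g - Cb 𝟏) / CW` encoded by a covariance matrix. -/
def invAffineCov {A : Type*} (Cb CW : ℝ) (g : Matrix A A ℝ) : A × A → ℝ :=
  fun p => CW⁻¹ * (g p.1 p.2 - Cb)

lemma continuous_invAffineCov {A : Type*} (Cb CW : ℝ) :
    Continuous (invAffineCov (A := A) Cb CW) :=
  continuous_pi fun p => continuous_const.mul ((continuous_matrix_apply p.1 p.2).sub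
    continuous_const)

lemma affineCov_invAffineCov {A : Type*} (Cb : ℝ) {CW : ℝ} (hCW : CW ≠ 0) (g : Matrix A A ℝ) :
    affineCov Cb CW (invAffineCov Cb CW g) = g := by
  ext α β
  simp [affineCov, invAffineCov, mul_inv_cancel_left₀ hCW]

lemma invAffineCov_affineCov {A : Type*} (Cb : ℝ) {CW : ℝ} (hCW : CW ≠ 0) (y : A × A → ℝ) :
    invAffineCov Cb CW (affineCov Cb CW y) = y := by
  ext p
  simp [affineCov, invAffineCov, inv_mul_cancel_left₀ hCW]

/-- With the convention `∞ * 0 = 0` both cases of the layer cost are `γ κ^*`: the transform vanishes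
only at the mean. -/
lemma layerCost_eq (hσ : Continuous σ) (hM : ∀ t, |σ t| ≤ M) (Cb : ℝ) {CW : ℝ} (hCW : CW ≠ 0)
    {γ : ℝ≥0∞} (g q : Matrix A A ℝ) :
    layerCost σ Cb CW γ g q = γ * legendre (featureLogMGF σ q) (invAffineCov Cb CW g) := by
  by_cases hγ : γ = ∞
  · subst hγ
    rw [layerCost, if_pos rfl, diracCost, ENNReal.top_mul']
    suffices hiff : g = (Matrix.of fun _ _ => Cb) + CW • secondMoment σ q ↔
        legendre (featureLogMGF σ q) (invAffineCov Cb CW g) = 0 by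
      by_cases h : g = (Matrix.of fun _ _ => Cb) + CW • secondMoment σ q
      · rw [if_pos h, if_pos (hiff.1 h)]
      · rw [if_neg h, if_neg (mt hiff.2 h)]
    rw [legendre_logMGF_eq_zero_iff (measurable_featurePair hσ q) (abs_featurePair_le hM q)]
    constructor
    · rintro rfl
      ext p
      simp [invAffineCov, secondMoment, featurePair, inv_mul_cancel_left₀ hCW]
    · intro h
      rw [← affineCov_invAffineCov Cb hCW g, h]
      ext α β
      simp [affineCov, secondMoment, featurePair]
  · rw [layerCost, if_neg hγ, toENNReal_kappaStar]
    rfl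

lemma posSemidef_gram {A : Type*} [Fintype A] {κ : Type*} [Fintype κ] {c : κ → ℝ}
    (hc : ∀ k, 0 ≤ c k) (w : κ → A → ℝ) :
    (Matrix.of fun α β => ∑ k, c k * (w k α * w k β)).PosSemidef := by
  rw [Matrix.posSemidef_iff_dotProduct_mulVec]
  refine ⟨?_, fun x => ?_⟩
  · ext α β
    simp [mul_comm]
  · have : star x ⬝ᵥ (Matrix.of fun α β => ∑ k, c k * (w k α * w k β)).mulVec x
        = ∑ k, c k * (∑ α, w k α * x α) ^ 2 := by
      simp only [dotProduct, Matrix.mulVec, Matrix.of_apply, star_trivial, sq, Finset.sum_mul,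
        Finset.mul_sum]
      rw [Finset.sum_congr rfl fun α _ => Finset.sum_comm, Finset.sum_comm]
      refine Finset.sum_congr rfl fun k _ => Finset.sum_congr rfl fun α _ =>
        Finset.sum_congr rfl fun β _ => by ring
    rw [this]
    exact Finset.sum_nonneg fun k _ => mul_nonneg (hc k) (sq_nonneg _)

lemma gram_mem_covSet {A : Type*} [Fintype A] {κ : Type*} [Fintype κ] {Cb : ℝ} (hCb : 0 ≤ Cb)
    {c : κ → ℝ} (hc : ∀ k, 0 ≤ c k) (w : κ → A → ℝ) :
    (Matrix.of fun α β => Cb + ∑ k, c k * (w k α * w k β)) ∈ covSet A Cb := by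
  have h1 := posSemidef_gram hc w
  have h2 := posSemidef_gram (κ := Unit) (c := fun _ => Cb) (fun _ => hCb) fun _ (_ : A) => 1
  constructor
  · convert h2.add h1 using 1
    ext α β; simp
  · convert h1 using 1
    ext α β; simp

lemma inputCov_mem_covSet {A : Type*} [Fintype A] {n₀ : ℕ} {Cb CW : ℝ} (hCb : 0 ≤ Cb) (hCW : 0 ≤ CW)
    (x : A → Fin n₀ → ℝ) : inputCov Cb CW x ∈ covSet A Cb := by
  convert gram_mem_covSet hCb (c := fun _ : Fin n₀ => CW / n₀) (fun _ => by positivity)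
    (fun r α => x α r) using 1
  ext α β
  simp [inputCov, Finset.mul_sum]

lemma affineCov_empirical_mem_covSet {Cb CW : ℝ} (hCb : 0 ≤ Cb) (hCW : 0 ≤ CW) (q : Matrix A A ℝ)
    (n : ℕ) (u : Fin n → A → ℝ) :
    affineCov Cb CW ((n : ℝ)⁻¹ • ∑ j, featurePair σ q (u j)) ∈ covSet A Cb := by
  convert gram_mem_covSet hCb (c := fun _ : Fin n => CW * (n : ℝ)⁻¹) (fun _ => by positivity)
    (fun j α => feature σ q (u j) α) using 1
  ext α β
  simp [affineCov, featurePair, Finset.mul_sum, mul_assoc]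

/-! ### The Laplace principle and goodness for one layer -/

/-- The free energy of the covariance of the next layer, given the covariance `q`. -/
def layerEnergy (σ : ℝ → ℝ) (Cb CW : ℝ) (v : ℝ) (m : ℕ) (f : Matrix A A ℝ → ℝ)
    (q : Matrix A A ℝ) : ℝ :=
  freeEnergy v (empiricalLaw (stdNormal A) (featurePair σ q) m) fun y => f (affineCov Cb CW y)

lemma isProbabilityMeasure_empiricalLaw (hσ : Continuous σ) (q : Matrix A A ℝ) (m : ℕ) :
    IsProbabilityMeasure (empiricalLaw (stdNormal A) (featurePair σ q) m) :=
  Measure.isProbabilityMeasure_map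
    (measurable_empirical (measurable_featurePair hσ q) m).aemeasurable

lemma lintegral_exp_layerEnergy (hσ : Continuous σ) {Cb CW v : ℝ} {m : ℕ} {f : Matrix A A ℝ → ℝ}
    (hf : Measurable f) (q : Matrix A A ℝ) :
    ∫⁻ y, ENNReal.ofReal (Real.exp (-(v * f (affineCov Cb CW y))))
        ∂empiricalLaw (stdNormal A) (featurePair σ q) m
      = ∫⁻ u, ENNReal.ofReal (Real.exp (-(v * f (affineCov Cb CW
        ((m : ℝ)⁻¹ • ∑ j, featurePair σ q (u j)))))) ∂Measure.pi fun _ : Fin m => stdNormal A := by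
  rw [empiricalLaw, lintegral_map ?_ (measurable_empirical (measurable_featurePair hσ q) m)]
  have := hf.comp (continuous_affineCov (A := A) Cb CW).measurable
  exact ((this.const_mul v).neg.exp).ennreal_ofReal

lemma measurable_layerEnergy (hσ : Continuous σ) {Cb CW v : ℝ} {m : ℕ} {f : Matrix A A ℝ → ℝ}
    (hf : Measurable f) : Measurable (layerEnergy σ Cb CW v m f) := by
  unfold layerEnergy freeEnergy
  simp only [lintegral_exp_layerEnergy hσ hf]
  refine ((Measurable.ennreal_toReal ?_).log.div_const v).neg
  refine Measurable.lintegral_prod_right' (f := fun x : Matrix A A ℝ × (Fin m → A → ℝ) =>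
    ENNReal.ofReal (Real.exp (-(v * f (affineCov Cb CW
        ((m : ℝ)⁻¹ • ∑ j, featurePair σ x.1 (x.2 j))))))) ?_
  have h1 : Measurable fun x : Matrix A A ℝ × (Fin m → A → ℝ) =>
      ∑ j, featurePair σ x.1 (x.2 j) :=
    Finset.measurable_fun_sum _ fun j _ => (measurable_featurePair_prod hσ).comp
      (measurable_fst.prodMk ((measurable_pi_apply j).comp measurable_snd))
  have h2 := (hf.comp (continuous_affineCov (A := A) Cb CW).measurable).comp
    (h1.const_smul (m : ℝ)⁻¹)
  exact ((h2.const_mul v).neg.exp).ennreal_ofReal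

/-- The empirical second moments of a layer satisfy the assumptions of the Gärtner–Ellis theorem,
continuously in the covariance of the previous layer. -/
lemma hasLimitLogMGF_layer (hσ : Continuous σ) (hM : ∀ t, |σ t| ≤ M) {v : ℕ → ℝ} {m : ℕ → ℕ}
    {γ : ℝ≥0∞} (hv : ∀ n, 0 < v n) (hvt : Tendsto v atTop atTop) (hm : ∀ n, 0 < m n)
    (hγ : 1 ≤ γ) (hr : Tendsto (fun n => ENNReal.ofReal (m n / v n)) atTop (𝓝 γ)) {Cb : ℝ}
    {q : Matrix A A ℝ} (hq : q ∈ covSet A Cb) :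
    HasLimitLogMGF (atTop ×ˢ 𝓝[covSet A Cb] q) (fun p : ℕ × Matrix A A ℝ => v p.1)
      (fun p => m p.1) γ (fun p => empiricalLaw (stdNormal A) (featurePair σ p.2) (m p.1))
      (fun p => featureLogMGF σ p.2) (featureLogMGF σ q) where
  prob p := isProbabilityMeasure_empiricalLaw hσ _ _
  speed_pos p := hv _
  scale_pos p := by exact_mod_cast hm _
  speed_tendsto := hvt.comp tendsto_fst
  one_le := hγ
  ratio := hr.comp tendsto_fst
  mgf p η := lintegral_exp_empiricalLaw (measurable_featurePair hσ p.2)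
    (exp_logMGF (measurable_featurePair hσ p.2) (abs_featurePair_le hM p.2) η).symm (hm _)
  tendsto η := by
    have h : Tendsto (fun q' => featureLogMGF σ q' η) (𝓝[covSet A Cb] q)
        (𝓝 (featureLogMGF σ q η)) :=
      (continuousOn_featureLogMGF hσ hM η q hq.1).mono fun _ h => h.1
    exact h.comp tendsto_snd
  cont := continuous_logMGF (measurable_featurePair hσ q) (abs_featurePair_le hM q)
  diff := differentiableAt_logMGF (measurable_featurePair hσ q) (abs_featurePair_le hM q)

/-- One layer turns continuously converging test functions into continuously converging ones. -/
lemma contConv_layerEnergy (hσ : Continuous σ) (hM : ∀ t, |σ t| ≤ M) {v : ℕ → ℝ} {m : ℕ → ℕ}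
    {γ : ℝ≥0∞} (hv : ∀ n, 0 < v n) (hvt : Tendsto v atTop atTop) (hm : ∀ n, 0 < m n)
    (hγ : 1 ≤ γ) (hr : Tendsto (fun n => ENNReal.ofReal (m n / v n)) atTop (𝓝 γ)) {Cb CW : ℝ}
    (hCb : 0 ≤ Cb) (hCW : 0 < CW) {f : ℕ → Matrix A A ℝ → ℝ} {F : Matrix A A ℝ → ℝ≥0∞} {B : ℝ}
    (hf0 : ∀ n g, 0 ≤ f n g) (hfB : ∀ n g, f n g ≤ B)
    (hfF : ContConv atTop (covSet A Cb) f F) :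
    ContConv atTop (covSet A Cb) (fun n => layerEnergy σ Cb CW (v n) (m n) (f n))
      fun q => ⨅ g ∈ covSet A Cb, (layerCost σ Cb CW γ g q + F g) := by
  intro q hq
  have : ((atTop : Filter ℕ) ×ˢ 𝓝[covSet A Cb] q).NeBot := by
    have := mem_closure_iff_nhdsWithin_neBot.1 (subset_closure hq)
    infer_instance
  have hS : IsClosed (affineCov Cb CW ⁻¹' covSet A Cb) :=
    (isClosed_covSet Cb).preimage (continuous_affineCov Cb CW)
  have h := (hasLimitLogMGF_layer hσ hM hv hvt hm hγ hr hq).tendsto_freeEnergy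
    (S := affineCov Cb CW ⁻¹' covSet A Cb) (f := fun p y => f p.1 (affineCov Cb CW y))
    (F := fun y => F (affineCov Cb CW y)) hS ?_ (fun p y => hf0 _ _) (fun p y => hfB _ _) ?_
  · have hsurj : Function.Surjective (affineCov (A := A) Cb CW) := fun g =>
      ⟨_, affineCov_invAffineCov Cb hCW.ne' g⟩
    have hval : ⨅ g ∈ covSet A Cb, (layerCost σ Cb CW γ g q + F g)
        = ⨅ y ∈ affineCov Cb CW ⁻¹' covSet A Cb,
          (γ * legendre (featureLogMGF σ q) y + F (affineCov Cb CW y)) := by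
      rw [← hsurj.iInf_comp]
      simp only [layerCost_eq hσ hM Cb hCW.ne', invAffineCov_affineCov Cb hCW.ne',
        Set.mem_preimage]
    rw [← hval] at h
    exact h
  · intro p
    rw [empiricalLaw, Measure.map_apply (measurable_empirical (measurable_featurePair hσ p.2) _)
      hS.measurableSet.compl]
    convert measure_empty
    · ext u
      simp only [Set.mem_preimage, Set.mem_compl_iff, Set.mem_empty_iff_false, iff_false, not_not]
      exact affineCov_empirical_mem_covSet hCb hCW.le p.2 _ u
    · infer_instance
  · intro y hy
    have h1 : Tendsto (affineCov Cb CW) (𝓝[affineCov Cb CW ⁻¹' covSet A Cb] y)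
        (𝓝[covSet A Cb] (affineCov Cb CW y)) :=
      (continuous_affineCov Cb CW).continuousWithinAt.tendsto_nhdsWithin fun _ h => h
    exact (hfF _ hy).comp ((tendsto_fst.comp tendsto_fst).prodMk (h1.comp tendsto_snd))

/-- The layer cost is jointly good: lower semicontinuous in both covariances, with compact sublevel
sets over compact sets of conditioning covariances. -/
lemma isCompact_layerCost_le (hσ : Continuous σ) (hM : ∀ t, |σ t| ≤ M) {Cb CW : ℝ}
    (hCW : 0 < CW) {γ : ℝ≥0∞} (hγ : 1 ≤ γ) {K : Set (Matrix A A ℝ)}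
    (hKS : K ⊆ covSet A Cb) (hK : IsCompact K) (a : ℝ≥0) :
    IsCompact {p : Matrix A A ℝ × Matrix A A ℝ |
      p.1 ∈ K ∧ ⨅ (_ : p.2 ∈ covSet A Cb), layerCost σ Cb CW γ p.2 p.1 ≤ a} := by
  have hγ0 : γ ≠ 0 := (zero_lt_one.trans_le hγ).ne'
  have hatop : (a : ℝ≥0∞) / γ ≠ ∞ := ENNReal.div_ne_top ENNReal.coe_ne_top hγ0
  set c := ((a : ℝ≥0∞) / γ).toReal with hc
  have hc0 : 0 ≤ c := ENNReal.toReal_nonneg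
  have hset : {p : Matrix A A ℝ × Matrix A A ℝ |
      p.1 ∈ K ∧ ⨅ (_ : p.2 ∈ covSet A Cb), layerCost σ Cb CW γ p.2 p.1 ≤ a}
      = {p | p.2 ∈ covSet A Cb} ∩ ⋂ η : A × A → ℝ, K ×ˢ Set.univ ∩
        (fun p : Matrix A A ℝ × Matrix A A ℝ =>
          η ⬝ᵥ invAffineCov Cb CW p.2 - featureLogMGF σ p.1 η) ⁻¹' Set.Iic c := by
    ext ⟨g, g'⟩
    simp only [Set.mem_ofPred_eq, Set.mem_inter_iff, Set.mem_iInter, Set.mem_prod, Set.mem_univ,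
      and_true, Set.mem_preimage, Set.mem_Iic, forall_and, forall_const]
    by_cases hg' : g' ∈ covSet A Cb
    · simp only [hg', iInf_pos, true_and]
      refine and_congr_right fun _ => ?_
      rw [layerCost_eq hσ hM Cb hCW.ne', mul_comm,
        ← ENNReal.le_div_iff_mul_le (Or.inl hγ0) (Or.inr ENNReal.coe_ne_top), legendre, iSup_le_iff]
      refine forall_congr' fun η => ?_
      rw [ENNReal.ofReal_le_iff_le_toReal hatop]
    · simp [hg']
  have hclosed : IsClosed {p : Matrix A A ℝ × Matrix A A ℝ |
      p.1 ∈ K ∧ ⨅ (_ : p.2 ∈ covSet A Cb), layerCost σ Cb CW γ p.2 p.1 ≤ a} := by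
    rw [hset]
    refine ((isClosed_covSet Cb).preimage continuous_snd).inter (isClosed_iInter fun η => ?_)
    refine ContinuousOn.preimage_isClosed_of_isClosed ?_ (hK.isClosed.prod isClosed_univ)
      isClosed_Iic
    refine ContinuousOn.sub ?_ ?_
    · exact ((continuous_dotProduct_right η).comp
        ((continuous_invAffineCov Cb CW).comp continuous_snd)).continuousOn
    · exact (continuousOn_featureLogMGF hσ hM η).comp continuousOn_fst fun p hp => (hKS hp.1).1
  -- testing with `η = ± e_k`, where `κ ≤ M²`, bounds every coordinate of the second moments
  set R := c + M * M with hR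
  have hR0 : 0 ≤ R := add_nonneg hc0 (mul_self_nonneg M)
  refine (hK.prod ((isCompact_closedBall (0 : A × A → ℝ) R).image
    (continuous_affineCov Cb CW))).of_isClosed_subset hclosed ?_
  rw [hset]
  rintro ⟨g, g'⟩ ⟨_, h⟩
  rw [Set.mem_iInter] at h
  refine ⟨(h 0).1.1, invAffineCov Cb CW g', ?_, affineCov_invAffineCov Cb hCW.ne' g'⟩
  rw [mem_closedBall_zero_iff, pi_norm_le_iff_of_nonneg hR0]
  intro k
  have hle : ∀ s : ℝ, |s| = 1 → s * invAffineCov Cb CW g' k ≤ R := fun s hs => by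
    have h1 : (Pi.single k s : A × A → ℝ) ⬝ᵥ invAffineCov Cb CW g'
        - featureLogMGF σ g (Pi.single k s) ≤ c := (h (Pi.single k s)).2
    have h2 := logMGF_le (P := stdNormal A) (measurable_featurePair hσ g)
      (abs_featurePair_le hM g) (Pi.single k s)
    have h3 : ∑ j, |(Pi.single k s : A × A → ℝ) j| = 1 := by
      rw [Finset.sum_eq_single k (fun j _ hj => by simp [hj]) (by simp)]
      simpa using hs
    rw [h3, one_mul] at h2
    rw [single_dotProduct] at h1
    simp only [featureLogMGF] at h1
    linarith
  rw [Real.norm_eq_abs, abs_le]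
  constructor
  · have := hle (-1) (by simp); linarith
  · have := hle 1 (by simp); linarith

end Feature

/-! ### The Gaussian output layer -/

section Output

variable {A : Type*} [Fintype A] {m : ℕ}

lemma continuous_dotProduct_self {ι : Type*} [Fintype ι] :
    Continuous fun r : ι → ℝ => r ⬝ᵥ r := by
  unfold dotProduct; fun_prop

/-- The standard Gaussian cost is its own Fenchel–Legendre transform. -/
lemma legendre_half_dotProduct_self {ι : Type*} [Fintype ι] (r : ι → ℝ) :
    legendre (fun η : ι → ℝ => η ⬝ᵥ η / 2) r = ENNReal.ofReal (r ⬝ᵥ r / 2) := by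
  refine le_antisymm (iSup_le fun η => ENNReal.ofReal_le_ofReal ?_) ?_
  · have h : 0 ≤ (η - r) ⬝ᵥ (η - r) := Finset.sum_nonneg fun _ _ => mul_self_nonneg _
    rw [sub_dotProduct, dotProduct_sub, dotProduct_sub, dotProduct_comm r η] at h
    linarith
  · refine le_trans (ENNReal.ofReal_le_ofReal ?_)
      (le_iSup (fun η : ι → ℝ => ENNReal.ofReal (η ⬝ᵥ r - η ⬝ᵥ η / 2)) r)
    linarith

/-- The law of a standard Gaussian array divided by `√v`. -/
def scaledNormal (A : Type*) [Fintype A] (m : ℕ) (v : ℝ) : Measure (A × Fin m → ℝ) :=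
  (Measure.pi fun _ : Fin m => stdNormal A).map fun u p => u p.2 p.1 / √v

lemma measurable_scaling {A : Type*} (v : ℝ) :
    Measurable fun (u : Fin m → A → ℝ) (p : A × Fin m) => u p.2 p.1 / √v :=
  measurable_pi_lambda _ fun p =>
    ((measurable_pi_apply p.1).comp (measurable_pi_apply p.2)).div_const _

instance (v : ℝ) : IsProbabilityMeasure (scaledNormal A m v) :=
  Measure.isProbabilityMeasure_map (measurable_scaling v).aemeasurable

lemma lintegral_exp_scaledNormal {v : ℝ} (hv : 0 < v) (η : A × Fin m → ℝ) :
    ∫⁻ r, ENNReal.ofReal (Real.exp (v * (η ⬝ᵥ r))) ∂scaledNormal A m v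
      = ENNReal.ofReal (Real.exp (v * (η ⬝ᵥ η / 2))) := by
  rw [scaledNormal, lintegral_map (measurable_exp_mul_dotProduct _ _) (measurable_scaling v)]
  have hs : v / √v = √v := Real.div_sqrt
  have h1 : ∀ u : Fin m → A → ℝ, Real.exp (v * (η ⬝ᵥ fun p => u p.2 p.1 / √v))
      = ∏ h, ∏ α, Real.exp (√v * η (α, h) * u h α) := fun u => by
    simp only [← Real.exp_sum]
    rw [dotProduct, Fintype.sum_prod_type_right, Finset.mul_sum]
    congr 1
    refine Finset.sum_congr rfl fun h _ => ?_
    rw [Finset.mul_sum]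
    refine Finset.sum_congr rfl fun α _ => ?_
    calc v * (η (α, h) * (u h α / √v)) = v / √v * η (α, h) * u h α := by ring
      _ = _ := by rw [hs]
  have hg : ∀ c : ℝ, Integrable (fun x : ℝ => Real.exp (c * x)) (gaussianReal 0 1) := fun c =>
    integrable_exp_mul_gaussianReal c
  have hgi : ∀ c : ℝ, ∫ x : ℝ, Real.exp (c * x) ∂gaussianReal 0 1 = Real.exp (c ^ 2 / 2) :=
    fun c => by
      have := congrFun (mgf_id_gaussianReal (μ := 0) (v := 1)) c
      simpa [mgf] using this
  have hint : ∀ h : Fin m, Integrable (fun w : A → ℝ => ∏ α, Real.exp (√v * η (α, h) * w α))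
      (stdNormal A) := fun h =>
    Integrable.fintype_prod (f := fun α (x : ℝ) => Real.exp (√v * η (α, h) * x)) fun α => hg _
  simp only [h1]
  rw [← ofReal_integral_eq_lintegral_ofReal
      (Integrable.fintype_prod
        (f := fun h (w : A → ℝ) => ∏ α, Real.exp (√v * η (α, h) * w α)) hint)
      (Eventually.of_forall fun u => Finset.prod_nonneg fun h _ => Finset.prod_nonneg fun α _ =>
        (Real.exp_pos _).le),
    integral_fintype_prod_eq_prod (fun h (w : A → ℝ) => ∏ α, Real.exp (√v * η (α, h) * w α))]
  congr 1
  have h2 : ∀ h : Fin m, ∫ w : A → ℝ, ∏ α, Real.exp (√v * η (α, h) * w α) ∂stdNormal A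
      = Real.exp (∑ α, v * (η (α, h) * η (α, h) / 2)) := fun h => by
    rw [stdNormal, integral_fintype_prod_eq_prod (fun α (x : ℝ) => Real.exp (√v * η (α, h) * x)),
      Real.exp_sum]
    refine Finset.prod_congr rfl fun α _ => ?_
    rw [hgi, mul_pow, Real.sq_sqrt hv.le]
    congr 1; ring
  simp only [h2]
  rw [← Real.exp_sum]
  rw [dotProduct, Fintype.sum_prod_type_right, Finset.sum_div, Finset.mul_sum]
  simp only [Finset.sum_div, Finset.mul_sum]

variable [DecidableEq A]

/-- The matrix product `q^# r`. -/
def outMap (q : Matrix A A ℝ) (r : A × Fin m → ℝ) : A → Fin m → ℝ :=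
  fun α h => ∑ γ, psdSqrt q α γ * r (γ, h)

lemma continuousOn_outMap :
    ContinuousOn (fun x : Matrix A A ℝ × (A × Fin m → ℝ) => outMap x.1 x.2)
      ({q | q.PosSemidef} ×ˢ Set.univ) := by
  refine continuousOn_pi.2 fun α => continuousOn_pi.2 fun h =>
    continuousOn_finsetSum _ fun γ _ => ?_
  refine ContinuousOn.mul ?_ (by fun_prop)
  exact ((continuous_matrix_apply α γ).comp_continuousOn continuousOn_psdSqrt).comp
    continuousOn_fst fun x hx => hx.1

lemma measurable_outMap :
    Measurable fun x : Matrix A A ℝ × (A × Fin m → ℝ) => outMap x.1 x.2 := by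
  refine measurable_pi_lambda _ fun α => measurable_pi_lambda _ fun h =>
    Finset.measurable_fun_sum _ fun γ _ => Measurable.mul ?_ ?_
  · exact (continuous_matrix_apply α γ).measurable.comp (measurable_psdSqrt.comp measurable_fst)
  · exact (measurable_pi_apply (γ, h)).comp measurable_snd

/-- The free energy of the output, given the covariance `q` of the last hidden layer. -/
def outputEnergy (v : ℝ) (F : (A → Fin m → ℝ) → ℝ) (q : Matrix A A ℝ) : ℝ :=
  freeEnergy v (scaledNormal A m v) fun r => F (outMap q r)

/-- The cost of the output `z`, given the covariance `q` of the last hidden layer. -/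
def outputCost (q : Matrix A A ℝ) (z : A → Fin m → ℝ) : ℝ≥0∞ :=
  ⨅ (r : A × Fin m → ℝ) (_ : outMap q r = z), ENNReal.ofReal (r ⬝ᵥ r / 2)

lemma measurable_outputEnergy {v : ℝ} {F : (A → Fin m → ℝ) → ℝ} (hF : Continuous F) :
    Measurable (outputEnergy (A := A) v F) := by
  unfold outputEnergy freeEnergy
  refine ((Measurable.ennreal_toReal ?_).log.div_const v).neg
  refine Measurable.lintegral_prod_right' (f := fun x : Matrix A A ℝ × (A × Fin m → ℝ) =>
    ENNReal.ofReal (Real.exp (-(v * F (outMap x.1 x.2))))) ?_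
  exact (((hF.measurable.comp measurable_outMap).const_mul v).neg.exp).ennreal_ofReal

lemma hasLimitLogMGF_output {I : Type*} {l : Filter I} {v : I → ℝ} (hv : ∀ i, 0 < v i)
    (hvt : Tendsto v l atTop) :
    HasLimitLogMGF l v v 1 (fun i => scaledNormal A m (v i)) (fun _ η => η ⬝ᵥ η / 2)
      (fun η => η ⬝ᵥ η / 2) where
  prob i := inferInstance
  speed_pos := hv
  scale_pos := hv
  speed_tendsto := hvt
  one_le := le_rfl
  ratio := by simpa [div_self (hv _).ne'] using tendsto_const_nhds
  mgf i η := lintegral_exp_scaledNormal (hv i) η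
  tendsto η := tendsto_const_nhds
  cont := continuous_dotProduct_self.div_const _
  diff η k := by
    have : (fun t : ℝ => (η + t • Pi.single k 1) ⬝ᵥ (η + t • Pi.single k 1) / 2)
        = fun t => (η ⬝ᵥ η + 2 * t * η k + t ^ 2) / 2 := by
      ext t
      simp only [add_dotProduct, dotProduct_add, smul_dotProduct, dotProduct_smul,
        single_one_dotProduct, dotProduct_single_one, smul_eq_mul, Pi.add_apply, Pi.smul_apply,
        Pi.single_eq_same]
      ring
    rw [this]
    fun_prop

/-- The output layer turns a bounded continuous test function into continuously converging ones. -/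
lemma contConv_outputEnergy {v : ℕ → ℝ} (hv : ∀ n, 0 < v n) (hvt : Tendsto v atTop atTop) {Cb : ℝ}
    {F : (A → Fin m → ℝ) → ℝ} {B : ℝ} (hF : Continuous F) (hF0 : ∀ z, 0 ≤ F z)
    (hFB : ∀ z, F z ≤ B) :
    ContConv atTop (covSet A Cb) (fun n => outputEnergy (v n) F)
      fun q => ⨅ z, (outputCost q z + ENNReal.ofReal (F z)) := by
  intro q hq
  have : ((atTop : Filter ℕ) ×ˢ 𝓝[covSet A Cb] q).NeBot := by
    have := mem_closure_iff_nhdsWithin_neBot.1 (subset_closure hq)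
    infer_instance
  have h := (hasLimitLogMGF_output (A := A) (m := m) (l := atTop ×ˢ 𝓝[covSet A Cb] q)
    (v := fun p => v p.1) (fun p => hv _) (hvt.comp tendsto_fst)).tendsto_freeEnergy
    (S := Set.univ) (f := fun p r => F (outMap p.2 r))
    (F := fun r => ENNReal.ofReal (F (outMap q r))) isClosed_univ (by simp) (fun p y => hF0 _)
    (fun p y => hFB _) ?_
  · have hval : ⨅ z, (outputCost q z + ENNReal.ofReal (F z))
        = ⨅ r ∈ (Set.univ : Set (A × Fin m → ℝ)), (1 * legendre (fun η => η ⬝ᵥ η / 2) r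
          + ENNReal.ofReal (F (outMap q r))) := by
      simp only [outputCost, ENNReal.iInf_add, Set.mem_univ, iInf_pos, one_mul,
        legendre_half_dotProduct_self]
      rw [iInf_comm]
      refine iInf_congr fun r => ?_
      refine le_antisymm (iInf₂_le (outMap q r) rfl) (le_iInf₂ ?_)
      rintro z rfl
      exact le_rfl
    rw [← hval] at h
    exact h
  · intro r _
    have h1 : Tendsto (fun x : Matrix A A ℝ × (A × Fin m → ℝ) => outMap x.1 x.2)
        (𝓝[covSet A Cb] q ×ˢ 𝓝 r) (𝓝 (outMap q r)) := by
      have h2 := continuousOn_outMap (A := A) (m := m) (q, r) ⟨hq.1, trivial⟩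
      refine h2.mono_left ?_
      rw [nhdsWithin_prod_eq, nhdsWithin_univ]
      exact Filter.prod_mono (nhdsWithin_mono _ fun _ h => h.1) le_rfl
    rw [nhdsWithin_univ]
    exact ENNReal.tendsto_ofReal (((hF.tendsto _).comp h1).comp
      ((tendsto_snd.comp tendsto_fst).prodMk tendsto_snd))

/-- The output cost is jointly good. -/
lemma isCompact_outputCost_le {Cb : ℝ} {K : Set (Matrix A A ℝ)}
    (hKS : K ⊆ covSet A Cb) (hK : IsCompact K) (a : ℝ≥0) :
    IsCompact {p : Matrix A A ℝ × (A → Fin m → ℝ) | p.1 ∈ K ∧ outputCost p.1 p.2 ≤ a} := by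
  classical
  let Φ : Matrix A A ℝ × (A × Fin m → ℝ) → ℝ≥0∞ := fun x =>
    if x.1 ∈ K then ENNReal.ofReal (x.2 ⬝ᵥ x.2 / 2) else ∞
  have hΦ : ∀ a : ℝ≥0, IsCompact {x | Φ x ≤ a} := fun a => by
    have h1 : {x | Φ x ≤ a} = K ×ˢ {r : A × Fin m → ℝ | r ⬝ᵥ r / 2 ≤ a} := by
      ext x
      by_cases hx : x.1 ∈ K
      · simp [Φ, hx, ENNReal.ofReal_le_iff_le_toReal]
      · simp [Φ, hx]
    rw [h1]
    refine hK.prod ((isCompact_closedBall (0 : A × Fin m → ℝ) √(2 * a)).of_isClosed_subset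
      (isClosed_le (continuous_dotProduct_self.div_const _) continuous_const) fun r hr => ?_)
    rw [mem_closedBall_zero_iff]
    refine Real.le_sqrt_of_sq_le ((sq_norm_le_dotProduct_self r).trans ?_)
    have : r ⬝ᵥ r / 2 ≤ a := hr
    linarith
  have hcont : ContinuousOn (fun x : Matrix A A ℝ × (A × Fin m → ℝ) => (x.1, outMap x.1 x.2))
      {x | Φ x ≠ ∞} := by
    refine continuousOn_fst.prodMk (continuousOn_outMap.mono fun x hx => ⟨?_, trivial⟩)
    by_cases h : x.1 ∈ K
    · exact (hKS h).1
    · exact absurd (if_neg h : Φ x = ∞) hx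
  convert isCompact_level_iInf_fiber hΦ hcont a using 1
  ext ⟨q, z⟩
  by_cases hq : q ∈ K
  · have : ⨅ (x : Matrix A A ℝ × (A × Fin m → ℝ)) (_ : (x.1, outMap x.1 x.2) = (q, z)), Φ x
        = outputCost q z := by
      refine le_antisymm (le_iInf₂ fun r hr => ?_) (le_iInf₂ ?_)
      · refine (iInf₂_le (f := fun (x : Matrix A A ℝ × (A × Fin m → ℝ))
          (_ : (x.1, outMap x.1 x.2) = (q, z)) => Φ x) (q, r) (by rw [hr])).trans ?_
        simp [Φ, hq]
      · rintro ⟨q', r⟩ h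
        have h1 : q' = q := congrArg Prod.fst h
        have h2 : outMap q' r = z := congrArg Prod.snd h
        subst h1
        simp only [Φ, if_pos hq]
        exact iInf₂_le (f := fun (r : A × Fin m → ℝ) (_ : outMap q' r = z) =>
          ENNReal.ofReal (r ⬝ᵥ r / 2)) r h2
    simp only [Set.mem_ofPred_eq, hq, true_and, this]
  · have : ⨅ (x : Matrix A A ℝ × (A × Fin m → ℝ)) (_ : (x.1, outMap x.1 x.2) = (q, z)), Φ x
        = ∞ := by
      simp only [iInf_eq_top]
      rintro ⟨q', r⟩ h
      obtain ⟨rfl, h⟩ := Prod.mk.inj h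
      exact if_neg hq
    simp only [Set.mem_ofPred_eq, hq, false_and, this]
    simp

end Output

/-! ### Gaussian linear combinations -/

section Gaussian

/-- The characteristic function of a product of centred Gaussian measures. -/
lemma integral_cexp_pi_gaussianReal {κ : Type*} [Fintype κ] (s : κ → ℝ≥0) (c : κ → ℝ) :
    ∫ x : κ → ℝ, Complex.exp ((∑ k, c k * x k : ℝ) * Complex.I)
        ∂Measure.pi (fun k => gaussianReal 0 (s k))
      = Complex.exp (-((∑ k, s k * c k ^ 2 : ℝ) / 2)) := by
  have h1 : ∀ x : κ → ℝ, Complex.exp ((∑ k, c k * x k : ℝ) * Complex.I)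
      = ∏ k, Complex.exp (c k * x k * Complex.I) := fun x => by
    rw [← Complex.exp_sum]; push_cast; rw [Finset.sum_mul]
  simp only [h1]
  rw [integral_fintype_prod_eq_prod (fun k (x : ℝ) => Complex.exp (c k * x * Complex.I))]
  have h2 : ∀ k, ∫ x : ℝ, Complex.exp (c k * x * Complex.I) ∂gaussianReal 0 (s k)
      = Complex.exp (-(s k * c k ^ 2 / 2)) := fun k => by
    have := charFun_gaussianReal (μ := 0) (v := s k) (c k)
    rw [charFun_apply_real] at this
    rw [this]; congr 1; push_cast; ring
  simp only [h2]
  rw [← Complex.exp_sum]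
  push_cast
  rw [Finset.sum_neg_distrib, Finset.sum_div]

/-- Two laws of arrays with the same characteristic function coincide. -/
lemma ext_of_integral_cexp {n A : Type*} [Fintype n] [Fintype A] [DecidableEq n] [DecidableEq A]
    {μ ν : Measure (n → A → ℝ)} [IsProbabilityMeasure μ] [IsProbabilityMeasure ν]
    (h : ∀ c : n → A → ℝ, ∫ z, Complex.exp ((∑ i, ∑ α, c i α * z i α : ℝ) * Complex.I) ∂μ
      = ∫ z, Complex.exp ((∑ i, ∑ α, c i α * z i α : ℝ) * Complex.I) ∂ν) : μ = ν := by
  refine Measure.ext_of_charFunDual ?_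
  ext l
  obtain ⟨c, hl⟩ : ∃ c : n → A → ℝ, ∀ z : n → A → ℝ, l z = ∑ i, ∑ α, c i α * z i α := by
    refine ⟨fun i α => l (Pi.single i (Pi.single α 1)), fun z => ?_⟩
    have hz : z = ∑ i, ∑ α, z i α • (Pi.single i (Pi.single α 1) : n → A → ℝ) := by
      ext i α
      simp only [Finset.sum_apply, Pi.smul_apply, smul_eq_mul]
      rw [Finset.sum_eq_single i (fun j _ hj => by simp [hj.symm]) (by simp),
        Finset.sum_eq_single α (fun j _ hj => by simp [hj.symm]) (by simp)]
      simp
    conv_lhs => rw [hz]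
    simp only [map_sum, map_smul, smul_eq_mul]
    exact Finset.sum_congr rfl fun i _ => Finset.sum_congr rfl fun α _ => mul_comm _ _
  rw [charFunDual_apply, charFunDual_apply]
  simp only [hl]
  exact h _

variable {A : Type*} [Fintype A] [DecidableEq A] {Ω : Type*} [MeasurableSpace Ω] {P : Measure Ω}

lemma integral_cexp_pi_stdNormal {A : Type*} [Fintype A] {n : ℕ} (c : Fin n → A → ℝ) :
    ∫ u : Fin n → A → ℝ, Complex.exp ((∑ i, ∑ α, c i α * u i α : ℝ) * Complex.I)
        ∂Measure.pi (fun _ => stdNormal A)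
      = Complex.exp (-((∑ i, ∑ α, c i α ^ 2 : ℝ) / 2)) := by
  have h1 : ∀ u : Fin n → A → ℝ, Complex.exp ((∑ i, ∑ α, c i α * u i α : ℝ) * Complex.I)
      = ∏ i, Complex.exp ((∑ α, c i α * u i α : ℝ) * Complex.I) := fun u => by
    rw [← Complex.exp_sum, Complex.ofReal_sum, Finset.sum_mul]
  simp only [h1]
  rw [integral_fintype_prod_eq_prod
    (fun i (w : A → ℝ) => Complex.exp ((∑ α, c i α * w α : ℝ) * Complex.I))]
  have h2 : ∀ i, ∫ w : A → ℝ, Complex.exp ((∑ α, c i α * w α : ℝ) * Complex.I) ∂stdNormal A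
      = Complex.exp (-((∑ α, c i α ^ 2 : ℝ) / 2)) := fun i => by
    have := integral_cexp_pi_gaussianReal (fun _ : A => 1) (c i)
    simpa [stdNormal] using this
  simp only [h2]
  rw [← Complex.exp_sum, Finset.sum_neg_distrib, ← Finset.sum_div, Complex.ofReal_sum]

/-- The rows of one layer, given the activations `s` of the previous one, are independent
centred Gaussian vectors; they are represented through the square root of their covariance. -/
lemma map_affine_rows [IsProbabilityMeasure P] {n n' : ℕ} {b : Fin n → Ω → ℝ}
    {W : Fin n → Fin n' → Ω → ℝ} {Cb C : ℝ≥0}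
    (hb : ∀ i, HasLaw (b i) (gaussianReal 0 Cb) P)
    (hW : ∀ i j, HasLaw (W i j) (gaussianReal 0 C) P)
    (hind : iIndepFun (Sum.elim b (fun p => W p.1 p.2) : Fin n ⊕ (Fin n × Fin n') → Ω → ℝ) P)
    (s : Fin n' → A → ℝ) :
    P.map (fun ω i α => b i ω + ∑ j, W i j ω * s j α)
      = (Measure.pi fun _ : Fin n => stdNormal A).map fun u i α =>
        ∑ γ, psdSqrt (Matrix.of fun α β => (Cb : ℝ) + ∑ j, (C : ℝ) * (s j α * s j β)) α γ
          * u i γ := by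
  set G : Matrix A A ℝ := Matrix.of fun α β => (Cb : ℝ) + ∑ j, (C : ℝ) * (s j α * s j β) with hG
  have hGpsd : G.PosSemidef :=
    (gram_mem_covSet Cb.2 (c := fun _ : Fin n' => (C : ℝ)) (fun _ => C.2) s).1
  let X : Fin n ⊕ (Fin n × Fin n') → Ω → ℝ := Sum.elim b (fun p => W p.1 p.2)
  let var : Fin n ⊕ (Fin n × Fin n') → ℝ≥0 := Sum.elim (fun _ => Cb) (fun _ => C)
  have hX : ∀ k, HasLaw (X k) (gaussianReal 0 (var k)) P := by
    rintro (i | p)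
    · exact hb i
    · exact hW p.1 p.2
  have hXm : AEMeasurable (fun ω k => X k ω) P :=
    aemeasurable_pi_lambda _ fun k => (hX k).aemeasurable
  have hlaw : P.map (fun ω k => X k ω) = Measure.pi fun k => gaussianReal 0 (var k) := by
    rw [(iIndepFun_iff_map_fun_eq_pi_map fun k => (hX k).aemeasurable).1 hind]
    congr 1; ext1 k; exact (hX k).map_eq
  have hrow : AEMeasurable (fun ω i α => b i ω + ∑ j, W i j ω * s j α) P :=
    aemeasurable_pi_lambda _ fun i => aemeasurable_pi_lambda _ fun α =>
      (hb i).aemeasurable.add (Finset.aemeasurable_fun_sum _ fun j _ =>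
        (hW i j).aemeasurable.mul_const _)
  have hrow' : Measurable fun (u : Fin n → A → ℝ) i α => ∑ γ, psdSqrt G α γ * u i γ := by fun_prop
  have := Measure.isProbabilityMeasure_map (μ := P) hrow
  have := Measure.isProbabilityMeasure_map (μ := Measure.pi fun _ : Fin n => stdNormal A)
    hrow'.aemeasurable
  refine ext_of_integral_cexp fun c => ?_
  have hc : Continuous (fun z : Fin n → A → ℝ =>
      Complex.exp ((∑ i, ∑ α, c i α * z i α : ℝ) * Complex.I)) :=
    Complex.continuous_exp.comp ((Complex.continuous_ofReal.comp (by fun_prop)).mul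
      continuous_const)
  rw [integral_map hrow hc.aestronglyMeasurable,
    integral_map hrow'.aemeasurable hc.aestronglyMeasurable]
  let d : Fin n ⊕ (Fin n × Fin n') → ℝ :=
    Sum.elim (fun i => ∑ α, c i α) (fun p => ∑ α, c p.1 α * s p.2 α)
  have e1 : ∀ ω, ∑ i, ∑ α, c i α * (b i ω + ∑ j, W i j ω * s j α) = ∑ k, d k * X k ω := fun ω => by
    simp only [d, X, Fintype.sum_sum_type, Sum.elim_inl, Sum.elim_inr, Fintype.sum_prod_type,
      mul_add, Finset.sum_add_distrib, Finset.sum_mul, Finset.mul_sum]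
    congr 1
    refine Finset.sum_congr rfl fun i _ => ?_
    rw [Finset.sum_comm]
    exact Finset.sum_congr rfl fun j _ => Finset.sum_congr rfl fun α _ => by ring
  have e2 : ∀ u : Fin n → A → ℝ, ∑ i, ∑ α, c i α * ∑ γ, psdSqrt G α γ * u i γ
      = ∑ i, ∑ γ, (∑ α, c i α * psdSqrt G α γ) * u i γ := fun u => by
    simp only [Finset.mul_sum, Finset.sum_mul]
    refine Finset.sum_congr rfl fun i _ => ?_
    rw [Finset.sum_comm]
    exact Finset.sum_congr rfl fun j _ => Finset.sum_congr rfl fun α _ => by ring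
  simp only [e1, e2]
  have hc2 : Continuous (fun x : Fin n ⊕ (Fin n × Fin n') → ℝ =>
      Complex.exp ((∑ k, d k * x k : ℝ) * Complex.I)) :=
    Complex.continuous_exp.comp ((Complex.continuous_ofReal.comp (by fun_prop)).mul
      continuous_const)
  have e3 := integral_map hXm hc2.aestronglyMeasurable
  rw [← e3, hlaw, integral_cexp_pi_gaussianReal, integral_cexp_pi_stdNormal]
  congr 4
  -- both variances equal `∑ i, ⟨c i, G (c i)⟩`
  have v1 : ∀ i, ∑ γ, (∑ α, c i α * psdSqrt G α γ) ^ 2 = ∑ α, ∑ β, c i α * c i β * G α β := by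
    intro i
    simp only [sq, Finset.sum_mul_sum]
    rw [Finset.sum_comm]
    refine Finset.sum_congr rfl fun α _ => ?_
    rw [Finset.sum_comm]
    refine Finset.sum_congr rfl fun β _ => ?_
    rw [← sum_psdSqrt_mul hGpsd α β, Finset.mul_sum]
    exact Finset.sum_congr rfl fun γ _ => by ring
  have v2 : ∀ i, ∑ α, ∑ β, c i α * c i β * G α β
      = Cb * (∑ α, c i α) ^ 2 + ∑ j, C * (∑ α, c i α * s j α) ^ 2 := by
    intro i
    have hsq : ∀ w : A → ℝ, (∑ α, c i α * w α) ^ 2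
        = ∑ α, ∑ β, c i α * c i β * (w α * w β) := fun w => by
      rw [sq, Finset.sum_mul_sum]
      exact Finset.sum_congr rfl fun α _ => Finset.sum_congr rfl fun β _ => by ring
    have hsq1 := hsq fun _ => 1
    simp only [mul_one] at hsq1
    simp only [hG, Matrix.of_apply, mul_add, Finset.sum_add_distrib, hsq, hsq1, Finset.mul_sum]
    congr 1
    · exact Finset.sum_congr rfl fun α _ => Finset.sum_congr rfl fun β _ => by ring
    · rw [Finset.sum_congr rfl fun α _ => Finset.sum_comm, Finset.sum_comm]
      exact Finset.sum_congr rfl fun j _ => Finset.sum_congr rfl fun α _ =>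
        Finset.sum_congr rfl fun β _ => by ring
  simp only [v1, v2]
  simp [d, var, Fintype.sum_prod_type, Finset.sum_add_distrib]

end Gaussian

/-! ### The Markov structure of the network -/

section Network

/-- Conditioning on an independent variable. -/
lemma lintegral_indepFun {Ω E E' : Type*} [MeasurableSpace Ω] [MeasurableSpace E]
    [MeasurableSpace E'] {P : Measure Ω} [IsProbabilityMeasure P] {X : Ω → E} {Y : Ω → E'}
    (hX : AEMeasurable X P) (hY : AEMeasurable Y P) (h : IndepFun X Y P) {Ψ : E × E' → ℝ≥0∞}
    (hΨ : Measurable Ψ) :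
    ∫⁻ ω, Ψ (X ω, Y ω) ∂P = ∫⁻ ω, ∫⁻ ω', Ψ (X ω, Y ω') ∂P ∂P := by
  have := Measure.isProbabilityMeasure_map hY
  have h1 : ∀ x, ∫⁻ ω', Ψ (x, Y ω') ∂P = ∫⁻ y, Ψ (x, y) ∂P.map Y := fun x =>
    (lintegral_map' (hΨ.comp measurable_prodMk_left).aemeasurable hY).symm
  simp only [h1]
  rw [← lintegral_map' (f := fun x => ∫⁻ y, Ψ (x, y) ∂P.map Y)
      hΨ.lintegral_prod_right'.aemeasurable hX, ← lintegral_prod _ hΨ.aemeasurable,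
    ← (indepFun_iff_map_prod_eq_prod_map_map hX hY).1 h,
    lintegral_map' hΨ.aemeasurable (hX.prodMk hY)]

lemma preActivation_congr {N : ℕ → ℕ} {σ : ℝ → ℝ} {b b' : (ℓ : ℕ) → Fin (N (ℓ + 1)) → ℝ}
    {W W' : (ℓ : ℕ) → Fin (N (ℓ + 1)) → Fin (N ℓ) → ℝ} (x : Fin (N 0) → ℝ) (k : ℕ)
    (hb : ∀ ℓ ≤ k, b ℓ = b' ℓ) (hW : ∀ ℓ ≤ k, W ℓ = W' ℓ) :
    preActivation N σ b W x k = preActivation N σ b' W' x k := by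
  induction k with
  | zero => simp only [preActivation, hb 0 le_rfl, hW 0 le_rfl]
  | succ k ih =>
    simp only [preActivation, hb (k + 1) le_rfl, hW (k + 1) le_rfl,
      ih (fun ℓ hℓ => hb ℓ (hℓ.trans k.le_succ)) (fun ℓ hℓ => hW ℓ (hℓ.trans k.le_succ))]

variable {A : Type*} [Fintype A] [DecidableEq A] {Ω : Type*} [MeasurableSpace Ω] {P : Measure Ω}
  {L : ℕ} {N : ℕ → ℕ} {Cb CW : ℝ≥0} {b : (ℓ : ℕ) → Fin (N (ℓ + 1)) → Ω → ℝ}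
  {W : (ℓ : ℕ) → Fin (N (ℓ + 1)) → Fin (N ℓ) → Ω → ℝ} {σ : ℝ → ℝ} {x : A → Fin (N 0) → ℝ}

/-- The array of pre-activations of one layer at all the inputs, as a random variable. -/
def netArray (σ : ℝ → ℝ) (b : (ℓ : ℕ) → Fin (N (ℓ + 1)) → Ω → ℝ)
    (W : (ℓ : ℕ) → Fin (N (ℓ + 1)) → Fin (N ℓ) → Ω → ℝ) (x : A → Fin (N 0) → ℝ) (k : ℕ) (ω : Ω) :
    Fin (N (k + 1)) → A → ℝ :=
  fun i α => preActivation N σ (fun ℓ i => b ℓ i ω) (fun ℓ i j => W ℓ i j ω) (x α) k i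

/-- The covariance `G^{(k+1)}` of the layer following the pre-activations `netArray … k`. -/
def netCov (σ : ℝ → ℝ) (Cb CW : ℝ) (b : (ℓ : ℕ) → Fin (N (ℓ + 1)) → Ω → ℝ)
    (W : (ℓ : ℕ) → Fin (N (ℓ + 1)) → Fin (N ℓ) → Ω → ℝ) (x : A → Fin (N 0) → ℝ) (k : ℕ) (ω : Ω) :
    Matrix A A ℝ :=
  affineCov Cb CW (((N (k + 1) : ℕ) : ℝ)⁻¹ • ∑ j, fun p : A × A =>
    σ (netArray σ b W x k ω j p.1) * σ (netArray σ b W x k ω j p.2))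

/-- Gaussian rows with covariance `q`, as a function of standard normal variables. -/
def rows {n : ℕ} (q : Matrix A A ℝ) (u : Fin n → A → ℝ) : Fin n → A → ℝ :=
  fun i α => ∑ γ, psdSqrt q α γ * u i γ

/-- The pre-activations of a layer fed with the deterministic activations `s`. -/
lemma IsGaussianInit.map_rows [IsProbabilityMeasure P] (h : IsGaussianInit P L N Cb CW b W)
    {k : ℕ} (hk : k ≤ L) (s : Fin (N k) → A → ℝ) :
    P.map (fun ω i α => b k i ω + ∑ j, W k i j ω * s j α)
      = (Measure.pi fun _ : Fin (N (k + 1)) => stdNormal A).map (rows (affineCov Cb CW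
        (((N k : ℕ) : ℝ)⁻¹ • ∑ j, fun p : A × A => s j p.1 * s j p.2))) := by
  let e : Fin (N (k + 1)) ⊕ (Fin (N (k + 1)) × Fin (N k)) → ParamIndex L N :=
    Sum.map (fun i => ⟨⟨k, Nat.lt_succ_of_le hk⟩, i⟩) (fun p => ⟨⟨k, Nat.lt_succ_of_le hk⟩, p⟩)
  have he : Function.Injective e := by
    refine Sum.map_injective.2 ⟨fun i j hij => ?_, fun i j hij => ?_⟩
    · simpa using hij
    · simpa using hij
  have hind := h.indep.precomp he
  have hrw : (fun i => (Sum.elim (fun p => b p.1 p.2) (fun p => W p.1 p.2.1 p.2.2) :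
      ParamIndex L N → Ω → ℝ) (e i)) = Sum.elim (b k) (fun p => W k p.1 p.2) := by
    ext1 i; rcases i with i | p <;> rfl
  rw [hrw] at hind
  rw [map_affine_rows (h.law_bias k hk) (h.law_weight k hk) hind s]
  have hcov : (Matrix.of fun α β => (Cb : ℝ) + ∑ j, ((CW / (N k : ℝ≥0) : ℝ≥0) : ℝ) *
      (s j α * s j β)) = affineCov Cb CW
        (((N k : ℕ) : ℝ)⁻¹ • ∑ j, fun p : A × A => s j p.1 * s j p.2) := by
    ext α β
    simp [affineCov, Finset.mul_sum, div_eq_mul_inv, mul_assoc]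
  rw [hcov]
  rfl

lemma measurable_rows {n : ℕ} (q : Matrix A A ℝ) : Measurable (rows (n := n) q) := by
  unfold rows; fun_prop

/-- The rows of the first layer are independent Gaussian vectors with covariance `inputCov`. -/
lemma IsGaussianInit.lintegral_netArray_zero [IsProbabilityMeasure P]
    (h : IsGaussianInit P L N Cb CW b W) {Φ : (Fin (N (0 + 1)) → A → ℝ) → ℝ≥0∞}
    (hΦ : Measurable Φ) :
    ∫⁻ ω, Φ (netArray σ b W x 0 ω) ∂P
      = ∫⁻ u, Φ (rows (inputCov Cb CW x) u) ∂Measure.pi fun _ : Fin (N (0 + 1)) => stdNormal A := by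
  have h1 := h.map_rows (Nat.zero_le L) (fun r α => x α r)
  have hcov : affineCov (Cb : ℝ) CW
      (((N 0 : ℕ) : ℝ)⁻¹ • ∑ j, fun p : A × A => x p.1 j * x p.2 j) = inputCov Cb CW x := by
    ext α β
    simp [affineCov, inputCov, div_eq_mul_inv, mul_assoc]
  rw [hcov] at h1
  have hm : AEMeasurable (fun ω i α => b 0 i ω + ∑ j, W 0 i j ω * x α j) P :=
    aemeasurable_pi_lambda _ fun i => aemeasurable_pi_lambda _ fun α =>
      (h.law_bias 0 (Nat.zero_le L) i).aemeasurable.add (Finset.aemeasurable_fun_sum _ fun j _ =>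
        (h.law_weight 0 (Nat.zero_le L) i j).aemeasurable.mul_const _)
  rw [← lintegral_map hΦ (measurable_rows _), ← h1, lintegral_map' hΦ.aemeasurable hm]
  rfl

lemma measurable_preActivation (hσ : Continuous σ) {E : Type*} [MeasurableSpace E]
    {b : (ℓ : ℕ) → Fin (N (ℓ + 1)) → E → ℝ} {W : (ℓ : ℕ) → Fin (N (ℓ + 1)) → Fin (N ℓ) → E → ℝ}
    (hb : ∀ ℓ i, Measurable (b ℓ i)) (hW : ∀ ℓ i j, Measurable (W ℓ i j)) (x : Fin (N 0) → ℝ)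
    (k : ℕ) (i : Fin (N (k + 1))) :
    Measurable fun θ => preActivation N σ (fun ℓ i => b ℓ i θ) (fun ℓ i j => W ℓ i j θ) x k i := by
  induction k with
  | zero =>
    exact (hb 0 i).add (Finset.measurable_fun_sum _ fun r _ => (hW 0 i r).mul_const _)
  | succ k ih =>
    exact (hb (k + 1) i).add (Finset.measurable_fun_sum _ fun j _ => (hW (k + 1) i j).mul
      (hσ.measurable.comp (ih j)))

/-- Given the previous layer, a layer consists of independent Gaussian rows. -/
lemma IsGaussianInit.lintegral_netArray_succ [IsProbabilityMeasure P]
    (h : IsGaussianInit P L N Cb CW b W) (hσ : Continuous σ) {k : ℕ} (hk : k + 1 ≤ L)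
    {Φ : (Fin (N (k + 1 + 1)) → A → ℝ) → ℝ≥0∞} (hΦ : Measurable Φ) :
    ∫⁻ ω, Φ (netArray σ b W x (k + 1) ω) ∂P
      = ∫⁻ ω, ∫⁻ u, Φ (rows (netCov σ Cb CW b W x k ω) u)
        ∂(Measure.pi fun _ : Fin (N (k + 1 + 1)) => stdNormal A) ∂P := by
  classical
  let layer : ParamIndex L N → ℕ := Sum.elim (fun p => p.1) (fun p => p.1)
  let T : Finset (ParamIndex L N) := Finset.univ.filter fun p => layer p ≤ k
  let S : Finset (ParamIndex L N) := Finset.univ.filter fun p => layer p = k + 1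
  have hTS : Disjoint T S := Finset.disjoint_filter.2 fun p _ h1 h2 => by omega
  let f : ParamIndex L N → Ω → ℝ := Sum.elim (fun p => b p.1 p.2) (fun p => W p.1 p.2.1 p.2.2)
  have hf : ∀ p, AEMeasurable (f p) P := by
    rintro (p | p)
    · exact (h.law_bias _ (Nat.lt_succ_iff.1 p.1.2) _).aemeasurable
    · exact (h.law_weight _ (Nat.lt_succ_iff.1 p.1.2) _ _).aemeasurable
  have hind := h.indep.indepFun_finset₀ T S hTS hf
  have hlt : ∀ {ℓ : ℕ}, ℓ ≤ k → ℓ < L + 1 := fun hℓ => by omega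
  -- the lower layers as a function of the parameters entering them
  let bT : (ℓ : ℕ) → Fin (N (ℓ + 1)) → (T → ℝ) → ℝ := fun ℓ i θ =>
    if hℓ : ℓ ≤ k then
      θ ⟨Sum.inl ⟨⟨ℓ, hlt hℓ⟩, i⟩, Finset.mem_filter.2 ⟨Finset.mem_univ _, hℓ⟩⟩ else 0
  let WT : (ℓ : ℕ) → Fin (N (ℓ + 1)) → Fin (N ℓ) → (T → ℝ) → ℝ := fun ℓ i j θ =>
    if hℓ : ℓ ≤ k then
      θ ⟨Sum.inr ⟨⟨ℓ, hlt hℓ⟩, (i, j)⟩, Finset.mem_filter.2 ⟨Finset.mem_univ _, hℓ⟩⟩ else 0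
  have hbT : ∀ ℓ i, Measurable (bT ℓ i) := fun ℓ i => by
    by_cases hℓ : ℓ ≤ k
    · simp only [bT, dif_pos hℓ]; exact measurable_pi_apply _
    · simp only [bT, dif_neg hℓ]; exact measurable_const
  have hWT : ∀ ℓ i j, Measurable (WT ℓ i j) := fun ℓ i j => by
    by_cases hℓ : ℓ ≤ k
    · simp only [WT, dif_pos hℓ]; exact measurable_pi_apply _
    · simp only [WT, dif_neg hℓ]; exact measurable_const
  let act : (T → ℝ) → Fin (N (k + 1)) → A → ℝ := fun θ j α => σ (netArray σ bT WT x k θ j α)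
  have hact : Measurable act := measurable_pi_lambda _ fun j => measurable_pi_lambda _ fun α =>
    hσ.measurable.comp (measurable_preActivation hσ hbT hWT (x α) k j)
  have hactω : ∀ ω, act (fun p => f p ω) = fun j α => σ (netArray σ b W x k ω j α) := fun ω => by
    ext j α
    simp only [act, netArray]
    rw [preActivation_congr (x α) k]
    · intro ℓ hℓ; ext i; simp only [bT, dif_pos hℓ]; rfl
    · intro ℓ hℓ; ext i j; simp only [WT, dif_pos hℓ]; rfl
  -- the next layer as a function of the activations and of the parameters entering it
  let iS : Fin (N (k + 1 + 1)) → S := fun i =>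
    ⟨Sum.inl ⟨⟨k + 1, Nat.lt_succ_of_le hk⟩, i⟩, Finset.mem_filter.2 ⟨Finset.mem_univ _, rfl⟩⟩
  let jS : Fin (N (k + 1 + 1)) → Fin (N (k + 1)) → S := fun i j =>
    ⟨Sum.inr ⟨⟨k + 1, Nat.lt_succ_of_le hk⟩, (i, j)⟩, Finset.mem_filter.2 ⟨Finset.mem_univ _, rfl⟩⟩
  let out : (Fin (N (k + 1)) → A → ℝ) × (S → ℝ) → Fin (N (k + 1 + 1)) → A → ℝ := fun y i α =>
    y.2 (iS i) + ∑ j, y.2 (jS i j) * y.1 j α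
  have hout : Measurable out := by
    refine measurable_pi_lambda _ fun i => measurable_pi_lambda _ fun α => ?_
    refine ((measurable_pi_apply _).comp measurable_snd).add
      (Finset.measurable_fun_sum _ fun j _ => ((measurable_pi_apply _).comp measurable_snd).mul ?_)
    exact (measurable_pi_apply α).comp ((measurable_pi_apply j).comp measurable_fst)
  have hX : AEMeasurable (fun ω (p : T) => f p ω) P := aemeasurable_pi_lambda _ fun p => hf p
  have hY : AEMeasurable (fun ω (p : S) => f p ω) P := aemeasurable_pi_lambda _ fun p => hf p
  have hmain := lintegral_indepFun (hact.comp_aemeasurable hX) hY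
    (hind.comp hact measurable_id) (hΦ.comp hout)
  simp only [Function.comp_def] at hmain
  have hl : ∀ ω, out (act (fun p => f p ω), fun p => f p ω) = netArray σ b W x (k + 1) ω :=
      fun ω => by
    rw [hactω]; rfl
  simp only [hl] at hmain
  rw [hmain]
  refine lintegral_congr fun ω => ?_
  rw [hactω]
  have h1 := h.map_rows hk (fun j α => σ (netArray σ b W x k ω j α))
  have hm : AEMeasurable (fun ω' i α => b (k + 1) i ω' + ∑ j, W (k + 1) i j ω' *
      σ (netArray σ b W x k ω j α)) P :=
    aemeasurable_pi_lambda _ fun i => aemeasurable_pi_lambda _ fun α =>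
      (h.law_bias _ hk i).aemeasurable.add (Finset.aemeasurable_fun_sum _ fun j _ =>
        (h.law_weight _ hk i j).aemeasurable.mul_const _)
  have h2 := lintegral_map' hΦ.aemeasurable hm
  rw [h1, lintegral_map hΦ (measurable_rows _)] at h2
  exact h2.symm

end Network

/-! ### Free energies along the network -/

section NetworkMeasurability

variable {A : Type*} [Fintype A] {Ω : Type*} [MeasurableSpace Ω] {P : Measure Ω}
  {L : ℕ} {N : ℕ → ℕ} {Cb CW : ℝ≥0} {b : (ℓ : ℕ) → Fin (N (ℓ + 1)) → Ω → ℝ}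
  {W : (ℓ : ℕ) → Fin (N (ℓ + 1)) → Fin (N ℓ) → Ω → ℝ} {σ : ℝ → ℝ} {x : A → Fin (N 0) → ℝ}

lemma IsGaussianInit.aemeasurable_netArray (h : IsGaussianInit P L N Cb CW b W)
    (hσ : Continuous σ) {k : ℕ} (hk : k ≤ L) :
    AEMeasurable (netArray σ b W x k) P := by
  refine aemeasurable_pi_lambda _ fun i => aemeasurable_pi_lambda _ fun α => ?_
  induction k with
  | zero =>
    exact (h.law_bias 0 hk i).aemeasurable.add (Finset.aemeasurable_fun_sum _ fun r _ =>
      (h.law_weight 0 hk i r).aemeasurable.mul_const _)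
  | succ k ih =>
    exact (h.law_bias _ hk i).aemeasurable.add (Finset.aemeasurable_fun_sum _ fun j _ =>
      (h.law_weight _ hk i j).aemeasurable.mul
        (hσ.measurable.comp_aemeasurable (ih (by omega) j)))

/-- The rescaled output of the network. -/
def netOutput (σ : ℝ → ℝ) (b : (ℓ : ℕ) → Fin (N (ℓ + 1)) → Ω → ℝ)
    (W : (ℓ : ℕ) → Fin (N (ℓ + 1)) → Fin (N ℓ) → Ω → ℝ) (x : A → Fin (N 0) → ℝ) (L : ℕ) {m : ℕ}
    (hm : N (L + 1) = m) (v : ℝ) (ω : Ω) : A → Fin m → ℝ :=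
  fun α h => netArray σ b W x L ω (Fin.cast hm.symm h) α / √v

lemma IsGaussianInit.aemeasurable_netOutput (h : IsGaussianInit P L N Cb CW b W)
    (hσ : Continuous σ) {m : ℕ} (hm : N (L + 1) = m) (v : ℝ) :
    AEMeasurable (netOutput σ b W x L hm v) P := by
  have h1 := h.aemeasurable_netArray (x := x) hσ le_rfl
  refine aemeasurable_pi_lambda _ fun α => aemeasurable_pi_lambda _ fun i => ?_
  exact ((measurable_pi_apply α).comp_aemeasurable
    ((measurable_pi_apply _).comp_aemeasurable h1)).div_const _

end NetworkMeasurability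

section NetworkEnergy

lemma exp_freeEnergy {X : Type*} [MeasurableSpace X] {ρ : Measure X}
    [IsProbabilityMeasure ρ] {v B : ℝ} (hv : 0 < v) {f : X → ℝ} (hf0 : ∀ x, 0 ≤ f x)
    (hfB : ∀ x, f x ≤ B) :
    ENNReal.ofReal (Real.exp (-(v * freeEnergy v ρ f)))
      = ∫⁻ x, ENNReal.ofReal (Real.exp (-(v * f x))) ∂ρ := by
  have ht : ∫⁻ x, ENNReal.ofReal (Real.exp (-(v * f x))) ∂ρ ≠ ∞ :=
    ne_top_of_le_ne_top ENNReal.one_ne_top (lintegral_exp_le_one hv hf0)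
  have h0 : ∫⁻ x, ENNReal.ofReal (Real.exp (-(v * f x))) ∂ρ ≠ 0 :=
    ((ENNReal.ofReal_pos.2 (Real.exp_pos _)).trans_le (le_lintegral_exp hv hfB)).ne'
  rw [freeEnergy, mul_neg, neg_neg, mul_div_cancel₀ _ hv.ne',
    Real.exp_log (ENNReal.toReal_pos h0 ht), ENNReal.ofReal_toReal ht]

variable {A : Type*} [Fintype A] [DecidableEq A] {Ω : Type*} [MeasurableSpace Ω] {P : Measure Ω}
  [IsProbabilityMeasure P]
  {L : ℕ} {N : ℕ → ℕ} {Cb CW : ℝ≥0} {b : (ℓ : ℕ) → Fin (N (ℓ + 1)) → Ω → ℝ}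
  {W : (ℓ : ℕ) → Fin (N (ℓ + 1)) → Fin (N ℓ) → Ω → ℝ} {σ : ℝ → ℝ} {x : A → Fin (N 0) → ℝ}

/-- The integrand of the free energy of a hidden covariance, as a function of the array of
pre-activations. -/
lemma measurable_exp_cov {A : Type*} [Fintype A] {σ : ℝ → ℝ} (hσ : Continuous σ) {n : ℕ}
    {f : Matrix A A ℝ → ℝ} (hf : Measurable f)
    (Cb CW v : ℝ) : Measurable fun z : Fin n → A → ℝ =>
      ENNReal.ofReal (Real.exp (-(v * f (affineCov Cb CW ((n : ℝ)⁻¹ • ∑ j, fun p : A × A =>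
        σ (z j p.1) * σ (z j p.2)))))) := by
  have h1 : Measurable fun z : Fin n → A → ℝ =>
      ∑ j, fun p : A × A => σ (z j p.1) * σ (z j p.2) := by
    refine Finset.measurable_fun_sum _ fun j _ => measurable_pi_lambda _ fun p => ?_
    have h2 : ∀ α, Measurable fun z : Fin n → A → ℝ => σ (z j α) := fun α =>
      hσ.measurable.comp ((measurable_pi_apply α).comp (measurable_pi_apply j))
    exact (h2 p.1).mul (h2 p.2)
  have h3 := (hf.comp (continuous_affineCov (A := A) Cb CW).measurable).comp
    (h1.const_smul (n : ℝ)⁻¹)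
  exact ((h3.const_mul v).neg.exp).ennreal_ofReal

lemma IsGaussianInit.freeEnergy_netCov_zero (h : IsGaussianInit P L N Cb CW b W)
    (hσ : Continuous σ) {f : Matrix A A ℝ → ℝ} (hf : Measurable f) (v : ℝ) :
    freeEnergy v P (fun ω => f (netCov σ Cb CW b W x 0 ω))
      = layerEnergy σ Cb CW v (N (0 + 1)) f (inputCov Cb CW x) := by
  unfold layerEnergy freeEnergy
  rw [lintegral_exp_layerEnergy hσ hf]
  have := h.lintegral_netArray_zero (σ := σ) (x := x) (measurable_exp_cov hσ hf Cb CW v)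
  unfold netCov
  rw [this]
  rfl

lemma IsGaussianInit.freeEnergy_netCov_succ (h : IsGaussianInit P L N Cb CW b W)
    (hσ : Continuous σ) {k : ℕ} (hk : k + 1 ≤ L) {f : Matrix A A ℝ → ℝ} (hf : Measurable f)
    {B : ℝ} (hf0 : ∀ g, 0 ≤ f g) (hfB : ∀ g, f g ≤ B) {v : ℝ} (hv : 0 < v) :
    freeEnergy v P (fun ω => f (netCov σ Cb CW b W x (k + 1) ω))
      = freeEnergy v P fun ω =>
        layerEnergy σ Cb CW v (N (k + 1 + 1)) f (netCov σ Cb CW b W x k ω) := by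
  have h1 := h.lintegral_netArray_succ (x := x) hσ hk (measurable_exp_cov hσ hf Cb CW v)
  have h2 : ∀ q : Matrix A A ℝ,
      ENNReal.ofReal (Real.exp (-(v * layerEnergy σ Cb CW v (N (k + 1 + 1)) f q)))
      = ∫⁻ u, ENNReal.ofReal (Real.exp (-(v * f (affineCov Cb CW
        (((N (k + 1 + 1) : ℕ) : ℝ)⁻¹ • ∑ j, featurePair σ q (u j))))))
          ∂Measure.pi fun _ : Fin (N (k + 1 + 1)) => stdNormal A := fun q => by
    have := isProbabilityMeasure_empiricalLaw hσ q (N (k + 1 + 1))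
    rw [← lintegral_exp_layerEnergy hσ hf, layerEnergy,
      exp_freeEnergy hv (fun y => hf0 _) (fun y => hfB _)]
  have h3 : ∫⁻ ω, ENNReal.ofReal (Real.exp (-(v * f (netCov σ Cb CW b W x (k + 1) ω)))) ∂P
      = ∫⁻ ω, ENNReal.ofReal (Real.exp (-(v *
        layerEnergy σ Cb CW v (N (k + 1 + 1)) f (netCov σ Cb CW b W x k ω)))) ∂P := by
    simp only [h2]
    exact h1
  unfold freeEnergy
  rw [h3]

lemma IsGaussianInit.freeEnergy_netOutput {k : ℕ} (h : IsGaussianInit P (k + 1) N Cb CW b W)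
    (hσ : Continuous σ) {m : ℕ} (hm : N (k + 1 + 1) = m) {F : (A → Fin m → ℝ) → ℝ}
    (hF : Continuous F) {B : ℝ} (hF0 : ∀ z, 0 ≤ F z) (hFB : ∀ z, F z ≤ B) {v : ℝ} (hv : 0 < v) :
    freeEnergy v (P.map (netOutput σ b W x (k + 1) hm v)) F
      = freeEnergy v P fun ω => outputEnergy v F (netCov σ Cb CW b W x k ω) := by
  have hE : Measurable fun z : A → Fin m → ℝ => ENNReal.ofReal (Real.exp (-(v * F z))) :=
    ((hF.measurable.const_mul v).neg.exp).ennreal_ofReal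
  have h3 : ∫⁻ z, ENNReal.ofReal (Real.exp (-(v * F z))) ∂P.map (netOutput σ b W x (k + 1) hm v)
      = ∫⁻ ω, ENNReal.ofReal (Real.exp (-(v *
        outputEnergy v F (netCov σ Cb CW b W x k ω)))) ∂P := by
    rw [lintegral_map' hE.aemeasurable (h.aemeasurable_netOutput hσ hm v)]
    subst hm
    have hT : Measurable fun (z : Fin (N (k + 1 + 1)) → A → ℝ) (α : A) (i : Fin (N (k + 1 + 1))) =>
        z i α / √v := by fun_prop
    have h1 := h.lintegral_netArray_succ (x := x) hσ le_rfl (hE.comp hT)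
    refine h1.trans (lintegral_congr fun ω => ?_)
    set q := netCov σ Cb CW b W x k ω
    have hE' : Measurable fun r : A × Fin (N (k + 1 + 1)) → ℝ =>
        ENNReal.ofReal (Real.exp (-(v * F (outMap q r)))) :=
      hE.comp (measurable_outMap.comp measurable_prodMk_left)
    rw [outputEnergy, exp_freeEnergy hv (fun y => hF0 _) (fun y => hFB _), scaledNormal,
      lintegral_map hE' (measurable_scaling v)]
    refine lintegral_congr fun u => ?_
    have : (fun α i => rows q u i α / √v) = outMap q fun p : A × Fin _ => u p.2 p.1 / √v := by
      ext α i
      simp only [rows, outMap, Finset.sum_div, mul_div_assoc]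
    simp only [Function.comp_def, this]
  unfold freeEnergy
  rw [h3]

end NetworkEnergy

/-! ### The rate functions -/

section RateFunctions

variable {A : Type*} [Fintype A] [DecidableEq A] {σ : ℝ → ℝ} {M : ℝ} {Cb CW : ℝ} {γ : ℕ → ℝ≥0∞}
  {g₀ : Matrix A A ℝ}

lemma covRate_zero_self (g₀ : Matrix A A ℝ) : covRate σ Cb CW γ 0 g₀ g₀ = 0 := by
  refine le_antisymm ?_ zero_le
  refine iInf_le_of_le (fun _ => g₀) (iInf_le_of_le rfl (iInf_le_of_le rfl (iInf_le_of_le ?_ ?_)))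
  · intro ℓ _ h; omega
  · simp

lemma covRate_zero_ne {g : Matrix A A ℝ} (h : g ≠ g₀) : covRate σ Cb CW γ 0 g₀ g = ∞ := by
  simp only [covRate, iInf_eq_top]
  rintro G h0 h1
  exact absurd (h1.symm.trans h0) h

/-- The dynamic programming recursion of the covariance rate functions. -/
lemma covRate_succ (hg₀ : g₀ ∈ covSet A Cb) (ℓ : ℕ) (g : Matrix A A ℝ) :
    covRate σ Cb CW γ (ℓ + 1) g₀ g = ⨅ q ∈ covSet A Cb,
      (covRate σ Cb CW γ ℓ g₀ q + layerCost σ Cb CW (γ (ℓ + 1)) g q) := by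
  refine le_antisymm (le_iInf₂ fun q hq => ?_) ?_
  · conv_rhs => rw [covRate]
    simp only [ENNReal.iInf_add]
    refine le_iInf fun G => le_iInf fun h0 => le_iInf fun hℓ => le_iInf fun hG => ?_
    refine iInf_le_of_le (Function.update G (ℓ + 1) g) (iInf_le_of_le (by simp [h0])
      (iInf_le_of_le (by simp) (iInf_le_of_le ?_ ?_)))
    · intro j hj1 hj2
      rw [Function.update_of_ne (by omega)]
      rcases Nat.lt_succ_iff_lt_or_eq.1 hj2 with hj | rfl
      · exact hG j hj1 hj
      · rwa [hℓ]
    · rw [Finset.sum_Icc_succ_top (by omega)]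
      refine add_le_add (Finset.sum_le_sum fun j hj => ?_) ?_
      · rw [Finset.mem_Icc] at hj
        rw [Function.update_of_ne (by omega), Function.update_of_ne (by omega)]
      · rw [Function.update_self, Nat.add_sub_cancel, Function.update_of_ne (by omega), hℓ]
  · refine le_iInf fun G => le_iInf fun h0 => le_iInf fun hℓ => le_iInf fun hG => ?_
    have hmem : G ℓ ∈ covSet A Cb := by
      rcases Nat.eq_zero_or_pos ℓ with rfl | hpos
      · rwa [h0]
      · exact hG ℓ hpos (Nat.lt_succ_self ℓ)
    refine (iInf₂_le (G ℓ) hmem).trans ?_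
    rw [Finset.sum_Icc_succ_top (by omega), Nat.add_sub_cancel, hℓ]
    refine add_le_add ?_ le_rfl
    exact iInf_le_of_le G (iInf_le_of_le h0 (iInf_le_of_le rfl (iInf_le_of_le
      (fun j hj1 hj2 => hG j hj1 (hj2.trans (Nat.lt_succ_self ℓ))) le_rfl)))

/-- Minimizing over the last covariance first turns a test function `F` into the limiting energy of
the last layer. -/
lemma iInf_covRate_succ (hg₀ : g₀ ∈ covSet A Cb) (ℓ : ℕ) (F : Matrix A A ℝ → ℝ≥0∞) :
    ⨅ q ∈ covSet A Cb, (covRate σ Cb CW γ ℓ g₀ q +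
        ⨅ g ∈ covSet A Cb, (layerCost σ Cb CW (γ (ℓ + 1)) g q + F g))
      = ⨅ g ∈ covSet A Cb, (covRate σ Cb CW γ (ℓ + 1) g₀ g + F g) := by
  simp only [covRate_succ hg₀, ENNReal.add_iInf, ENNReal.iInf_add, add_assoc]
  rw [iInf_congr fun q => iInf_comm]
  rw [iInf_comm]
  refine iInf_congr fun g => ?_
  rw [iInf_congr fun q => iInf_comm, iInf_comm]

/-- Goodness of the covariance rate functions. -/
lemma isCompact_covRate_le (hσ : Continuous σ) (hM : ∀ t, |σ t| ≤ M) (hCW : 0 < CW)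
    (hg₀ : g₀ ∈ covSet A Cb) {ℓ : ℕ} (hγ : ∀ j ∈ Finset.Icc 1 ℓ, 1 ≤ γ j) (a : ℝ≥0) :
    IsCompact {g | ⨅ (_ : g ∈ covSet A Cb), covRate σ Cb CW γ ℓ g₀ g ≤ a} := by
  induction ℓ generalizing a with
  | zero =>
    refine ((Set.finite_singleton g₀).subset fun g hg => ?_).isCompact
    by_contra hne
    have h1 : ⨅ (_ : g ∈ covSet A Cb), covRate σ Cb CW γ 0 g₀ g = ∞ := by
      simp [covRate_zero_ne hne]
    have h2 : ⨅ (_ : g ∈ covSet A Cb), covRate σ Cb CW γ 0 g₀ g ≤ a := hg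
    rw [h1] at h2
    simp at h2
  | succ ℓ ih =>
    have hR := ih fun j hj => hγ j (Finset.Icc_subset_Icc_right ℓ.le_succ hj)
    have h1 : 1 ≤ γ (ℓ + 1) := hγ _ (Finset.mem_Icc.2 ⟨by omega, le_rfl⟩)
    convert isCompact_level_iInf_add hR (D := covSet A Cb)
      (J := fun q g => ⨅ (_ : g ∈ covSet A Cb), layerCost σ Cb CW (γ (ℓ + 1)) g q) ?_
      (fun K hKS hK c => isCompact_layerCost_le hσ hM hCW h1 hKS hK c) a using 4 with g
    · by_cases hg : g ∈ covSet A Cb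
      · simp only [hg, iInf_pos, covRate_succ hg₀, ENNReal.iInf_add]
      · simp [hg]
    · intro q hq
      by_contra hne
      exact hq (by simp [hne])

/-- The output rate is one more step of the chain of covariances. -/
lemma outputRate_eq {m : ℕ} (L : ℕ) (z : A → Fin m → ℝ) :
    outputRate σ Cb CW γ L g₀ z
      = ⨅ g, ((⨅ (_ : g ∈ covSet A Cb), covRate σ Cb CW γ L g₀ g) + outputCost g z) := by
  unfold outputRate outputCost
  refine iInf_congr fun g => ?_
  rw [ENNReal.iInf_add]
  refine iInf_congr fun _ => ?_
  simp only [ENNReal.add_iInf]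
  have hsurj : Function.Surjective fun (r : Matrix A (Fin m) ℝ) (p : A × Fin m) => r p.1 p.2 :=
    fun r => ⟨Matrix.of fun α h => r (α, h), rfl⟩
  rw [← hsurj.iInf_comp]
  refine iInf_congr fun r => ?_
  have hiff : psdSqrt g * r = Matrix.of z ↔ outMap g (fun p => r p.1 p.2) = z := by
    rfl
  have hsq : ∑ α, ∑ h, r α h ^ 2
      = (fun p : A × Fin m => r p.1 p.2) ⬝ᵥ fun p => r p.1 p.2 := by
    simp [dotProduct, Fintype.sum_prod_type, sq]
  simp only [hiff, hsq]

lemma isCompact_outputRate_le (hσ : Continuous σ) (hM : ∀ t, |σ t| ≤ M) (hCW : 0 < CW)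
    (hg₀ : g₀ ∈ covSet A Cb) {L m : ℕ} (hγ : ∀ j ∈ Finset.Icc 1 L, 1 ≤ γ j) (a : ℝ≥0) :
    IsCompact {z : A → Fin m → ℝ | outputRate σ Cb CW γ L g₀ z ≤ a} := by
  simp only [outputRate_eq]
  refine isCompact_level_iInf_add (isCompact_covRate_le hσ hM hCW hg₀ hγ) (D := covSet A Cb) ?_
    (fun K hKS hK c => isCompact_outputCost_le hKS hK c) a
  intro q hq
  by_contra hne
  exact hq (by simp [hne])

lemma iInf_outputRate_add {m : ℕ} (L : ℕ) (F : (A → Fin m → ℝ) → ℝ≥0∞) :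
    ⨅ g ∈ covSet A Cb, (covRate σ Cb CW γ L g₀ g + ⨅ z, (outputCost g z + F z))
      = ⨅ z, (outputRate σ Cb CW γ L g₀ z + F z) := by
  simp only [outputRate_eq, ENNReal.add_iInf, ENNReal.iInf_add, add_assoc]
  rw [iInf_comm]
  refine iInf_congr fun g => ?_
  rw [iInf_comm]

end RateFunctions

/-! ### The Laplace principle for the hidden covariances -/

section HiddenLaplace

variable {A : Type*} [Fintype A] [DecidableEq A] {σ : ℝ → ℝ} {M : ℝ} {Cb CW : ℝ≥0} {γ : ℕ → ℝ≥0∞}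
  {g₀ : Matrix A A ℝ} {L : ℕ} {N : ℕ → ℕ → ℕ} {v : ℕ → ℝ}
  {Ω : ℕ → Type*} [∀ n, MeasurableSpace (Ω n)] {P : (n : ℕ) → Measure (Ω n)}
  [∀ n, IsProbabilityMeasure (P n)]
  {b : (n ℓ : ℕ) → Fin (N n (ℓ + 1)) → Ω n → ℝ}
  {W : (n ℓ : ℕ) → Fin (N n (ℓ + 1)) → Fin (N n ℓ) → Ω n → ℝ}
  {x : (n : ℕ) → A → Fin (N n 0) → ℝ}

/-- The Laplace principle for the covariance of each hidden layer, by induction on the depth: the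
last layer is integrated out, which replaces the test functions by their layer energies. -/
theorem tendsto_freeEnergy_netCov (hσ : Continuous σ) (hM : ∀ t, |σ t| ≤ M) (hCW : 0 < CW)
    (hv : ∀ n, 0 < v n) (hvt : Tendsto v atTop atTop)
    (hNpos : ∀ n, ∀ ℓ ∈ Finset.Icc 1 L, 0 < N n ℓ)
    (hγ : ∀ ℓ ∈ Finset.Icc 1 L, 1 ≤ γ ℓ)
    (hr : ∀ ℓ ∈ Finset.Icc 1 L,
      Tendsto (fun n => ENNReal.ofReal (N n ℓ / v n)) atTop (𝓝 (γ ℓ)))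
    (hbW : ∀ n, IsGaussianInit (P n) L (N n) Cb CW (b n) (W n))
    (hx : ∀ n, inputCov (Cb : ℝ) CW (x n) = g₀) {k : ℕ} (hk : k + 1 ≤ L)
    {f : ℕ → Matrix A A ℝ → ℝ} {F : Matrix A A ℝ → ℝ≥0∞} {B : ℝ} (hf : ∀ n, Measurable (f n))
    (hf0 : ∀ n g, 0 ≤ f n g) (hfB : ∀ n g, f n g ≤ B)
    (hfF : ContConv atTop (covSet A (Cb : ℝ)) f F) :
    Tendsto (fun n => ENNReal.ofReal (freeEnergy (v n) (P n)
        fun ω => f n (netCov σ Cb CW (b n) (W n) (x n) k ω))) atTop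
      (𝓝 (⨅ g ∈ covSet A (Cb : ℝ), (covRate σ Cb CW γ (k + 1) g₀ g + F g))) := by
  have hg₀ : g₀ ∈ covSet A (Cb : ℝ) := by
    rw [← hx 0]; exact inputCov_mem_covSet Cb.2 CW.2 _
  induction k generalizing f F with
  | zero =>
    have hmem : 0 + 1 ∈ Finset.Icc 1 L := Finset.mem_Icc.2 ⟨le_rfl, hk⟩
    have h1 := contConv_layerEnergy hσ hM hv hvt (fun n => hNpos n _ hmem) (hγ _ hmem) (hr _ hmem)
      Cb.2 (NNReal.coe_pos.2 hCW) hf0 hfB hfF g₀ hg₀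
    have h2 : Tendsto (fun n : ℕ => (n, g₀)) atTop (atTop ×ˢ 𝓝[covSet A (Cb : ℝ)] g₀) :=
      tendsto_id.prodMk (tendsto_const_pure.mono_right (pure_le_nhdsWithin hg₀))
    have h3 := h1.comp h2
    have hval : ⨅ g ∈ covSet A (Cb : ℝ), (covRate σ Cb CW γ (0 + 1) g₀ g + F g)
        = ⨅ g ∈ covSet A (Cb : ℝ), (layerCost σ Cb CW (γ (0 + 1)) g g₀ + F g) := by
      rw [← iInf_covRate_succ hg₀]
      refine le_antisymm ?_ (le_iInf₂ fun q _ => ?_)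
      · refine (iInf₂_le g₀ hg₀).trans ?_
        exact (congrArg (· + _) (covRate_zero_self g₀)).trans (zero_add _) |>.le
      · by_cases hq : q = g₀
        · rw [hq]; exact le_add_self
        · rw [covRate_zero_ne hq, top_add]; exact le_top
    rw [hval]
    refine h3.congr fun n => ?_
    rw [(hbW n).freeEnergy_netCov_zero hσ (hf n), hx n]
    rfl
  | succ k ih =>
    have hmem : k + 1 + 1 ∈ Finset.Icc 1 L := Finset.mem_Icc.2 ⟨by omega, hk⟩
    have h1 := contConv_layerEnergy hσ hM hv hvt (fun n => hNpos n _ hmem) (hγ _ hmem) (hr _ hmem)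
      Cb.2 (NNReal.coe_pos.2 hCW) hf0 hfB hfF
    have h2 := ih (by omega) (fun n => measurable_layerEnergy hσ (hf n))
      (fun n q => by
        have := isProbabilityMeasure_empiricalLaw hσ q (N n (k + 1 + 1))
        exact freeEnergy_nonneg (hv n) (fun y => hf0 n _) fun y => hfB n _)
      (fun n q => by
        have := isProbabilityMeasure_empiricalLaw hσ q (N n (k + 1 + 1))
        exact freeEnergy_le_of_le (hv n) (fun y => hf0 n _) fun y => hfB n _) h1
    have h3 := iInf_covRate_succ (σ := σ) (CW := (CW : ℝ)) (γ := γ) hg₀ (k + 1) F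
    refine (h2.mono_right (congrArg 𝓝 h3).le).congr fun n => ?_
    rw [(hbW n).freeEnergy_netCov_succ hσ (by omega) (hf n) (hf0 n) (hfB n) (hv n)]
    rfl

end HiddenLaplace

lemma inputCov_cast {A : Type*} [Fintype A] {n₀ n : ℕ} (h : n = n₀) (Cb CW : ℝ)
    (x : A → Fin n₀ → ℝ) :
    inputCov Cb CW (fun α (r : Fin n) => x α (Fin.cast h r)) = inputCov Cb CW x := by
  subst h; rfl

end DeepLDP

end

theorem mainTheorem1
    -- depth, input and output dimensions, finite family of inputs
    (L : ℕ) (hL : 1 ≤ L) (n₀ nOut : ℕ) (hn₀ : 0 < n₀) (hnOut : 0 < nOut)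
    {A : Type*} [Fintype A] [DecidableEq A] (x : A → Fin n₀ → ℝ)
    -- the activation is continuous and bounded
    (σ : ℝ → ℝ) (hσ : Continuous σ) (hσb : ∃ M : ℝ, ∀ t, |σ t| ≤ M)
    (Cb CW : ℝ≥0) (hCW : 0 < CW)
    -- widths `N n ℓ` of the `n`-th network; the hidden ones diverge at comparable or larger rates
    (N : ℕ → ℕ → ℕ) (hN0 : ∀ n, N n 0 = n₀) (hNout : ∀ n, N n (L + 1) = nOut)
    (hNpos : ∀ n, ∀ ℓ ∈ Finset.Icc 1 L, 0 < N n ℓ)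
    (hNtop : ∀ ℓ ∈ Finset.Icc 1 L, Tendsto (fun n => N n ℓ) atTop atTop)
    (ℓhat : ℕ) (hℓhat : ℓhat ∈ Finset.Icc 1 L)
    (γ : ℕ → ℝ≥0∞) (hγ : ∀ ℓ ∈ Finset.Icc 1 L, 1 ≤ γ ℓ)
    (hNγ : ∀ ℓ ∈ Finset.Icc 1 L,
      Tendsto (fun n => (N n ℓ : ℝ≥0∞) / (N n ℓhat : ℝ≥0∞)) atTop (𝓝 (γ ℓ)))
    -- Gaussian biases and weights
    {Ω : ℕ → Type*} [∀ n, MeasurableSpace (Ω n)] (P : (n : ℕ) → Measure (Ω n))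
    [∀ n, IsProbabilityMeasure (P n)]
    (b : (n ℓ : ℕ) → Fin (N n (ℓ + 1)) → Ω n → ℝ)
    (W : (n ℓ : ℕ) → Fin (N n (ℓ + 1)) → Fin (N n ℓ) → Ω n → ℝ)
    (hbW : ∀ n, DeepLDP.IsGaussianInit (P n) L (N n) Cb CW (b n) (W n)) :
    DeepLDP.IsGoodLDP (X := A → Fin nOut → ℝ)
      (fun n => (N n ℓhat : ℝ))
      (fun n => (P n).map fun ω α h =>
        DeepLDP.preActivation (N n) σ (fun ℓ i => b n ℓ i ω) (fun ℓ i j => W n ℓ i j ω)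
            (fun r => x α (Fin.cast (hN0 n) r)) L (Fin.cast (hNout n).symm h)
          / √(N n ℓhat : ℝ))
      (DeepLDP.outputRate σ Cb CW γ L (DeepLDP.inputCov (Cb : ℝ) CW x)) := by
  obtain ⟨M, hM⟩ := hσb
  obtain ⟨k, rfl⟩ : ∃ k, L = k + 1 := ⟨L - 1, by omega⟩
  have hv : ∀ n, (0 : ℝ) < N n ℓhat := fun n => Nat.cast_pos.2 (hNpos n _ hℓhat)
  have hvt : Tendsto (fun n => (N n ℓhat : ℝ)) atTop atTop :=
    tendsto_natCast_atTop_atTop.comp (hNtop _ hℓhat)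
  have hCW' : (0 : ℝ) < CW := NNReal.coe_pos.2 hCW
  have hr : ∀ ℓ ∈ Finset.Icc 1 (k + 1),
      Tendsto (fun n => ENNReal.ofReal ((N n ℓ : ℝ) / (N n ℓhat : ℝ))) atTop (𝓝 (γ ℓ)) :=
    fun ℓ hℓ => (hNγ ℓ hℓ).congr fun n => by
      rw [ENNReal.ofReal_div_of_pos (hv n), ENNReal.ofReal_natCast, ENNReal.ofReal_natCast]
  let x' : (n : ℕ) → A → Fin (N n 0) → ℝ := fun n α r => x α (Fin.cast (hN0 n) r)
  have hx : ∀ n, DeepLDP.inputCov (Cb : ℝ) CW (x' n) = DeepLDP.inputCov (Cb : ℝ) CW x := fun n =>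
    DeepLDP.inputCov_cast (hN0 n) _ _ x
  have hg₀ : DeepLDP.inputCov (Cb : ℝ) CW x ∈ DeepLDP.covSet A (Cb : ℝ) :=
    DeepLDP.inputCov_mem_covSet Cb.2 CW.2 x
  change DeepLDP.IsGoodLDP (fun n => (N n ℓhat : ℝ))
    (fun n => (P n).map (DeepLDP.netOutput σ (b n) (W n) (x' n) (k + 1) (hNout n) (N n ℓhat))) _
  refine DeepLDP.isGoodLDP_of_laplace hv hvt
    (fun n => Measure.isProbabilityMeasure_map ((hbW n).aemeasurable_netOutput hσ (hNout n) _))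
    (DeepLDP.isCompact_outputRate_le hσ hM hCW' hg₀ hγ) ?_
  rintro F hF hF0 ⟨B, hFB⟩
  have h1 := DeepLDP.tendsto_freeEnergy_netCov hσ hM hCW hv hvt hNpos hγ hr hbW hx le_rfl
    (fun n => DeepLDP.measurable_outputEnergy (v := N n ℓhat) hF)
    (fun n q => DeepLDP.freeEnergy_nonneg (hv n) (fun r => hF0 _) fun r => hFB _)
    (fun n q => DeepLDP.freeEnergy_le_of_le (hv n) (fun r => hF0 _) fun r => hFB _)
    (DeepLDP.contConv_outputEnergy hv hvt hF hF0 hFB)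
  rw [DeepLDP.iInf_outputRate_add] at h1
  refine h1.congr fun n => ?_
  rw [(hbW n).freeEnergy_netOutput hσ (hNout n) hF hF0 hFB (hv n)]
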